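/- \textbf{Setting.} Let $\mathcal T=\mathbb R/\mathbb Z\simeq[0,1)$ with Lebesgue measure and geodesic distance $\mathrm{dist}$, let $\alpha\in(0,1]$, and let $R:[0,1]\to\mathbb R$ be $\alpha$-Hölder continuous ($R(0)\ne R(1)$ is allowed). Let $$p(t;x,\tilde x)=\sum_{i\in\mathbb Z}\frac1{\sqrt{2\pi t}}\,e^{-|x-\tilde x+i|^2/(2t)},\qquad x,\tilde x\in[0,1),\ t>0,$$ be the heat kernel on $\mathcal T$, let $\Sigma_n(t)=\{(s_0,\dots,s_n)\in(0,\infty)^{n+1}:s_0+\dots+s_n=t\}$ with $n$-dimensional Lebesgue measure $d^n\vec s=ds_1\cdots ds_n$ (so $\Sigma_n(0)=\emptyset$), and for $n\ge 1$, $x_0:=x$, $x_{n+1}:=\tilde x$, put $$\mathcal S_n(t;x,\tilde x)=\int_{\Sigma_n(t)}\mathcal I_n(\vec s;x,\tilde x)\,d^n\vec s,\qquad \mathcal I_n(\vec s;x,\tilde x)=\int_{\mathcal T^n}\prod_{i=0}^n p(s_i;x_i,x_{i+1})\prod_{i=1}^n dR(x_i),$$ where the integral against $dR$ is an iterated Riemann–Stieltjes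 integral, each variable running over $[0,1]$. Let $H^1(\mathcal T)=\{f\in L^2(\mathcal T): f'\in L^2(\mathcal T)\}$ (weak derivative; $f(1)$ is the value of the continuous representative at $1\equiv0$) and, for $f,g\in H^1(\mathcal T)$, $$F_R(f,g)=\tfrac12\langle f',g'\rangle-f(1)g(1)\,(R(1)-R(0))+\int_0^1(f'g+fg')(x)R(x)\,dx .$$ Let $\mathcal H=\frac12\partial_{xx}+R'$ be the operator on $L^2(\mathcal T)$ associated with $-F_R$: $f\in D(\mathcal H)$ and $\mathcal Hf=w$ if and only if $f\in H^1(\mathcal T)$ and $F_R(f,g)=-\langle w,g\rangle$ for all $g\in H^1(\mathcal T)$. \textbf{Proposition.} The integrals defining $\mathcal I_n$ exist for all $s_0,\dots,s_n>0$, and $\mathcal I_n(\cdot\,;x,\tilde x)$ is Lebesgue integrable over $\Sigma_n(t)$. For every $T<\infty$ the series $\mathcal R(t;x,\tilde x):=\sum_{n\ge1}\mathcal S_n(t;x,\tilde x)$ converges absolutely, and uniformly over $x,\tilde x\in\mathcal T$ and $t\in[0,T]$; moreover $\mathcal R(t;x,\cdot)$ is integrable and, with a constant $c(T)$ and, for each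 $u\in(0,1]$, a constant $c(u,T)$ (both may depend on the fixed $R$), for all $x,x',\tilde x\in\mathcal T$ and $t\in[0,T]$ ($t\in(0,T]$ in (d)): (a) $\displaystyle\int_{\mathcal T}|\mathcal R(t;x,\tilde x)|\,d\tilde x\le c(T)$; (b) $\displaystyle\int_{\mathcal T}|\mathcal R(t;x,\tilde x)-\mathcal R(t;x',\tilde x)|\,d\tilde x\le \mathrm{dist}(x,x')^u\,c(u,T)$; (c) $|\mathcal R(t;x,\tilde x)|\le c(T)$; (d) $\displaystyle|\mathcal R(t;x,\tilde x)-\mathcal R(t;x',\tilde x)|\le\frac{\mathrm{dist}(x,x')^u}{t^{u/2}}\,c(u,T)$. Furthermore, let $\mathcal S(t;x,\tilde x)=p(t;x,\tilde x)+\mathcal R(t;x,\tilde x)$, $(\mathcal S(t)f)(x)=\int_{\mathcal T}\mathcal S(t;x,\tilde x)f(\tilde x)\,d\tilde x$ for $t>0$, and $\mathcal S(0)=\mathrm{Id}$. Then each $\mathcal S(t)$, $t\ge0$, is a bounded linear operator $C(\mathcal T)\to C(\mathcal T)$, and $\mathcal S(t+s)=\mathcal S(t)\mathcal S(s)$ for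 $s,t\ge0$. The operator $\mathcal H$ is well defined, densely defined and self-adjoint on $L^2(\mathcal T)$, and $\mathcal S(t)$ is the semigroup of $\mathcal H$: the same kernels define bounded operators on $L^2(\mathcal T)$ forming a strongly continuous semigroup whose generator is exactly $\mathcal H$, i.e. for $f,w\in L^2(\mathcal T)$, $\frac1t(\mathcal S(t)f-f)\to w$ in $L^2(\mathcal T)$ as $t\downarrow0$ if and only if $f\in D(\mathcal H)$ and $\mathcal Hf=w$. -/

import Mathlib

open Set Filter Topology MeasureTheory

noncomputable section

namespace RoughTorus

/-- The continuum torus `ℝ / ℤ`, with its quotient metric `dist` (the geodesic distance) and with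
Lebesgue measure `volume` (of total mass one). -/
abbrev Torus : Type := UnitAddCircle

/-- The real Hilbert space `L²(ℝ / ℤ)`. -/
abbrev L2 : Type := Lp ℝ 2 (volume : Measure Torus)

/-- The representative in `[0, 1)` of a point of the torus. -/
def rep (x : Torus) : ℝ := (AddCircle.equivIco (1 : ℝ) 0 x : ℝ)

/-- The heat kernel of `½ ∂ₓₓ` on the torus (for `t > 0`). -/
def heatKernel (t : ℝ) (x y : Torus) : ℝ :=
  ∑' i : ℤ, 1 / Real.sqrt (2 * Real.pi * t) * Real.exp (-(|rep x - rep y + i| ^ 2) / (2 * t))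

/-! ### Riemann–Stieltjes integrals over `[0, 1]` -/

/-- `I` is the Riemann–Stieltjes integral `∫_{[0,1]} φ dR`: the limit, as the mesh of the tagged
partition `0 = a 0 ≤ ξ 0 ≤ a 1 ≤ ξ 1 ≤ … ≤ a m = 1` tends to zero, of the sums
`∑ φ (ξ j) (R (a (j+1)) - R (a j))`. -/
def HasRSIntegral (φ R : ℝ → ℝ) (I : ℝ) : Prop :=
  ∀ ε > 0, ∃ δ > 0, ∀ (m : ℕ) (a ξ : ℕ → ℝ), a 0 = 0 → a m = 1 →
    (∀ j < m, a j ≤ ξ j ∧ ξ j ≤ a (j + 1) ∧ a (j + 1) - a j < δ) →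
    |∑ j ∈ Finset.range m, φ (ξ j) * (R (a (j + 1)) - R (a j)) - I| < ε

/-- Existence of the Riemann–Stieltjes integral. -/
def RSIntegrable (φ R : ℝ → ℝ) : Prop := ∃ I, HasRSIntegral φ R I

open Classical in
/-- The value of the Riemann–Stieltjes integral `∫_{[0,1]} φ dR` (zero if it does not exist). -/
def rsIntegral (φ R : ℝ → ℝ) : ℝ := if h : RSIntegrable φ R then h.choose else 0

/-- The `n`-fold Riemann–Stieltjes integral `∫_{𝕋ⁿ} φ(x₁, …, xₙ) dR(xₙ) ⋯ dR(x₁)`, each variable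
running once through the torus, cut open at `0` (a jump of `R` there is not picked up). -/
def rsIntegralN (R : ℝ → ℝ) : (n : ℕ) → ((Fin n → Torus) → ℝ) → ℝ
  | 0, φ => φ Fin.elim0
  | n + 1, φ => rsIntegral (fun x : ℝ =>
      rsIntegralN R n (fun z => φ (Fin.cons (α := fun _ => Torus) (x : Torus) z))) R

/-- All the Riemann–Stieltjes integrals in the `n`-fold integral exist. -/
def RSIntegrableN (R : ℝ → ℝ) : (n : ℕ) → ((Fin n → Torus) → ℝ) → Prop
  | 0, _ => True
  | n + 1, φ =>
      (∀ x : ℝ, RSIntegrableN R n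
        (fun z => φ (Fin.cons (α := fun _ => Torus) (x : Torus) z))) ∧
      RSIntegrable (fun x : ℝ =>
        rsIntegralN R n (fun z => φ (Fin.cons (α := fun _ => Torus) (x : Torus) z))) R

/-! ### The kernel series -/

/-- The points `x₀ = x, x₁, …, xₙ, xₙ₊₁ = y`. -/
def path {n : ℕ} (x y : Torus) (z : Fin n → Torus) : Fin (n + 2) → Torus :=
  Fin.cons (α := fun _ => Torus) x (Fin.snoc (α := fun _ => Torus) z y)

/-- The product `∏_{i=0}^n p(sᵢ; xᵢ, xᵢ₊₁)` as a function of `(x₁, …, xₙ)`. -/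
def pathWeight {n : ℕ} (s : Fin (n + 1) → ℝ) (x y : Torus) (z : Fin n → Torus) : ℝ :=
  ∏ i : Fin (n + 1), heatKernel (s i) (path x y z i.castSucc) (path x y z i.succ)

/-- `∫_{𝕋ⁿ} ∏_{i=0}^n p(sᵢ; xᵢ, xᵢ₊₁) ∏_{i=1}^n dR(xᵢ)`, with `x₀ = x` and `xₙ₊₁ = y`. -/
def innerTerm (R : ℝ → ℝ) {n : ℕ} (s : Fin (n + 1) → ℝ) (x y : Torus) : ℝ :=
  rsIntegralN R n (pathWeight s x y)

/-- The simplex `{(s₀, …, sₙ) ∈ (0,∞)ⁿ⁺¹ : s₀ + ⋯ + sₙ = t}` in the coordinates `(s₁, …, sₙ)`. -/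
def simplex (n : ℕ) (t : ℝ) : Set (Fin n → ℝ) := {s | (∀ i, 0 < s i) ∧ ∑ i, s i < t}

/-- The point of the simplex with coordinates `(s₁, …, sₙ)`: `s₀ = t - (s₁ + ⋯ + sₙ)`. -/
def fullTimes {n : ℕ} (t : ℝ) (s : Fin n → ℝ) : Fin (n + 1) → ℝ :=
  Fin.cons (α := fun _ => ℝ) (t - ∑ i, s i) s

/-- The `n`-th term of the kernel series. -/
def seriesTerm (R : ℝ → ℝ) (n : ℕ) (t : ℝ) (x y : Torus) : ℝ :=
  ∫ s in simplex n t, innerTerm R (fullTimes t s) x y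

/-- The remainder `∑_{n ≥ 1}` of the kernel series. -/
def remainder (R : ℝ → ℝ) (t : ℝ) (x y : Torus) : ℝ :=
  ∑' n : ℕ, seriesTerm R (n + 1) t x y

/-- The kernel `p + ∑_{n ≥ 1}` (for `t > 0`). -/
def kernel (R : ℝ → ℝ) (t : ℝ) (x y : Torus) : ℝ := heatKernel t x y + remainder R t x y

/-- The action of the kernel on functions; the heat kernel at `t = 0` is the Dirac mass and the
remainder vanishes there, so time `0` acts as the identity. -/
def kernelOp (R : ℝ → ℝ) (t : ℝ) (f : Torus → ℝ) (x : Torus) : ℝ :=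
  if t = 0 then f x else ∫ y, kernel R t x y * f y

/-! ### The quadratic form -/

/-- `f'` is the weak derivative of `f` on the torus, tested against smooth periodic functions. -/
def IsWeakDeriv (f f' : L2) : Prop :=
  ∀ φ : ℝ → ℝ, ContDiff ℝ (⊤ : ℕ∞) φ → Function.Periodic φ 1 →
    ∫ x in (0 : ℝ)..1, f (x : Torus) * deriv φ x = - ∫ x in (0 : ℝ)..1, f' (x : Torus) * φ x

/-- The Sobolev space `H¹` of the torus, as a subset of `L²`. -/
def MemH1 (f : L2) : Prop := ∃ f', IsWeakDeriv f f'

open Classical in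
/-- The weak derivative of an element of `H¹`. -/
def weakDeriv (f : L2) : L2 := if h : MemH1 f then h.choose else 0

open Classical in
/-- The value at `x` of the continuous representative of `f`, which every `f` in `H¹` has. -/
def pointValue (f : L2) (x : Torus) : ℝ :=
  if h : ∃ F : C(Torus, ℝ), (F : Torus → ℝ) =ᵐ[volume] f then h.choose x else 0

/-- The form `½⟨f', g'⟩ - f(1) g(1) (R(1) - R(0)) + ∫₀¹ (f' g + f g') R dx` on `H¹ × H¹`.
The points `0` and `1` coincide on the torus. -/
def form (R : ℝ → ℝ) (f g : L2) : ℝ :=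
  1 / 2 * (∫ x : Torus, weakDeriv f x * weakDeriv g x)
    - pointValue f ((1 : ℝ) : Torus) * pointValue g ((1 : ℝ) : Torus) * (R 1 - R 0)
    + ∫ x in (0 : ℝ)..1,
        (weakDeriv f (x : Torus) * g (x : Torus) + f (x : Torus) * weakDeriv g (x : Torus)) * R x

/-- `H` is the operator associated with the form: `f` is in the domain with `H f = w` exactly when
`f ∈ H¹` and `-⟨w, g⟩` is the value of the form at `(f, g)` for all `g ∈ H¹`. -/
def IsFormOperator (R : ℝ → ℝ) (H : L2 →ₗ.[ℝ] L2) : Prop :=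
  ∀ f w : L2, (f, w) ∈ H.graph ↔
    MemH1 f ∧ ∀ g : L2, MemH1 g → form R f g = - ∫ x : Torus, w x * g x

end RoughTorus

end

/-! Put κ = R(1) − R(0) and R = κx + ρ. Then ρ agrees at 0 and 1, so it is an α-Hölder function on
the circle. Integration by parts turns the Stieltjes integral of a periodic C¹ function φ into the
Lebesgue integral κ∫φ − ∫φ'ρ (`hasRSIntegral_pairing`); the jump of R at 0 survives only through the
term κ dx.

The analytic core is the rough step ∫ p(a; w, z) p(b; z, w') dR(z). Its derivative terms are
singular like a^(-1/2) and b^(-1/2), but after subtracting ρ(w), respectively ρ(w'), the Hölder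
increment improves the exponent to −(1−α)/2, and the subtracted constants recombine by the semigroup
law (`abs_stepKernel_le`). Cutting in half each heat kernel that follows a rough variable writes the
n-fold Stieltjes integral as an ordinary iterated integral of rough steps, a `chain`, along which
Gaussian bounds propagate (`abs_chain_le`). The times enter as s₀^(-(1-α)/2) ∏ sᵢ^(α-1), whose
integral over the simplex is a Dirichlet integral; the resulting Gamma quotients form a
Mittag-Leffler series. This yields absolute and uniform convergence. Regularity in x follows because
half of the first heat kernel carries the whole dependence on x.

On the operator side the form is bounded below on H¹. Lax–Milgram and the compact embedding of H¹ in
L² give a compact, symmetric, injective resolvent, hence a self-adjoint H with a total set of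
eigenvectors (`exists_form_operator`).

The two sides meet on eigenvectors. If He = μe, the heat flow of e solves u' = μu − (rough source).
Variation of constants in the first time of each chain expresses the n-th term of the series,
integrated against e, as a difference A(n−1) − A(n) of source terms, with e^(μt) e(y) in place of
A(−1). The series therefore telescopes to e^(μt) e(y) (`IsEigenpair.integral_kernel_mul`). This
diagonalises the transposed kernel operator; orthogonality of eigenvectors with distinct eigenvalues
shows that the kernel operator equals its transpose. The semigroup law, strong continuity and the
generator are then read off from eigenvectors, and the law passes to C(𝕋) because C(𝕋) injects into
L². -/

noncomputable section

/-! ### Heat kernel on the circle: Fourier series, Gaussian series, smoothness. -/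

namespace RoughTorus

/-! ### The heat kernel as a theta function -/

/-- The heat kernel of `½ ∂ₓₓ` as a function on the torus (zero for `t ≤ 0`). -/
def heat (t : ℝ) (x : Torus) : ℝ := HurwitzZeta.cosKernel x (2 * Real.pi * t)

/-- The space derivative of `heat`. -/
def heatD (t : ℝ) (x : Torus) : ℝ := -(2 * Real.pi) * HurwitzZeta.sinKernel x (2 * Real.pi * t)

/-- The second space derivative of `heat`. -/
def heatDD (t : ℝ) (x : Torus) : ℝ :=
  ∑' n : ℤ, -(2 * Real.pi * n) ^ 2 * Real.exp (-(2 * Real.pi ^ 2 * n ^ 2 * t)) * (fourier n x).re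

/-- Majorant for every termwise differentiation of the theta series below. -/
lemma summable_pow_mul_exp_sq (k : ℕ) {c : ℝ} (hc : 0 < c) :
    Summable fun n : ℤ => |(n : ℝ)| ^ k * Real.exp (-(c * n ^ 2)) := by
  have h := summable_pow_mul_jacobiTheta₂_term_bound 0 (T := c / Real.pi)
    (div_pos hc Real.pi_pos) k
  refine h.congr fun n => ?_
  congr 2
  · push_cast; rfl
  · field_simp; ring

lemma fourier_re_coe (n : ℤ) (x : ℝ) : (fourier n (x : Torus)).re = Real.cos (2 * Real.pi * n * x) := by
  rw [fourier_coe_apply]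
  have : (2 * Real.pi * Complex.I * n * x / (1 : ℝ) : ℂ)
      = ((2 * Real.pi * n * x : ℝ) : ℂ) * Complex.I := by push_cast; ring
  rw [this, Complex.exp_ofReal_mul_I_re]

lemma hasSum_heat {t : ℝ} (ht : 0 < t) (x : ℝ) :
    HasSum (fun n : ℤ => Real.exp (-(2 * Real.pi ^ 2 * n ^ 2 * t)) * Real.cos (2 * Real.pi * n * x))
      (heat t x) := by
  have h := Complex.hasSum_re (HurwitzZeta.hasSum_int_cosKernel x
    (t := 2 * Real.pi * t) (by positivity))
  rw [Complex.ofReal_re] at h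
  refine h.congr_fun fun n => ?_
  have : (2 * Real.pi * Complex.I * x * n : ℂ) = ((2 * Real.pi * n * x : ℝ) : ℂ) * Complex.I := by
    push_cast; ring
  rw [this, mul_comm (Complex.exp _), Complex.re_ofReal_mul, Complex.exp_ofReal_mul_I_re]
  congr 2
  ring

lemma hasSum_heatD {t : ℝ} (ht : 0 < t) (x : ℝ) :
    HasSum (fun n : ℤ => -(2 * Real.pi * n) * Real.exp (-(2 * Real.pi ^ 2 * n ^ 2 * t))
      * Real.sin (2 * Real.pi * n * x)) (heatD t x) := by
  have h := Complex.hasSum_re (HurwitzZeta.hasSum_int_sinKernel x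
    (t := 2 * Real.pi * t) (by positivity))
  rw [Complex.ofReal_re] at h
  refine (h.mul_left (-(2 * Real.pi))).congr_fun fun n => ?_
  have : (2 * Real.pi * Complex.I * x * n : ℂ) = ((2 * Real.pi * n * x : ℝ) : ℂ) * Complex.I := by
    push_cast; ring
  rw [this, mul_comm (_ * Complex.exp _), Complex.re_ofReal_mul, Complex.mul_re,
    Complex.exp_ofReal_mul_I_re, Complex.exp_ofReal_mul_I_im]
  simp
  have e : Real.exp (-(2 * Real.pi ^ 2 * n ^ 2 * t)) = Real.exp (-(Real.pi * n ^ 2 * (2 * Real.pi * t))) := by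
    congr 1; ring
  rw [e]; ring

/-- Poisson summation, in the form of the functional equation of the theta function: time 2πt on the
Fourier side becomes 1/(2πt) on the Gaussian side. The Fourier form serves for differentiation and
convolution, the Gaussian form for positivity and bounds. -/
lemma hasSum_heat_gauss {t : ℝ} (ht : 0 < t) (x : ℝ) :
    HasSum (fun n : ℤ => 1 / Real.sqrt (2 * Real.pi * t) * Real.exp (-(x + n) ^ 2 / (2 * t)))
      (heat t x) := by
  have hp : 0 < 1 / (2 * Real.pi * t) := by positivity
  have h := (HurwitzZeta.hasSum_int_evenKernel x hp).mul_left (1 / Real.sqrt (2 * Real.pi * t))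
  rw [HurwitzZeta.evenKernel_functional_equation, one_div_one_div, ← Real.sqrt_eq_rpow,
    ← mul_assoc] at h
  have e : 1 / Real.sqrt (2 * Real.pi * t) * (1 / Real.sqrt (1 / (2 * Real.pi * t))) = 1 := by
    rw [Real.sqrt_div zero_le_one, Real.sqrt_one]
    have : Real.sqrt (2 * Real.pi * t) ≠ 0 := by positivity
    field_simp
  rw [e, one_mul] at h
  refine h.congr_fun fun n => ?_
  congr 2
  field_simp
  ring

/-- The odd theta function has weight 3/2; the extra power of t compared with the even one is the
factor 1/t in the derivative of a Gaussian. -/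
lemma hasSum_heatD_gauss {t : ℝ} (ht : 0 < t) (x : ℝ) :
    HasSum (fun n : ℤ => -((x + n) / t) *
      (1 / Real.sqrt (2 * Real.pi * t) * Real.exp (-(x + n) ^ 2 / (2 * t)))) (heatD t x) := by
  have hp : 0 < 1 / (2 * Real.pi * t) := by positivity
  have hq : 0 < 2 * Real.pi * t := by positivity
  have h := (HurwitzZeta.hasSum_int_oddKernel x hp).mul_left
    (-(1 / t) * (1 / Real.sqrt (2 * Real.pi * t)))
  rw [HurwitzZeta.oddKernel_functional_equation, one_div_one_div] at h
  have e : -(1 / t) * (1 / Real.sqrt (2 * Real.pi * t)) *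
      (1 / (1 / (2 * Real.pi * t)) ^ (3 / 2 : ℝ) * HurwitzZeta.sinKernel x (2 * Real.pi * t))
      = heatD t x := by
    have h3 : (1 / (2 * Real.pi * t)) ^ (3 / 2 : ℝ)
        = 1 / (2 * Real.pi * t * Real.sqrt (2 * Real.pi * t)) := by
      rw [show (3 / 2 : ℝ) = 1 + 1 / 2 by norm_num, Real.rpow_add hp, Real.rpow_one,
        ← Real.sqrt_eq_rpow, Real.sqrt_div zero_le_one, Real.sqrt_one]
      field_simp
    rw [h3, heatD]
    have : Real.sqrt (2 * Real.pi * t) ≠ 0 := by positivity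
    field_simp
  rw [e] at h
  refine h.congr_fun fun n => ?_
  have : -Real.pi * (n + x) ^ 2 * (1 / (2 * Real.pi * t)) = -(x + n) ^ 2 / (2 * t) := by
    field_simp; ring
  rw [this]; ring

lemma coe_rep (x : Torus) : ((rep x : ℝ) : Torus) = x :=
  (AddCircle.equivIco (1 : ℝ) 0).symm_apply_apply x

/-- The sum over all integers does not depend on the lift of x − y, so the kernel defined through
representatives is a convolution kernel. -/
lemma heatKernel_eq_heat {t : ℝ} (ht : 0 < t) (x y : Torus) : heatKernel t x y = heat t (x - y) := by
  rw [heatKernel]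
  have h := hasSum_heat_gauss ht (rep x - rep y)
  rw [AddCircle.coe_sub, coe_rep, coe_rep] at h
  rw [← h.tsum_eq]
  simp only [sq_abs]

lemma exists_coe_eq (x : Torus) : ∃ y : ℝ, (y : Torus) = x := ⟨rep x, coe_rep x⟩

lemma heat_pos {t : ℝ} (ht : 0 < t) (x : Torus) : 0 < heat t x := by
  obtain ⟨x, rfl⟩ := exists_coe_eq x
  rw [← (hasSum_heat_gauss ht x).tsum_eq]
  exact (hasSum_heat_gauss ht x).summable.tsum_pos (fun n => by positivity) 0 (by positivity)

lemma heat_nonneg (t : ℝ) (x : Torus) : 0 ≤ heat t x := by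
  rcases lt_or_ge 0 t with ht | ht
  · exact (heat_pos ht x).le
  · rw [heat, HurwitzZeta.cosKernel_undef _ (mul_nonpos_of_nonneg_of_nonpos (by positivity) ht)]

lemma heat_neg (t : ℝ) (x : Torus) : heat t (-x) = heat t x := HurwitzZeta.cosKernel_neg _ _

lemma heatD_neg (t : ℝ) (x : Torus) : heatD t (-x) = -heatD t x := by
  rw [heatD, heatD, HurwitzZeta.sinKernel_neg]; ring

lemma heat_sub_comm (t : ℝ) (x y : Torus) : heat t (x - y) = heat t (y - x) := by
  rw [← heat_neg, neg_sub]

lemma heat_undef {t : ℝ} (ht : t ≤ 0) (x : Torus) : heat t x = 0 := by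
  rw [heat, HurwitzZeta.cosKernel_undef _ (mul_nonpos_of_nonneg_of_nonpos (by positivity) ht)]

lemma heatD_undef {t : ℝ} (ht : t ≤ 0) (x : Torus) : heatD t x = 0 := by
  rw [heatD, HurwitzZeta.sinKernel_undef _ (mul_nonpos_of_nonneg_of_nonpos (by positivity) ht),
    mul_zero]

/-! ### Smoothness -/

/-- `φ'` is the derivative of `φ` along the torus. -/
def HasTorusDeriv (φ φ' : Torus → ℝ) : Prop :=
  ∀ x : ℝ, HasDerivAt (fun y : ℝ => φ (y : Torus)) (φ' (x : Torus)) x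

lemma hasTorusDeriv_heat {t : ℝ} (ht : 0 < t) : HasTorusDeriv (heat t) (heatD t) := by
  intro x
  have hu : Summable fun n : ℤ => 2 * Real.pi * (|(n : ℝ)| ^ 1 *
      Real.exp (-(2 * Real.pi ^ 2 * t * n ^ 2))) :=
    (summable_pow_mul_exp_sq 1 (by positivity)).mul_left _
  have := hasDerivAt_tsum hu (g := fun (n : ℤ) (x : ℝ) =>
    Real.exp (-(2 * Real.pi ^ 2 * n ^ 2 * t)) * Real.cos (2 * Real.pi * n * x))
    (g' := fun n x => -(2 * Real.pi * n) * Real.exp (-(2 * Real.pi ^ 2 * n ^ 2 * t))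
      * Real.sin (2 * Real.pi * n * x)) (fun n y => ?_) (fun n y => ?_)
    (hasSum_heat ht 0).summable x
  · simp only [(hasSum_heat ht _).tsum_eq, (hasSum_heatD ht _).tsum_eq] at this
    exact this
  · have := (((hasDerivAt_id y).const_mul (2 * Real.pi * n)).cos).const_mul
      (Real.exp (-(2 * Real.pi ^ 2 * n ^ 2 * t)))
    refine this.congr_deriv ?_
    simp; ring
  · rw [norm_mul, norm_mul, Real.norm_of_nonneg (Real.exp_pos _).le, Real.norm_eq_abs,
      Real.norm_eq_abs, abs_neg, abs_mul, abs_of_pos (by positivity : 0 < 2 * Real.pi), pow_one]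
    calc _ ≤ 2 * Real.pi * |(n : ℝ)| * Real.exp (-(2 * Real.pi ^ 2 * n ^ 2 * t)) * 1 := by
          gcongr; exact Real.abs_sin_le_one _
      _ = _ := by rw [mul_one, mul_assoc]; congr 4; ring

lemma heatDD_coe (t x : ℝ) : heatDD t x = ∑' n : ℤ, -(2 * Real.pi * n) ^ 2 *
    Real.exp (-(2 * Real.pi ^ 2 * n ^ 2 * t)) * Real.cos (2 * Real.pi * n * x) := by
  simp only [heatDD, fourier_re_coe]

/-- The bound involves only the lower end a of the times, so it serves for differentiation in space
and, uniformly over t ≥ a, for differentiation in time. -/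
lemma norm_heatDD_term_le {a t : ℝ} (hat : a ≤ t) (n : ℤ) {u : ℝ} (hu : |u| ≤ 1) :
    ‖-(2 * Real.pi * n) ^ 2 * Real.exp (-(2 * Real.pi ^ 2 * n ^ 2 * t)) * u‖ ≤
      4 * Real.pi ^ 2 * (|(n : ℝ)| ^ 2 * Real.exp (-(2 * Real.pi ^ 2 * a * n ^ 2))) := by
  rw [norm_mul, norm_mul, Real.norm_of_nonneg (Real.exp_pos _).le, Real.norm_eq_abs,
    Real.norm_eq_abs, abs_neg, abs_of_nonneg (sq_nonneg _), sq_abs]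
  calc _ ≤ (2 * Real.pi * (n : ℝ)) ^ 2 * Real.exp (-(2 * Real.pi ^ 2 * a * n ^ 2)) * 1 := by
        gcongr ?_ * Real.exp (-?_) * ?_
        calc 2 * Real.pi ^ 2 * a * n ^ 2 = 2 * Real.pi ^ 2 * n ^ 2 * a := by ring
          _ ≤ _ := by gcongr
    _ = _ := by ring

lemma summable_heatDD_bound {a : ℝ} (ha : 0 < a) : Summable fun n : ℤ =>
    4 * Real.pi ^ 2 * (|(n : ℝ)| ^ 2 * Real.exp (-(2 * Real.pi ^ 2 * a * n ^ 2))) :=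
  (summable_pow_mul_exp_sq 2 (by positivity)).mul_left _

lemma exists_heatDD_bound {a : ℝ} (ha : 0 < a) :
    ∃ C : ℝ, ∀ t, a ≤ t → ∀ x, |heatDD t x| ≤ C :=
  ⟨_, fun _ ht x => tsum_of_norm_bounded (summable_heatDD_bound ha).hasSum
    fun n => norm_heatDD_term_le ht n ((Complex.abs_re_le_norm _).trans
      (((fourier n).norm_coe_le_norm x).trans (fourier_norm n).le))⟩

lemma hasTorusDeriv_heatD {t : ℝ} (ht : 0 < t) : HasTorusDeriv (heatD t) (heatDD t) := by
  intro x
  have := hasDerivAt_tsum (summable_heatDD_bound ht) (g := fun (n : ℤ) (x : ℝ) =>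
    -(2 * Real.pi * n) * Real.exp (-(2 * Real.pi ^ 2 * n ^ 2 * t)) * Real.sin (2 * Real.pi * n * x))
    (g' := fun n x => -(2 * Real.pi * n) ^ 2 * Real.exp (-(2 * Real.pi ^ 2 * n ^ 2 * t))
      * Real.cos (2 * Real.pi * n * x)) (fun n y => ?_)
    (fun n y => norm_heatDD_term_le le_rfl n (Real.abs_cos_le_one _))
    (hasSum_heatD ht 0).summable x
  · simp only [(hasSum_heatD ht _).tsum_eq, ← heatDD_coe] at this
    exact this
  · have := (((hasDerivAt_id y).const_mul (2 * Real.pi * n)).sin).const_mul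
      (-(2 * Real.pi * n) * Real.exp (-(2 * Real.pi ^ 2 * n ^ 2 * t)))
    refine this.congr_deriv ?_
    simp; ring

/-- The heat equation. -/
lemma hasDerivAt_heat_time {t : ℝ} (ht : 0 < t) (x : Torus) :
    HasDerivAt (fun t => heat t x) (1 / 2 * heatDD t x) t := by
  obtain ⟨x, rfl⟩ := exists_coe_eq x
  -- Times are confined to (t/2, ∞), where one majorant dominates all time derivatives.
  have key := hasDerivAt_tsum_of_isPreconnected
    ((summable_heatDD_bound (half_pos ht)).mul_left (1 / 2)) (isOpen_Ioi (a := t / 2))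
    isPreconnected_Ioi (g := fun (n : ℤ) (t : ℝ) =>
      Real.exp (-(2 * Real.pi ^ 2 * n ^ 2 * t)) * Real.cos (2 * Real.pi * n * x))
    (g' := fun n t => 1 / 2 * (-(2 * Real.pi * n) ^ 2 * Real.exp (-(2 * Real.pi ^ 2 * n ^ 2 * t))
      * Real.cos (2 * Real.pi * n * x))) (fun n y _ => ?_)
    (fun n y hy => ?_) (half_lt_self ht) (hasSum_heat ht x).summable (half_lt_self ht)
  · rw [tsum_mul_left, ← heatDD_coe] at key
    refine key.congr_of_eventuallyEq ?_
    filter_upwards [lt_mem_nhds ht] with s hs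
    exact (hasSum_heat hs x).tsum_eq.symm
  · have := ((((hasDerivAt_id y).const_mul (2 * Real.pi ^ 2 * n ^ 2)).neg).exp).mul_const
      (Real.cos (2 * Real.pi * n * x))
    refine this.congr_deriv ?_
    simp; ring
  · rw [norm_mul, Real.norm_of_nonneg (by norm_num : (0:ℝ) ≤ 1 / 2)]
    gcongr
    exact norm_heatDD_term_le (mem_Ioi.1 hy).le n (Real.abs_cos_le_one _)

/-- The theta function is entire in its first variable. Full smoothness is needed because weak
derivatives are tested against smooth functions, and heat kernels will be the test functions. -/
lemma contDiff_heat {t : ℝ} (ht : 0 < t) : ContDiff ℝ (⊤ : ℕ∞) fun x : ℝ => heat t (x : Torus) := by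
  have h1 : ContDiff ℂ (⊤ : ℕ∞) fun z : ℂ => jacobiTheta₂ z (Complex.I * (2 * Real.pi * t : ℝ)) := by
    refine Differentiable.contDiff fun z => differentiableAt_jacobiTheta₂_fst z ?_
    simp; positivity
  have h2 : ContDiff ℝ (⊤ : ℕ∞) fun x : ℝ =>
      Complex.reCLM (jacobiTheta₂ (Complex.ofRealCLM x) (Complex.I * (2 * Real.pi * t : ℝ))) :=
    Complex.reCLM.contDiff.comp ((h1.restrict_scalars ℝ).comp Complex.ofRealCLM.contDiff)
  convert h2 using 2 with x
  have := HurwitzZeta.cosKernel_def x (2 * Real.pi * t)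
  rw [Complex.ofRealCLM_apply, ← this, Complex.reCLM_apply, Complex.ofReal_re, heat]

lemma continuous_of_comp_coe {φ : Torus → ℝ} (h : Continuous fun x : ℝ => φ (x : Torus)) :
    Continuous φ :=
  (QuotientAddGroup.isQuotientMap_mk (N := AddSubgroup.zmultiples (1 : ℝ))).continuous_iff.2 h

lemma HasTorusDeriv.continuous {φ φ' : Torus → ℝ} (h : HasTorusDeriv φ φ') : Continuous φ :=
  continuous_of_comp_coe (continuous_iff_continuousAt.2 fun x => (h x).continuousAt)

lemma continuous_heat {t : ℝ} (ht : 0 < t) : Continuous (heat t) :=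
  (hasTorusDeriv_heat ht).continuous

lemma continuous_heatD {t : ℝ} (ht : 0 < t) : Continuous (heatD t) :=
  (hasTorusDeriv_heatD ht).continuous

end RoughTorus
end

/-! ### Convolution semigroup, Gaussian bounds, approximate identity. -/

noncomputable section

namespace RoughTorus

/-! ### The convolution semigroup -/

instance isProbabilityMeasure_torus : IsProbabilityMeasure (volume : Measure Torus) :=
  ⟨UnitAddCircle.measure_univ⟩

lemma _root_.Continuous.integrable_torus {E : Type*} [NormedAddCommGroup E] {f : Torus → E}
    (hf : Continuous f) : Integrable f :=
  hf.integrable_of_hasCompactSupport (HasCompactSupport.of_compactSpace f)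

lemma integral_fourier (k : ℤ) : ∫ x : Torus, fourier k x = if k = 0 then 1 else 0 := by
  have h := fourierCoeff_fourier (T := 1) k
  have h0 := congrFun h 0
  have hv : (volume : Measure Torus) = AddCircle.haarAddCircle := by
    rw [AddCircle.volume_eq_smul_haarAddCircle]; simp
  rw [fourierCoeff] at h0
  simp only [neg_zero, fourier_zero, one_smul] at h0
  rw [hv, h0, Pi.single_apply]
  simp [eq_comm]

lemma hasSum_heat_fourier {t : ℝ} (ht : 0 < t) (x : Torus) :
    HasSum (fun n : ℤ => (Real.exp (-(2 * Real.pi ^ 2 * n ^ 2 * t)) : ℂ) * fourier n x)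
      (heat t x : ℂ) := by
  obtain ⟨x, rfl⟩ := exists_coe_eq x
  have h := HurwitzZeta.hasSum_int_cosKernel x (t := 2 * Real.pi * t) (by positivity)
  refine h.congr_fun fun n => ?_
  rw [fourier_coe_apply, mul_comm]
  congr 2
  · push_cast; ring
  · congr 1; ring

lemma summable_exp_sq {t : ℝ} (ht : 0 < t) :
    Summable fun n : ℤ => Real.exp (-(2 * Real.pi ^ 2 * n ^ 2 * t)) := by
  refine (summable_pow_mul_exp_sq 0 (c := 2 * Real.pi ^ 2 * t) (by positivity)).congr fun n => ?_
  rw [pow_zero, one_mul]; congr 2; ring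

lemma norm_fourier_apply (n : ℤ) (x : Torus) : ‖fourier n x‖ = 1 := by
  rw [fourier_apply]; exact Circle.norm_coe _

lemma fourier_sub (n : ℤ) (x y : Torus) : fourier n (x - y) = fourier n x * fourier (-n) y := by
  have h : n • (x - y) = n • x + (-n) • y := by rw [smul_sub, neg_smul, sub_eq_add_neg]
  rw [fourier_apply, fourier_apply, fourier_apply, h, AddCircle.toCircle_add]
  exact Circle.coe_mul _ _

/-- Characters are eigenfunctions of convolution: integrating the Fourier series of the heat kernel
termwise, orthogonality keeps one term. -/
lemma integral_fourier_sub_mul_heat {t : ℝ} (ht : 0 < t) (n : ℤ) (x y : Torus) :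
    ∫ w : Torus, fourier n (x - w) * (heat t (w - y) : ℂ)
      = Real.exp (-(2 * Real.pi ^ 2 * n ^ 2 * t)) * fourier n (x - y) := by
  set c : ℤ → ℂ := fun m => (Real.exp (-(2 * Real.pi ^ 2 * m ^ 2 * t)) : ℂ) with hc
  have hF : ∀ m : ℤ, Continuous fun w : Torus => fourier n (x - w) * (c m * fourier m (w - y)) := by
    intro m; fun_prop
  have hsum := hasSum_integral_of_summable_integral_norm (μ := (volume : Measure Torus))
    (F := fun (m : ℤ) w => fourier n (x - w) * (c m * fourier m (w - y)))
    (fun m => (hF m).integrable_torus) (by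
      refine (summable_exp_sq ht).congr fun m => ?_
      simp only [norm_mul, norm_fourier_apply, hc, Complex.norm_real,
        Real.norm_of_nonneg (Real.exp_pos _).le]
      simp)
  have hint : ∀ m : ℤ, ∫ w : Torus, fourier n (x - w) * (c m * fourier m (w - y))
      = if m = n then c n * fourier n (x - y) else 0 := by
    intro m
    have : ∀ w : Torus, fourier n (x - w) * (c m * fourier m (w - y))
        = c m * fourier n x * fourier (-m) y * fourier (m - n) w := by
      intro w
      rw [fourier_sub, fourier_sub, sub_eq_add_neg m n, fourier_add]; ring
    simp only [this]
    rw [integral_const_mul, integral_fourier]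
    simp only [sub_eq_zero]
    split_ifs with h
    · rw [h, fourier_sub]; ring
    · ring
  have h2 : HasSum (fun m : ℤ => if m = n then c n * fourier n (x - y) else 0)
      (∫ w : Torus, fourier n (x - w) * (heat t (w - y) : ℂ)) := by
    have e : ∀ w : Torus, ∑' m : ℤ, fourier n (x - w) * (c m * fourier m (w - y))
        = fourier n (x - w) * (heat t (w - y) : ℂ) := fun w =>
      ((hasSum_heat_fourier ht (w - y)).mul_left _).tsum_eq
    simp only [hint, e] at hsum
    exact hsum
  exact h2.unique (hasSum_ite_eq n _)

lemma integral_heat_sub_left {t : ℝ} (ht : 0 < t) (y : Torus) : ∫ w : Torus, heat t (w - y) = 1 := by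
  have h := integral_fourier_sub_mul_heat ht 0 0 y
  simp only [fourier_zero, one_mul] at h
  rw [integral_complex_ofReal] at h
  simpa using h

lemma integral_heat_sub_right {t : ℝ} (ht : 0 < t) (x : Torus) : ∫ w : Torus, heat t (x - w) = 1 := by
  simp only [heat_sub_comm t x]; exact integral_heat_sub_left ht x

/-- The semigroup property of the heat kernel. -/
lemma heat_conv {s t : ℝ} (hs : 0 < s) (ht : 0 < t) (x y : Torus) :
    ∫ w : Torus, heat s (x - w) * heat t (w - y) = heat (s + t) (x - y) := by
  set c : ℤ → ℂ := fun m => (Real.exp (-(2 * Real.pi ^ 2 * m ^ 2 * s)) : ℂ) with hc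
  have hcont : Continuous fun w : Torus => (heat t (w - y) : ℂ) :=
    Complex.continuous_ofReal.comp ((continuous_heat ht).comp (by fun_prop))
  have hF : ∀ m : ℤ, Continuous fun w : Torus => c m * (fourier m (x - w) * (heat t (w - y) : ℂ)) := by
    intro m; fun_prop
  -- Only the kernel at time s is expanded; each of its characters is an eigenfunction of the kernel
  -- at time t, and the exponentials multiply.
  have hsum := hasSum_integral_of_summable_integral_norm (μ := (volume : Measure Torus))
    (F := fun (m : ℤ) w => c m * (fourier m (x - w) * (heat t (w - y) : ℂ)))
    (fun m => (hF m).integrable_torus) (by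
      refine (summable_exp_sq hs).congr fun m => ?_
      simp only [norm_mul, norm_fourier_apply, hc, Complex.norm_real,
        Real.norm_of_nonneg (Real.exp_pos _).le, Real.norm_of_nonneg (heat_nonneg _ _), one_mul]
      rw [integral_const_mul, integral_heat_sub_left ht, mul_one])
  simp only [integral_const_mul, integral_fourier_sub_mul_heat ht] at hsum
  have h3 := hasSum_heat_fourier (add_pos hs ht) (x - y)
  have h4 : HasSum (fun n : ℤ => c n * ((Real.exp (-(2 * Real.pi ^ 2 * n ^ 2 * t)) : ℂ)
      * fourier n (x - y))) (heat (s + t) (x - y) : ℂ) := by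
    refine h3.congr_fun fun n => ?_
    rw [hc]
    dsimp only
    rw [← mul_assoc, ← Complex.ofReal_mul, ← Real.exp_add]
    congr 3; ring
  have h5 := hsum.unique h4
  rw [← Complex.ofReal_inj, ← h5, ← integral_complex_ofReal]
  congr 1; funext w
  rw [Complex.ofReal_mul]
  have := ((hasSum_heat_fourier hs (x - w)).mul_right (heat t (w - y) : ℂ)).tsum_eq
  rw [← this]
  congr 1; funext n
  simp only [hc]; ring

/-! ### Gaussian bounds -/

lemma norm_coe_le_abs_add (x : ℝ) (n : ℤ) : ‖(x : Torus)‖ ≤ |x + n| := by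
  have h := round_le x (-n)
  rw [UnitAddCircle.norm_eq]
  simpa using h

/-- With y = |z|/√t one has y^γ ≤ 1 + y² ≤ 4 exp(y²/4), and this exponential is exactly what
doubling the time of the Gaussian releases. The change of prefactor costs √2 ≤ 2, whence 8. -/
lemma rpow_mul_gauss_le {t γ : ℝ} (ht : 0 < t) (h0 : 0 ≤ γ) (h2 : γ ≤ 2) (z : ℝ) :
    |z| ^ γ * (1 / Real.sqrt (2 * Real.pi * t) * Real.exp (-z ^ 2 / (2 * t))) ≤
      8 * t ^ (γ / 2) *
        (1 / Real.sqrt (2 * Real.pi * (2 * t)) * Real.exp (-z ^ 2 / (2 * (2 * t)))) := by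
  have hs : Real.sqrt (2 * Real.pi * (2 * t)) = Real.sqrt 2 * Real.sqrt (2 * Real.pi * t) := by
    rw [← Real.sqrt_mul (by norm_num)]; congr 1; ring
  have hs2 : Real.sqrt 2 ≤ 2 := by
    rw [Real.sqrt_le_left (by norm_num)]; norm_num
  have hst : 0 < Real.sqrt t := Real.sqrt_pos.2 ht
  have key : |z| ^ γ ≤ t ^ (γ / 2) * (4 * Real.exp (z ^ 2 / (4 * t))) := by
    have e1 : |z| = Real.sqrt t * (|z| / Real.sqrt t) := by field_simp
    have e2 : (|z| / Real.sqrt t) ^ 2 = z ^ 2 / t := by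
      rw [div_pow, sq_abs, Real.sq_sqrt ht.le]
    set y := |z| / Real.sqrt t with hy
    have hy0 : 0 ≤ y := by positivity
    have h3 : y ^ γ ≤ 1 + y ^ 2 := by
      rcases le_total y 1 with h | h
      · exact (Real.rpow_le_one hy0 h h0).trans (by nlinarith [sq_nonneg y])
      · calc y ^ γ ≤ y ^ (2 : ℝ) := Real.rpow_le_rpow_of_exponent_le h h2
          _ = y ^ 2 := Real.rpow_two y
          _ ≤ _ := by linarith
    have h4 : 1 + y ^ 2 ≤ 4 * Real.exp (z ^ 2 / (4 * t)) := by
      have := Real.add_one_le_exp (z ^ 2 / (4 * t))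
      have e3 : z ^ 2 / (4 * t) = y ^ 2 / 4 := by rw [e2]; field_simp
      rw [e3] at this ⊢
      linarith
    rw [e1, Real.mul_rpow hst.le hy0, Real.sqrt_eq_rpow, ← Real.rpow_mul ht.le]
    rw [show 1 / 2 * γ = γ / 2 by ring]
    gcongr
    exact h3.trans h4
  have e4 : Real.exp (z ^ 2 / (4 * t)) * Real.exp (-z ^ 2 / (2 * t))
      = Real.exp (-z ^ 2 / (2 * (2 * t))) := by
    rw [← Real.exp_add]; congr 1; field_simp; ring
  have hp : 0 < Real.sqrt (2 * Real.pi * t) := by positivity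
  calc _ ≤ t ^ (γ / 2) * (4 * Real.exp (z ^ 2 / (4 * t))) *
        (1 / Real.sqrt (2 * Real.pi * t) * Real.exp (-z ^ 2 / (2 * t))) := by gcongr
    _ = 4 * t ^ (γ / 2) * (1 / Real.sqrt (2 * Real.pi * t) * Real.exp (-z ^ 2 / (2 * (2 * t)))) := by
        rw [← e4]; ring
    _ ≤ 8 * t ^ (γ / 2) *
        (1 / Real.sqrt (2 * Real.pi * (2 * t)) * Real.exp (-z ^ 2 / (2 * (2 * t)))) := by
        rw [hs]
        have : 4 * (1 / Real.sqrt (2 * Real.pi * t))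
            ≤ 8 * (1 / (Real.sqrt 2 * Real.sqrt (2 * Real.pi * t))) := by
          rw [mul_one_div, mul_one_div, div_le_div_iff₀ hp (by positivity)]
          nlinarith
        calc _ = 4 * (1 / Real.sqrt (2 * Real.pi * t)) *
              (t ^ (γ / 2) * Real.exp (-z ^ 2 / (2 * (2 * t)))) := by ring
          _ ≤ 8 * (1 / (Real.sqrt 2 * Real.sqrt (2 * Real.pi * t))) *
              (t ^ (γ / 2) * Real.exp (-z ^ 2 / (2 * (2 * t)))) := by gcongr
          _ = _ := by ring

lemma norm_rpow_mul_heat_le {t γ : ℝ} (ht : 0 < t) (h0 : 0 ≤ γ) (h2 : γ ≤ 2) (x : Torus) :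
    ‖x‖ ^ γ * heat t x ≤ 8 * t ^ (γ / 2) * heat (2 * t) x := by
  obtain ⟨x, rfl⟩ := exists_coe_eq x
  have h1 := (hasSum_heat_gauss ht x).mul_left (‖(x : Torus)‖ ^ γ)
  have h3 := (hasSum_heat_gauss (mul_pos two_pos ht) x).mul_left (8 * t ^ (γ / 2))
  refine hasSum_le (fun n => ?_) h1 h3
  refine le_trans ?_ (rpow_mul_gauss_le ht h0 h2 (x + n))
  gcongr
  exact norm_coe_le_abs_add x n

/-- The estimate behind the rough step: multiplied by a Hölder increment of exponent β, the
singularity t^(-1/2) of the derivative improves to t^((β-1)/2), which remains integrable after two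
adjacent steps have shared a time. -/
lemma abs_heatD_mul_rpow_le {t β : ℝ} (ht : 0 < t) (h0 : 0 ≤ β) (h1 : β ≤ 1) (x : Torus) :
    |heatD t x| * ‖x‖ ^ β ≤ 8 * t ^ ((β - 1) / 2) * heat (2 * t) x := by
  obtain ⟨x, rfl⟩ := exists_coe_eq x
  have h3 := (hasSum_heat_gauss (mul_pos two_pos ht) x).mul_left (8 * t ^ ((β - 1) / 2))
  have h2 := (hasSum_heatD_gauss ht x).mul_right (‖(x : Torus)‖ ^ β)
  have e : |heatD t x| * ‖(x : Torus)‖ ^ β = ‖heatD t x * ‖(x : Torus)‖ ^ β‖ := by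
    rw [norm_mul, Real.norm_eq_abs, Real.norm_of_nonneg (by positivity)]
  rw [e, ← h2.tsum_eq]
  refine tsum_of_norm_bounded h3 fun n => ?_
  have hn := norm_coe_le_abs_add x n
  set z := x + n with hz
  have key := rpow_mul_gauss_le ht (by linarith : 0 ≤ 1 + β) (by linarith) z
  rw [norm_mul, norm_mul, Real.norm_eq_abs, abs_neg, abs_div, abs_of_pos ht,
    Real.norm_of_nonneg (by positivity), Real.norm_of_nonneg (by positivity)]
  calc _ ≤ |z| / t * (1 / Real.sqrt (2 * Real.pi * t) * Real.exp (-z ^ 2 / (2 * t))) * |z| ^ β := by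
        gcongr
    _ = 1 / t * (|z| ^ (1 + β) * (1 / Real.sqrt (2 * Real.pi * t) * Real.exp (-z ^ 2 / (2 * t)))) := by
        rw [Real.rpow_add_of_nonneg (abs_nonneg _) zero_le_one h0, Real.rpow_one]; ring
    _ ≤ 1 / t * (8 * t ^ ((1 + β) / 2) * (1 / Real.sqrt (2 * Real.pi * (2 * t)) *
          Real.exp (-z ^ 2 / (2 * (2 * t))))) := by gcongr
    _ = _ := by
        have : t ^ ((β - 1) / 2) = 1 / t * t ^ ((1 + β) / 2) := by
          rw [one_div, ← Real.rpow_neg_one, ← Real.rpow_add ht]; congr 1; ring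
        rw [this]
        ring

lemma abs_heatD_le {t : ℝ} (ht : 0 < t) (x : Torus) :
    |heatD t x| ≤ 8 * t ^ (-(1 / 2) : ℝ) * heat (2 * t) x := by
  have := abs_heatD_mul_rpow_le ht le_rfl zero_le_one x
  rw [Real.rpow_zero, mul_one] at this
  convert this using 4; norm_num

/-- Lengthening the time increases every exponential; only the prefactor loses. -/
lemma heat_le_of_le {a b : ℝ} (ha : 0 < a) (hab : a ≤ b) (x : Torus) :
    heat a x ≤ Real.sqrt (b / a) * heat b x := by
  obtain ⟨x, rfl⟩ := exists_coe_eq x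
  have hb := ha.trans_le hab
  refine hasSum_le (fun n => ?_) (hasSum_heat_gauss ha x) ((hasSum_heat_gauss hb x).mul_left _)
  have e : Real.sqrt (b / a) * (1 / Real.sqrt (2 * Real.pi * b)) = 1 / Real.sqrt (2 * Real.pi * a) := by
    rw [Real.sqrt_div hb.le, Real.sqrt_mul (by positivity) b, Real.sqrt_mul (by positivity) a]
    have : Real.sqrt a ≠ 0 := by positivity
    have : Real.sqrt b ≠ 0 := by positivity
    field_simp
  rw [← mul_assoc, e, neg_div, neg_div]
  gcongr

lemma heat_le_four {t : ℝ} (ht : 0 < t) (x : Torus) : heat t x ≤ 2 * heat (4 * t) x := by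
  have := heat_le_of_le ht (by linarith : t ≤ 4 * t) x
  have h2 : Real.sqrt 4 = 2 := by
    rw [show (4 : ℝ) = 2 ^ 2 by norm_num, Real.sqrt_sq (by norm_num)]
  rwa [mul_div_assoc, div_self ht.ne', mul_one, h2] at this

lemma heat_le_zero {t : ℝ} (ht : 0 < t) (x : Torus) : heat t x ≤ heat t 0 := by
  obtain ⟨x, rfl⟩ := exists_coe_eq x
  refine hasSum_le (fun n => ?_) (hasSum_heat ht x) (hasSum_heat ht 0)
  rw [mul_zero, Real.cos_zero]
  gcongr
  exact Real.cos_le_one _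

lemma heat_sup_le {t T : ℝ} (ht : 0 < t) (hT : t ≤ T) (x : Torus) :
    heat t x ≤ Real.sqrt T * heat T 0 * t ^ (-(1 / 2) : ℝ) := by
  refine (heat_le_of_le ht hT x).trans ?_
  rw [Real.sqrt_div (ht.le.trans hT), Real.rpow_neg ht.le, ← Real.sqrt_eq_rpow]
  calc _ ≤ Real.sqrt T / Real.sqrt t * heat T 0 := by gcongr; exact heat_le_zero (ht.trans_le hT) x
    _ = _ := by ring

/-- From (a+n)² ≤ 2(b+n)² + 2(b−a)², a shift of at most √t costs exp(1/4) ≤ 2 once the time is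
doubled. The prefactor costs √2, and 2√2 ≤ 3. -/
lemma gauss_shift_le {t a b : ℝ} (ht : 0 < t) (hab : |b - a| ≤ Real.sqrt t) (n : ℤ) :
    1 / Real.sqrt (2 * Real.pi * (2 * t)) * Real.exp (-(b + n) ^ 2 / (2 * (2 * t))) ≤
      3 * (1 / Real.sqrt (2 * Real.pi * (4 * t)) * Real.exp (-(a + n) ^ 2 / (2 * (4 * t)))) := by
  have h1 : (b - a) ^ 2 ≤ t := by
    rw [← sq_abs, ← Real.sq_sqrt ht.le]; gcongr
  have h2 : -(b + n) ^ 2 / (2 * (2 * t)) ≤ 1 / 4 + -(a + n) ^ 2 / (2 * (4 * t)) := by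
    rw [← sub_nonneg]
    have : 1 / 4 + -(a + n) ^ 2 / (2 * (4 * t)) - -(b + n) ^ 2 / (2 * (2 * t))
        = (2 * t - (a + n) ^ 2 + 2 * (b + n) ^ 2) / (8 * t) := by field_simp; ring
    rw [this]
    apply div_nonneg _ (by positivity)
    nlinarith [sq_nonneg ((b + n) + (b - a))]
  have hs : Real.sqrt (2 * Real.pi * (4 * t)) = Real.sqrt 2 * Real.sqrt (2 * Real.pi * (2 * t)) := by
    rw [← Real.sqrt_mul (by norm_num)]; congr 1; ring
  have hs2 : Real.sqrt 2 ≤ 3 / 2 := by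
    rw [Real.sqrt_le_left (by norm_num)]; norm_num
  have he : Real.exp (1 / 4) ≤ 2 := by
    have h4 : Real.exp (1 / 4) ^ 4 = Real.exp 1 := by
      rw [← Real.exp_nat_mul]; norm_num
    by_contra! h
    have : (2 : ℝ) ^ 4 < Real.exp (1 / 4) ^ 4 := by gcongr
    rw [h4] at this
    linarith [Real.exp_one_lt_d9]
  have hp : 0 < Real.sqrt (2 * Real.pi * (2 * t)) := by positivity
  calc _ ≤ 1 / Real.sqrt (2 * Real.pi * (2 * t)) *
        (2 * Real.exp (-(a + n) ^ 2 / (2 * (4 * t)))) := by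
        gcongr
        refine (Real.exp_le_exp.2 h2).trans ?_
        rw [Real.exp_add]; gcongr
    _ = 2 * (1 / Real.sqrt (2 * Real.pi * (2 * t))) * Real.exp (-(a + n) ^ 2 / (2 * (4 * t))) := by
        ring
    _ ≤ 3 * (1 / Real.sqrt (2 * Real.pi * (4 * t))) * Real.exp (-(a + n) ^ 2 / (2 * (4 * t))) := by
        gcongr ?_ * _
        rw [hs, mul_one_div, mul_one_div, div_le_div_iff₀ hp (by positivity)]
        nlinarith
    _ = _ := by ring

lemma heat_shift_le {t a b : ℝ} (ht : 0 < t) (hab : |b - a| ≤ Real.sqrt t) :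
    heat (2 * t) (b : Torus) ≤ 3 * heat (4 * t) (a : Torus) :=
  hasSum_le (fun n => gauss_shift_le ht hab n) (hasSum_heat_gauss (by linarith) b)
    ((hasSum_heat_gauss (by linarith) a).mul_left 3)

/-- Let r = dist(x, x')/√t. If r ≥ 1 the triangle inequality suffices, as r^u ≥ 1. If r ≤ 1 the mean
value theorem along the short arc gives a bound linear in r, and r ≤ r^u; the constant is 8 from the
derivative times 3 from the shift. -/
lemma abs_heat_sub_heat_le {t u : ℝ} (ht : 0 < t) (hu0 : 0 < u) (hu1 : u ≤ 1) (x x' : Torus) :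
    |heat t x - heat t x'| ≤
      24 * (dist x x' ^ u * t ^ (-u / 2)) * (heat (4 * t) x + heat (4 * t) x') := by
  have hst : 0 < Real.sqrt t := Real.sqrt_pos.2 ht
  have e : dist x x' ^ u * t ^ (-u / 2) = (dist x x' / Real.sqrt t) ^ u := by
    rw [Real.div_rpow dist_nonneg hst.le, Real.sqrt_eq_rpow, ← Real.rpow_mul ht.le, neg_div,
      Real.rpow_neg ht.le, div_eq_mul_inv]
    congr 3; ring
  rw [e]
  have hx := heat_pos (mul_pos four_pos ht) x
  have hx' := heat_pos (mul_pos four_pos ht) x'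
  rcases le_total (Real.sqrt t) (dist x x') with h | h
  · have h1 : 1 ≤ (dist x x' / Real.sqrt t) ^ u :=
      Real.one_le_rpow ((one_le_div hst).2 h) hu0.le
    have h2 : |heat t x - heat t x'| ≤ heat t x + heat t x' := by
      rw [abs_le]; constructor <;> linarith [heat_nonneg t x, heat_nonneg t x']
    have h3 := heat_le_four ht x
    have h4 := heat_le_four ht x'
    nlinarith
  · obtain ⟨a, rfl⟩ := exists_coe_eq x
    -- The signed shortest lift of x − x'.
    set d := rep ((a : Torus) - x') - round (rep ((a : Torus) - x')) with hd
    have hdn : |d| = dist (a : Torus) x' := by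
      rw [dist_eq_norm, hd, ← UnitAddCircle.norm_eq, coe_rep]
    have hdc : ((d : ℝ) : Torus) = (a : Torus) - x' := by
      rw [hd, AddCircle.coe_sub, coe_rep]
      have : ((round (rep ((a : Torus) - x')) : ℝ) : Torus) = 0 := by
        rw [AddCircle.coe_eq_zero_iff]
        exact ⟨round (rep ((a : Torus) - x')), by simp⟩
      rw [this, sub_zero]
    have hx'b : x' = ((a - d : ℝ) : Torus) := by
      rw [AddCircle.coe_sub, hdc]; abel
    rw [hx'b] at h hdn hx' ⊢
    have hd2 : |d| ≤ Real.sqrt t := hdn.trans_le h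
    have hmv := Convex.norm_image_sub_le_of_norm_hasDerivWithin_le (f := fun y : ℝ => heat t (y : Torus))
      (f' := fun y => heatD t (y : Torus)) (s := segment ℝ (a - d) a)
      (C := 24 * t ^ (-(1 / 2) : ℝ) * heat (4 * t) (a : Torus)) (x := a - d) (y := a)
      (fun y _ => (hasTorusDeriv_heat ht y).hasDerivWithinAt) (fun y hy => ?_)
      (convex_segment _ _) (left_mem_segment _ _ _) (right_mem_segment _ _ _)
    · have h5 : t ^ (-(1 / 2) : ℝ) = 1 / Real.sqrt t := by
        rw [Real.rpow_neg ht.le, ← Real.sqrt_eq_rpow, one_div]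
      rw [Real.norm_eq_abs, Real.norm_eq_abs, sub_sub_cancel, hdn, h5] at hmv
      have h6 : dist (a : Torus) ((a - d : ℝ) : Torus) / Real.sqrt t ≤
          (dist (a : Torus) ((a - d : ℝ) : Torus) / Real.sqrt t) ^ u := by
        conv_lhs => rw [← Real.rpow_one (dist _ _ / _)]
        exact Real.rpow_le_rpow_of_exponent_ge' (by positivity) ((div_le_one hst).2 h) hu0.le hu1
      calc _ ≤ _ := hmv
        _ = 24 * (dist (a : Torus) ((a - d : ℝ) : Torus) / Real.sqrt t) * heat (4 * t) a := by ring
        _ ≤ _ := by gcongr; linarith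
    · rw [Real.norm_eq_abs]
      have hya : |y - a| ≤ Real.sqrt t := by
        rw [segment_eq_uIcc] at hy
        refine le_trans ?_ hd2
        rcases le_total 0 d with h0 | h0
        · rw [uIcc_of_le (by linarith)] at hy
          rw [abs_of_nonneg h0, abs_le]; constructor <;> linarith [hy.1, hy.2]
        · rw [uIcc_of_ge (by linarith)] at hy
          rw [abs_of_nonpos h0, abs_le]; constructor <;> linarith [hy.1, hy.2]
      calc _ ≤ 8 * t ^ (-(1 / 2) : ℝ) * heat (2 * t) y := abs_heatD_le ht _
        _ ≤ 8 * t ^ (-(1 / 2) : ℝ) * (3 * heat (4 * t) a) := by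
            gcongr; exact heat_shift_le ht hya
        _ = _ := by ring

/-! ### Measurability and the approximate identity -/

lemma measurable_tsum_of_summable {α ι : Type*} [MeasurableSpace α] [Countable ι] {f : ι → α → ℝ}
    (hf : ∀ i, Measurable (f i)) (hs : ∀ a, Summable fun i => f i a) :
    Measurable fun a => ∑' i, f i a :=
  measurable_of_tendsto_metrizable' atTop (f := fun (s : Finset ι) a => ∑ i ∈ s, f i a)
    (fun s => Finset.measurable_fun_sum s fun i _ => hf i)
    (tendsto_pi_nhds.2 fun a => (hs a).hasSum)

lemma fourier_im_coe (n : ℤ) (x : ℝ) : (fourier n (x : Torus)).im = Real.sin (2 * Real.pi * n * x) := by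
  rw [fourier_coe_apply]
  have : (2 * Real.pi * Complex.I * n * x / (1 : ℝ) : ℂ)
      = ((2 * Real.pi * n * x : ℝ) : ℂ) * Complex.I := by push_cast; ring
  rw [this, Complex.exp_ofReal_mul_I_im]

/-- Joint measurability in time and space, needed for Fubini over simplices. The Fourier series is
switched off at nonpositive times, where the kernel has the value zero. -/
lemma measurable_heat_uncurry : Measurable fun p : ℝ × Torus => heat p.1 p.2 := by
  have h : (fun p : ℝ × Torus => heat p.1 p.2) = fun p => ∑' n : ℤ, if 0 < p.1 then
      Real.exp (-(2 * Real.pi ^ 2 * n ^ 2 * p.1)) * (fourier n p.2).re else 0 := by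
    funext ⟨t, x⟩
    obtain ⟨x, rfl⟩ := exists_coe_eq x
    by_cases ht : 0 < t
    · simp only [ht, if_true, fourier_re_coe, (hasSum_heat ht x).tsum_eq]
    · simp [ht, heat_undef (not_lt.1 ht)]
  rw [h]
  refine measurable_tsum_of_summable (fun n => ?_) fun ⟨t, x⟩ => ?_
  · refine Measurable.ite (measurableSet_lt measurable_const measurable_fst) ?_ measurable_const
    have : Continuous fun p : ℝ × Torus =>
      Real.exp (-(2 * Real.pi ^ 2 * n ^ 2 * p.1)) * (fourier n p.2).re := by fun_prop
    exact this.measurable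
  · obtain ⟨x, rfl⟩ := exists_coe_eq x
    by_cases ht : 0 < t
    · simp only [ht, if_true, fourier_re_coe]; exact (hasSum_heat ht x).summable
    · simpa only [ht, if_false] using summable_zero

lemma measurable_heatD_uncurry : Measurable fun p : ℝ × Torus => heatD p.1 p.2 := by
  have h : (fun p : ℝ × Torus => heatD p.1 p.2) = fun p => ∑' n : ℤ, if 0 < p.1 then
      -(2 * Real.pi * n) * Real.exp (-(2 * Real.pi ^ 2 * n ^ 2 * p.1)) * (fourier n p.2).im
      else 0 := by
    funext ⟨t, x⟩
    obtain ⟨x, rfl⟩ := exists_coe_eq x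
    by_cases ht : 0 < t
    · simp only [ht, if_true, fourier_im_coe, (hasSum_heatD ht x).tsum_eq]
    · simp [ht, heatD_undef (not_lt.1 ht)]
  rw [h]
  refine measurable_tsum_of_summable (fun n => ?_) fun ⟨t, x⟩ => ?_
  · refine Measurable.ite (measurableSet_lt measurable_const measurable_fst) ?_ measurable_const
    have : Continuous fun p : ℝ × Torus => -(2 * Real.pi * n) *
      Real.exp (-(2 * Real.pi ^ 2 * n ^ 2 * p.1)) * (fourier n p.2).im := by fun_prop
    exact this.measurable
  · obtain ⟨x, rfl⟩ := exists_coe_eq x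
    by_cases ht : 0 < t
    · simp only [ht, if_true, fourier_im_coe]; exact (hasSum_heatD ht x).summable
    · simpa only [ht, if_false] using summable_zero

lemma _root_.Measurable.heat {α : Type*} [MeasurableSpace α] {f : α → ℝ} {g : α → Torus}
    (hf : Measurable f) (hg : Measurable g) : Measurable fun a => RoughTorus.heat (f a) (g a) :=
  measurable_heat_uncurry.comp (hf.prodMk hg)

lemma _root_.Measurable.heatD {α : Type*} [MeasurableSpace α] {f : α → ℝ} {g : α → Torus}
    (hf : Measurable f) (hg : Measurable g) : Measurable fun a => RoughTorus.heatD (f a) (g a) :=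
  measurable_heatD_uncurry.comp (hf.prodMk hg)

/-- The heat semigroup approximates the identity, uniformly on continuous functions. -/
lemma exists_heat_approx {φ : Torus → ℝ} (hφ : Continuous φ) {ε : ℝ} (hε : 0 < ε) :
    ∃ δ > 0, ∀ t, 0 < t → t < δ → ∀ x, |(∫ y, heat t (x - y) * φ y) - φ x| ≤ ε := by
  obtain ⟨M, hM⟩ := isCompact_univ.exists_bound_of_continuousOn hφ.continuousOn
  have hM0 : 0 ≤ M := (norm_nonneg _).trans (hM 0 (mem_univ _))
  obtain ⟨d, hd, hd2⟩ := Metric.uniformContinuous_iff.1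
    (CompactSpace.uniformContinuous_of_continuous hφ) (ε / 2) (half_pos hε)
  -- Uniform continuity near the diagonal and boundedness away from it give a bound affine in the
  -- distance, so that the first moment of the kernel, of order √t, controls the error.
  have hlip : ∀ x y, |φ y - φ x| ≤ ε / 2 + 2 * M / d * ‖x - y‖ := by
    intro x y
    rcases lt_or_ge (dist y x) d with h | h
    · have := hd2 h
      rw [Real.dist_eq] at this
      have : 0 ≤ 2 * M / d * ‖x - y‖ := by positivity
      linarith
    · have h1 : |φ y - φ x| ≤ 2 * M := by
        have := abs_sub (φ y) (φ x)
        have h2 := hM y (mem_univ _); have h3 := hM x (mem_univ _)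
        rw [Real.norm_eq_abs] at h2 h3
        linarith
      have h4 : 2 * M ≤ 2 * M / d * ‖x - y‖ := by
        rw [div_mul_eq_mul_div, le_div_iff₀ hd, norm_sub_rev, ← dist_eq_norm]
        gcongr
      linarith
  set B := 2 * M / d * 8 with hB
  have hB0 : 0 ≤ B := by positivity
  refine ⟨(ε / 2 / (B + 1)) ^ 2, by positivity, fun t ht htd x => ?_⟩
  have hc : Continuous fun y => heat t (x - y) := (continuous_heat ht).comp (by fun_prop)
  have hc2 : Continuous fun y => heat (2 * t) (x - y) :=
    (continuous_heat (by linarith)).comp (by fun_prop)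
  have e : (∫ y, heat t (x - y) * φ y) - φ x = ∫ y, heat t (x - y) * (φ y - φ x) := by
    simp only [mul_sub]
    rw [integral_sub (Continuous.integrable_torus (by fun_prop))
      (Continuous.integrable_torus (by fun_prop)),
      integral_mul_const, integral_heat_sub_right ht, one_mul]
  rw [e]
  have hst : Real.sqrt t ≤ ε / 2 / (B + 1) := by
    rw [Real.sqrt_le_left (by positivity)]; exact htd.le
  calc _ ≤ ∫ y, ((ε / 2) * heat t (x - y) + 2 * M / d * (8 * Real.sqrt t) * heat (2 * t) (x - y)) := by
        rw [← Real.norm_eq_abs]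
        refine norm_integral_le_of_norm_le (g := fun y => ε / 2 * heat t (x - y) +
            2 * M / d * (8 * Real.sqrt t) * heat (2 * t) (x - y))
          (Continuous.integrable_torus (by fun_prop)) (Eventually.of_forall fun y => ?_)
        rw [norm_mul, Real.norm_of_nonneg (heat_nonneg _ _), Real.norm_eq_abs]
        have h1 := norm_rpow_mul_heat_le ht zero_le_one one_le_two (x - y)
        rw [Real.rpow_one, ← Real.sqrt_eq_rpow] at h1
        calc _ ≤ heat t (x - y) * (ε / 2 + 2 * M / d * ‖x - y‖) := by
              gcongr
              · exact heat_nonneg _ _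
              · exact hlip x y
          _ = ε / 2 * heat t (x - y) + 2 * M / d * (‖x - y‖ * heat t (x - y)) := by ring
          _ ≤ ε / 2 * heat t (x - y) + 2 * M / d * (8 * Real.sqrt t * heat (2 * t) (x - y)) := by
              gcongr
          _ = _ := by ring
    _ = ε / 2 + B * Real.sqrt t := by
        rw [integral_add (Continuous.integrable_torus (by fun_prop))
          (Continuous.integrable_torus (by fun_prop)),
          integral_const_mul, integral_const_mul, integral_heat_sub_right ht,
          integral_heat_sub_right (by linarith), hB]
        ring
    _ ≤ ε / 2 + (B + 1) * (ε / 2 / (B + 1)) := by gcongr; linarith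
    _ = ε := by field_simp; ring

end RoughTorus
end

/-! ### Riemann–Stieltjes integrals and the Hölder function on the circle. -/

noncomputable section

namespace RoughTorus

/-! ### Riemann–Stieltjes integrals of differentiable functions -/

/-- Uniform partitions show that arbitrarily fine tagged partitions exist; one of them approximates
both values. -/
lemma HasRSIntegral.unique {φ R : ℝ → ℝ} {I J : ℝ} (hI : HasRSIntegral φ R I)
    (hJ : HasRSIntegral φ R J) : I = J := by
  refine eq_of_forall_dist_le fun ε hε => ?_
  obtain ⟨δ, hδ, h1⟩ := hI (ε / 2) (half_pos hε)
  obtain ⟨δ', hδ', h2⟩ := hJ (ε / 2) (half_pos hε)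
  obtain ⟨m, hm⟩ := exists_nat_one_div_lt (lt_min hδ hδ')
  have hm0 : (0 : ℝ) < m + 1 := by positivity
  have ht : ∀ δ'', (1 : ℝ) / (m + 1) < δ'' → ∀ j < m + 1, ((fun j : ℕ => (j : ℝ) / (m + 1)) j ≤
      (fun j : ℕ => (j : ℝ) / (m + 1)) j ∧ (fun j : ℕ => (j : ℝ) / (m + 1)) j ≤
      (fun j : ℕ => (j : ℝ) / (m + 1)) (j + 1) ∧ (fun j : ℕ => (j : ℝ) / (m + 1)) (j + 1) -
      (fun j : ℕ => (j : ℝ) / (m + 1)) j < δ'') := by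
    intro δ'' h j _
    refine ⟨le_rfl, ?_, ?_⟩
    · dsimp only; gcongr; simp
    · dsimp only; rw [← sub_div]; push_cast; simpa using h
  have e0 : (fun j : ℕ => (j : ℝ) / (m + 1)) 0 = 0 := by simp
  have e1 : (fun j : ℕ => (j : ℝ) / (m + 1)) (m + 1) = 1 := by
    dsimp only; push_cast; exact div_self hm0.ne'
  have k1 := h1 (m + 1) _ _ e0 e1 (ht δ (hm.trans_le (min_le_left _ _)))
  have k2 := h2 (m + 1) _ _ e0 e1 (ht δ' (hm.trans_le (min_le_right _ _)))
  rw [Real.dist_eq]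
  rw [abs_lt] at k1 k2
  rw [abs_le]; constructor <;> linarith [k1.1, k1.2, k2.1, k2.2]

lemma HasRSIntegral.rsIntegrable {φ R : ℝ → ℝ} {I : ℝ} (h : HasRSIntegral φ R I) :
    RSIntegrable φ R := ⟨I, h⟩

lemma HasRSIntegral.rsIntegral_eq {φ R : ℝ → ℝ} {I : ℝ} (h : HasRSIntegral φ R I) :
    rsIntegral φ R = I := by
  rw [rsIntegral, dif_pos h.rsIntegrable]
  exact h.rsIntegrable.choose_spec.unique h

lemma RSIntegrable.hasRSIntegral {φ R : ℝ → ℝ} (h : RSIntegrable φ R) :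
    HasRSIntegral φ R (rsIntegral φ R) := by
  obtain ⟨I, hI⟩ := h
  rwa [hI.rsIntegral_eq]

lemma HasRSIntegral.const_mul {φ R : ℝ → ℝ} {I : ℝ} (h : HasRSIntegral φ R I) (c : ℝ) :
    HasRSIntegral (fun x => c * φ x) R (c * I) := by
  intro ε hε
  have hc : 0 < |c| + 1 := by positivity
  obtain ⟨δ, hδ, h1⟩ := h (ε / (|c| + 1)) (by positivity)
  refine ⟨δ, hδ, fun m a ξ h0 hm hj => ?_⟩
  have := h1 m a ξ h0 hm hj
  simp only [mul_assoc]
  rw [← Finset.mul_sum, ← mul_sub, abs_mul]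
  rw [lt_div_iff₀ hc] at this
  nlinarith [abs_nonneg (∑ j ∈ Finset.range m, φ (ξ j) * (R (a (j + 1)) - R (a j)) - I)]

lemma RSIntegrableN.const_mul {R : ℝ → ℝ} (c : ℝ) : ∀ {n : ℕ} {φ : (Fin n → Torus) → ℝ},
    RSIntegrableN R n φ → RSIntegrableN R n (fun z => c * φ z) ∧
      rsIntegralN R n (fun z => c * φ z) = c * rsIntegralN R n φ
  | 0, _, _ => ⟨trivial, rfl⟩
  | n + 1, φ, h => by
    have e : ∀ x : ℝ, rsIntegralN R n
        (fun z => c * φ (Fin.cons (α := fun _ => Torus) (x : Torus) z)) = c * rsIntegralN R n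
        (fun z => φ (Fin.cons (α := fun _ => Torus) (x : Torus) z)) :=
      fun x => (RSIntegrableN.const_mul c (h.1 x)).2
    have h2 := h.2.hasRSIntegral.const_mul c
    refine ⟨⟨fun x => (RSIntegrableN.const_mul c (h.1 x)).1, ?_⟩, ?_⟩
    · simp only [e]; exact h2.rsIntegrable
    · simp only [rsIntegralN, e]; exact h2.rsIntegral_eq

/-- Integration by parts: the Riemann–Stieltjes integral of a `C¹` function against a continuous
one. -/
lemma hasRSIntegral_of_hasDerivAt {φ φ' R : ℝ → ℝ} (hφ : ∀ x, HasDerivAt φ (φ' x) x)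
    (hφ' : Continuous φ') (hR : ContinuousOn R (Icc 0 1)) :
    HasRSIntegral φ R (φ 1 * R 1 - φ 0 * R 0 - ∫ x in (0 : ℝ)..1, φ' x * R x) := by
  intro ε hε
  obtain ⟨M, hM⟩ := isCompact_Icc.exists_bound_of_continuousOn (s := Icc (0 : ℝ) 1) hφ'.continuousOn
  have hM0 : 0 ≤ M := (norm_nonneg _).trans (hM 0 ⟨le_rfl, zero_le_one⟩)
  set η := ε / 2 / (M + 1) with hη
  have hη0 : 0 < η := by positivity
  obtain ⟨δ, hδ, hu⟩ := Metric.uniformContinuousOn_iff.1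
    (isCompact_Icc.uniformContinuousOn_of_continuous hR) η hη0
  refine ⟨δ, hδ, fun m a ξ h0 hm hj => ?_⟩
  have hle : ∀ j < m, a j ≤ a (j + 1) := fun j hjm => (hj j hjm).1.trans (hj j hjm).2.1
  have hmono : ∀ i j, i ≤ j → j ≤ m → a i ≤ a j := by
    intro i j hij
    induction j, hij using Nat.le_induction with
    | base => intro _; exact le_rfl
    | succ k _ ih => intro hk; exact (ih (by omega)).trans (hle k (by omega))
  have hmem : ∀ j ≤ m, a j ∈ Icc (0 : ℝ) 1 := fun j hjm =>
    ⟨h0 ▸ hmono 0 j (Nat.zero_le _) hjm, hm ▸ hmono j m hjm le_rfl⟩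
  have hint : ∀ x ∈ Icc (0 : ℝ) 1, ∀ y ∈ Icc (0 : ℝ) 1, ∀ c : ℝ,
      IntervalIntegrable (fun u => φ' u * (R u - c)) volume x y := by
    intro x hx y hy c
    refine ContinuousOn.intervalIntegrable ?_
    exact (hφ'.continuousOn.mul (hR.sub continuousOn_const)).mono (ordConnected_Icc.uIcc_subset hx hy)
  have hint0 : ∀ x ∈ Icc (0 : ℝ) 1, ∀ y ∈ Icc (0 : ℝ) 1,
      IntervalIntegrable (fun u => φ' u * R u) volume x y := fun x hx y hy => by
    simpa using hint x hx y hy 0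
  have hint' : ∀ x y c : ℝ, IntervalIntegrable (fun u => φ' u * c) volume x y := fun x y c =>
    (hφ'.mul continuous_const).intervalIntegrable _ _
  have hftc : ∀ x y : ℝ, ∫ u in x..y, φ' u = φ y - φ x := fun x y =>
    intervalIntegral.integral_eq_sub_of_hasDerivAt (fun u _ => hφ u) (hφ'.intervalIntegrable _ _)
  have hpiece : ∀ j < m, |φ (ξ j) * (R (a (j + 1)) - R (a j)) - ((φ (a (j + 1)) * R (a (j + 1)) -
      φ (a j) * R (a j)) - ∫ u in a j..a (j + 1), φ' u * R u)| ≤ M * η * (a (j + 1) - a j) := by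
    intro j hjm
    obtain ⟨h1, h2, h3⟩ := hj j hjm
    have ma := hmem j hjm.le
    have mb := hmem (j + 1) hjm
    have mx : ξ j ∈ Icc (0 : ℝ) 1 := ⟨ma.1.trans h1, h2.trans mb.2⟩
    -- The cell is cut at its tag, and R is compared with its value at the left end on the left
    -- piece and at the right end on the right piece. The error is then at most M times the
    -- oscillation of R times the length, so R need not have bounded variation.
    have e : φ (ξ j) * (R (a (j + 1)) - R (a j)) - ((φ (a (j + 1)) * R (a (j + 1)) -
        φ (a j) * R (a j)) - ∫ u in a j..a (j + 1), φ' u * R u) =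
        (∫ u in a j..ξ j, φ' u * (R u - R (a j))) +
          ∫ u in ξ j..a (j + 1), φ' u * (R u - R (a (j + 1))) := by
      simp only [mul_sub]
      rw [intervalIntegral.integral_sub (hint0 _ ma _ mx) (hint' _ _ _),
        intervalIntegral.integral_sub (hint0 _ mx _ mb) (hint' _ _ _),
        intervalIntegral.integral_mul_const, intervalIntegral.integral_mul_const, hftc, hftc,
        ← intervalIntegral.integral_add_adjacent_intervals (hint0 _ ma _ mx) (hint0 _ mx _ mb)]
      ring
    rw [e]
    have b1 : ‖∫ u in a j..ξ j, φ' u * (R u - R (a j))‖ ≤ M * η * |ξ j - a j| := by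
      refine intervalIntegral.norm_integral_le_of_norm_le_const fun u hu' => ?_
      rw [uIoc_of_le h1] at hu'
      have mu : u ∈ Icc (0 : ℝ) 1 := ⟨ma.1.trans hu'.1.le, hu'.2.trans mx.2⟩
      rw [norm_mul]
      gcongr
      · exact hM u mu
      · have := hu u mu (a j) ma (by
          rw [Real.dist_eq, abs_of_nonneg (by linarith [hu'.1])]; linarith [hu'.2])
        rw [Real.dist_eq] at this
        exact this.le
    have b2 : ‖∫ u in ξ j..a (j + 1), φ' u * (R u - R (a (j + 1)))‖ ≤ M * η * |a (j + 1) - ξ j| := by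
      refine intervalIntegral.norm_integral_le_of_norm_le_const fun u hu' => ?_
      rw [uIoc_of_le h2] at hu'
      have mu : u ∈ Icc (0 : ℝ) 1 := ⟨mx.1.trans hu'.1.le, hu'.2.trans mb.2⟩
      rw [norm_mul]
      gcongr
      · exact hM u mu
      · have := hu u mu (a (j + 1)) mb (by
          rw [Real.dist_eq, abs_sub_comm, abs_of_nonneg (by linarith [hu'.2])]; linarith [hu'.1])
        rw [Real.dist_eq] at this
        exact this.le
    rw [Real.norm_eq_abs, abs_of_nonneg (by linarith : 0 ≤ ξ j - a j)] at b1
    rw [Real.norm_eq_abs, abs_of_nonneg (by linarith : 0 ≤ a (j + 1) - ξ j)] at b2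
    calc _ ≤ _ := abs_add_le _ _
      _ ≤ _ := add_le_add b1 b2
      _ = _ := by ring
  have htel : φ 1 * R 1 - φ 0 * R 0 - ∫ x in (0 : ℝ)..1, φ' x * R x =
      ∑ j ∈ Finset.range m, ((φ (a (j + 1)) * R (a (j + 1)) - φ (a j) * R (a j)) -
        ∫ u in a j..a (j + 1), φ' u * R u) := by
    rw [Finset.sum_sub_distrib, Finset.sum_range_sub (fun j => φ (a j) * R (a j)),
      intervalIntegral.sum_integral_adjacent_intervals
        (fun k hk => hint0 _ (hmem k hk.le) _ (hmem (k + 1) hk)), h0, hm]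
  rw [htel, ← Finset.sum_sub_distrib]
  calc _ ≤ ∑ j ∈ Finset.range m, M * η * (a (j + 1) - a j) :=
        (Finset.abs_sum_le_sum_abs _ _).trans
          (Finset.sum_le_sum fun j hjm => hpiece j (Finset.mem_range.1 hjm))
    _ = M * η := by rw [← Finset.mul_sum, Finset.sum_range_sub, h0, hm]; ring
    _ ≤ (M + 1) * η := by gcongr; linarith
    _ = ε / 2 := by rw [hη]; field_simp
    _ < ε := half_lt_self hε

/-! ### The periodic part of the integrator -/

/-- The periodic part of `R`, obtained by subtracting the linear function with the same increment
over `[0, 1]`. -/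
def periodicPart (R : ℝ → ℝ) (x : Torus) : ℝ := R (rep x) - (R 1 - R 0) * rep x

/-- The integral of a `C¹` function `φ` with derivative `φ'` against `κ dx + dρ`. -/
def pairing (κ : ℝ) (ρ φ φ' : Torus → ℝ) : ℝ := κ * (∫ x, φ x) - ∫ x, φ' x * ρ x

lemma rep_coe {x : ℝ} (hx : x ∈ Ico (0 : ℝ) 1) : rep (x : Torus) = x := by
  rw [rep]
  have h := AddCircle.equivIco_coe_eq (p := (1 : ℝ)) (a := 0) (x := x) (by simpa using hx)
  rw [h]

lemma rep_mem (x : Torus) : rep x ∈ Ico (0 : ℝ) 1 := by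
  have := (AddCircle.equivIco (1 : ℝ) 0 x).2
  exact ⟨this.1, this.2.trans_eq (zero_add 1)⟩

lemma integral_torus_eq (f : Torus → ℝ) : ∫ x : Torus, f x = ∫ x in (0 : ℝ)..1, f (x : Torus) := by
  rw [← UnitAddCircle.intervalIntegral_preimage 0 f, zero_add]

lemma intervalIntegral_congr_Ioo {f g : ℝ → ℝ} (h : ∀ x ∈ Ioo (0 : ℝ) 1, f x = g x) :
    ∫ x in (0 : ℝ)..1, f x = ∫ x in (0 : ℝ)..1, g x := by
  rw [intervalIntegral.integral_of_le zero_le_one, intervalIntegral.integral_of_le zero_le_one,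
    integral_Ioc_eq_integral_Ioo, integral_Ioc_eq_integral_Ioo]
  exact setIntegral_congr_fun measurableSet_Ioo h

/-- By periodicity the boundary term of the integration by parts is κφ(0). Substituting R = κx + ρ
and ∫₀¹ xφ' = φ(0) − ∫φ cancels it and leaves κ∫φ − ∫φ'ρ. -/
lemma hasRSIntegral_pairing {φ φ' : Torus → ℝ} {R : ℝ → ℝ} (hφ : HasTorusDeriv φ φ')
    (hφ' : Continuous φ') (hR : ContinuousOn R (Icc 0 1)) :
    HasRSIntegral (fun x : ℝ => φ (x : Torus)) R
      (pairing (R 1 - R 0) (periodicPart R) φ φ') := by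
  have hc : Continuous fun x : ℝ => φ' (x : Torus) := hφ'.comp (AddCircle.continuous_mk' 1)
  convert hasRSIntegral_of_hasDerivAt hφ hc hR using 1
  have h1 : ((1 : ℝ) : Torus) = ((0 : ℝ) : Torus) := by
    rw [AddCircle.coe_period]; rfl
  rw [pairing, integral_torus_eq, integral_torus_eq, h1]
  have e : ∫ x in (0 : ℝ)..1, φ' (x : Torus) * periodicPart R (x : Torus) =
      ∫ x in (0 : ℝ)..1, (φ' (x : Torus) * R x - (R 1 - R 0) * (x * φ' (x : Torus))) := by
    refine intervalIntegral_congr_Ioo fun x hx => ?_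
    rw [periodicPart, rep_coe ⟨hx.1.le, hx.2⟩]; ring
  have hi : IntervalIntegrable (fun x : ℝ => φ' (x : Torus) * R x) volume 0 1 := by
    refine ContinuousOn.intervalIntegrable ?_
    rw [uIcc_of_le zero_le_one]
    exact hc.continuousOn.mul hR
  have hi2 : IntervalIntegrable (fun x : ℝ => (R 1 - R 0) * (x * φ' (x : Torus))) volume 0 1 :=
    Continuous.intervalIntegrable (by fun_prop) _ _
  have hp := intervalIntegral.integral_mul_deriv_eq_deriv_mul (a := 0) (b := 1)
    (u := fun x : ℝ => x) (v := fun x : ℝ => φ (x : Torus)) (u' := fun _ => 1)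
    (v' := fun x : ℝ => φ' (x : Torus)) (fun x _ => hasDerivAt_id x) (fun x _ => hφ x)
    intervalIntegrable_const (hc.intervalIntegrable _ _)
  rw [e, intervalIntegral.integral_sub hi hi2, intervalIntegral.integral_const_mul, hp, h1]
  simp only [one_mul]
  ring

/-- `α`-Hölder continuity on the torus with constant `C`. -/
def HolderTorus (C α : ℝ) (ρ : Torus → ℝ) : Prop := ∀ x y, |ρ x - ρ y| ≤ C * ‖x - y‖ ^ α

lemma HolderTorus.nonneg {C α : ℝ} {ρ : Torus → ℝ} (h : HolderTorus C α ρ) : 0 ≤ C := by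
  have h1 := (abs_nonneg _).trans (h ((1 / 2 : ℝ) : Torus) 0)
  rw [sub_zero] at h1
  have : 0 < ‖((1 / 2 : ℝ) : Torus)‖ ^ α := by
    refine Real.rpow_pos_of_pos (norm_pos_iff.2 fun h0 => ?_) _
    have := congrArg rep h0
    rw [rep_coe ⟨by norm_num, by norm_num⟩, ← AddCircle.coe_zero, rep_coe ⟨le_rfl, one_pos⟩] at this
    norm_num at this
  exact nonneg_of_mul_nonneg_left h1 this

lemma HolderTorus.continuous {C α : ℝ} {ρ : Torus → ℝ} (h : HolderTorus C α ρ) (hα : 0 < α) :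
    Continuous ρ := by
  rw [continuous_iff_continuousAt]
  intro x
  rw [ContinuousAt, tendsto_iff_dist_tendsto_zero]
  have h1 : Tendsto (fun y => C * ‖y - x‖ ^ α) (𝓝 x) (𝓝 0) := by
    have : Continuous fun y : Torus => C * ‖y - x‖ ^ α :=
      continuous_const.mul ((continuous_id.sub continuous_const).norm.rpow_const
        fun _ => Or.inr hα.le)
    have h2 := this.tendsto x
    simpa [Real.zero_rpow hα.ne'] using h2
  exact squeeze_zero (fun _ => dist_nonneg) (fun y => by rw [Real.dist_eq]; exact h y x) h1

/-- The linear correction is α-Hölder on [0,1] since α ≤ 1, and it equalises the values at 0 and 1.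
For points whose shorter arc crosses 0, the increment is split there; this doubles the constant. -/
lemma exists_holderTorus_periodicPart {α : NNReal} (hα : 0 < α) (hα1 : α ≤ 1) {R : ℝ → ℝ}
    (hR : ∃ C : NNReal, HolderOnWith C α R (Icc 0 1)) :
    ∃ C, HolderTorus C α (periodicPart R) := by
  obtain ⟨C, hC⟩ := hR
  set κ := R 1 - R 0 with hκ
  set f : ℝ → ℝ := fun x => R x - κ * x with hf
  have hα0 : (0 : ℝ) < α := hα
  have hα1' : (α : ℝ) ≤ 1 := hα1
  have hH : ∀ a ∈ Icc (0 : ℝ) 1, ∀ b ∈ Icc (0 : ℝ) 1, |f a - f b| ≤ (C + |κ|) * |a - b| ^ (α : ℝ) := by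
    intro a ha b hb
    have h1 := hC.dist_le ha hb
    rw [Real.dist_eq, Real.dist_eq] at h1
    have h2 : |a - b| ≤ |a - b| ^ (α : ℝ) := by
      conv_lhs => rw [← Real.rpow_one |a - b|]
      refine Real.rpow_le_rpow_of_exponent_ge' (abs_nonneg _) ?_ hα0.le hα1'
      rw [abs_le]; constructor <;> linarith [ha.1, ha.2, hb.1, hb.2]
    calc |f a - f b| = |(R a - R b) - κ * (a - b)| := by rw [hf]; congr 1; ring
      _ ≤ |R a - R b| + |κ * (a - b)| := abs_sub _ _
      _ ≤ C * |a - b| ^ (α : ℝ) + |κ| * |a - b| ^ (α : ℝ) := by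
          rw [abs_mul]; gcongr
      _ = _ := by ring
  have h01 : f 1 = f 0 := by simp only [hf, hκ]; ring
  have key : ∀ a ∈ Ico (0 : ℝ) 1, ∀ b ∈ Ico (0 : ℝ) 1, b ≤ a →
      |f a - f b| ≤ 2 * (C + |κ|) * ‖(a : Torus) - (b : Torus)‖ ^ (α : ℝ) := by
    intro a ha b hb hba
    have hK : 0 ≤ C + |κ| := by positivity
    rw [← AddCircle.coe_sub, UnitAddCircle.norm_eq]
    rcases le_total (a - b) (1 / 2) with h | h
    · have hr : |a - b - round (a - b)| = |a - b| := by
        have h3 : ‖((a - b : ℝ) : Torus)‖ = |a - b| := by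
          rw [AddCircle.norm_coe_eq_abs_iff (p := 1) one_ne_zero]
          rw [abs_of_nonneg (by linarith), abs_one]; exact h
        rw [← UnitAddCircle.norm_eq, h3]
      rw [hr]
      refine (hH a ⟨ha.1, ha.2.le⟩ b ⟨hb.1, hb.2.le⟩).trans ?_
      gcongr
      linarith
    -- The shorter arc passes through 0 and has length 1 − (a − b), which dominates both 1 − a and
    -- b.
    · have hr : |a - b - round (a - b)| = 1 - (a - b) := by
        have h3 : ‖((a - b - 1 : ℝ) : Torus)‖ = |a - b - 1| := by
          rw [AddCircle.norm_coe_eq_abs_iff (p := 1) one_ne_zero]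
          rw [abs_of_nonpos (by linarith [ha.2, hb.1]), abs_one]; linarith
        rw [AddCircle.coe_sub, AddCircle.coe_period, sub_zero, UnitAddCircle.norm_eq] at h3
        rw [h3, abs_of_nonpos (by linarith [ha.2, hb.1])]; ring
      rw [hr]
      have h4 := hH a ⟨ha.1, ha.2.le⟩ 1 ⟨zero_le_one, le_rfl⟩
      have h5 := hH 0 ⟨le_rfl, zero_le_one⟩ b ⟨hb.1, hb.2.le⟩
      rw [abs_sub_comm a 1, abs_of_nonneg (by linarith [ha.2] : (0 : ℝ) ≤ 1 - a)] at h4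
      rw [zero_sub, abs_neg, abs_of_nonneg hb.1] at h5
      calc |f a - f b| = |(f a - f 1) + (f 0 - f b)| := by rw [h01]; congr 1; ring
        _ ≤ _ := abs_add_le _ _
        _ ≤ (C + |κ|) * (1 - (a - b)) ^ (α : ℝ) + (C + |κ|) * (1 - (a - b)) ^ (α : ℝ) := by
            refine add_le_add (h4.trans ?_) (h5.trans ?_)
            · gcongr
              · linarith [ha.2]
              · linarith [hb.1]
            · gcongr
              · exact hb.1
              · linarith [ha.2]
        _ = _ := by ring
  refine ⟨2 * (C + |κ|), fun x y => ?_⟩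
  have hx := rep_mem x
  have hy := rep_mem y
  have hxy : |periodicPart R x - periodicPart R y| = |f (rep x) - f (rep y)| := rfl
  rw [hxy]
  rcases le_total (rep y) (rep x) with h | h
  · have := key _ hx _ hy h
    rwa [coe_rep, coe_rep] at this
  · have := key _ hy _ hx h
    rwa [coe_rep, coe_rep, abs_sub_comm, norm_sub_rev] at this

/-! ### The iterated integrals -/

lemma path_cons {n : ℕ} (x y z₀ : Torus) (z : Fin n → Torus) :
    path x y (Fin.cons (α := fun _ => Torus) z₀ z) =
      Fin.cons (α := fun _ => Torus) x (path z₀ y z) := by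
  rw [path, path]
  congr 1
  exact (Fin.cons_snoc_eq_snoc_cons z₀ z y).symm

lemma pathWeight_cons {n : ℕ} (s : Fin (n + 2) → ℝ) (x y z₀ : Torus) (z : Fin n → Torus) :
    pathWeight s x y (Fin.cons (α := fun _ => Torus) z₀ z) =
      heatKernel (s 0) x z₀ * pathWeight (Fin.tail s) z₀ y z := by
  rw [pathWeight, Fin.prod_univ_succ, path_cons]
  rfl

/-- The iterated integrals exist, and the inner term is computed recursively, as soon as each
integrand is `C¹`. -/
lemma rsIntegrableN_pathWeight_succ {R : ℝ → ℝ} {n : ℕ} {s : Fin (n + 2) → ℝ} {x y : Torus}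
    {I : ℝ} (h : ∀ z : Torus, RSIntegrableN R n (pathWeight (Fin.tail s) z y))
    (hI : HasRSIntegral (fun z : ℝ => heatKernel (s 0) x z * innerTerm R (Fin.tail s) (z : Torus) y)
      R I) :
    RSIntegrableN R (n + 1) (pathWeight s x y) ∧ innerTerm R s x y = I := by
  have e : ∀ z : ℝ, rsIntegralN R n
      (fun w => pathWeight s x y (Fin.cons (α := fun _ => Torus) (z : Torus) w)) =
      heatKernel (s 0) x z * innerTerm R (Fin.tail s) (z : Torus) y := by
    intro z
    simp only [pathWeight_cons]
    exact ((h z).const_mul _).2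
  refine ⟨⟨fun z => ?_, ?_⟩, ?_⟩
  · simp only [pathWeight_cons]
    exact ((h z).const_mul _).1
  · simp only [e]; exact hI.rsIntegrable
  · simp only [innerTerm, rsIntegralN, e]; exact hI.rsIntegral_eq

end RoughTorus
end

/-! ### The pairing and one rough step between two heat kernels. -/

noncomputable section

namespace RoughTorus

/-! ### Calculus of the pairing -/

lemma HasTorusDeriv.mul {φ φ' ψ ψ' : Torus → ℝ} (h : HasTorusDeriv φ φ') (k : HasTorusDeriv ψ ψ') :
    HasTorusDeriv (fun x => φ x * ψ x) (fun x => φ' x * ψ x + φ x * ψ' x) :=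
  fun x => (h x).mul (k x)

lemma HasTorusDeriv.comp_sub_const {φ φ' : Torus → ℝ} (h : HasTorusDeriv φ φ') (w : Torus) :
    HasTorusDeriv (fun x => φ (x - w)) (fun x => φ' (x - w)) := by
  obtain ⟨w, rfl⟩ := exists_coe_eq w
  intro x
  have := (h (x - w)).comp_sub_const x w
  simpa only [AddCircle.coe_sub] using this

lemma HasTorusDeriv.comp_const_sub {φ φ' : Torus → ℝ} (h : HasTorusDeriv φ φ') (w : Torus) :
    HasTorusDeriv (fun x => φ (w - x)) (fun x => -φ' (w - x)) := by
  obtain ⟨w, rfl⟩ := exists_coe_eq w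
  intro x
  have := (h (w - x)).comp_const_sub w x
  simpa only [AddCircle.coe_sub] using this

lemma HasTorusDeriv.unique {φ φ' φ'' : Torus → ℝ} (h : HasTorusDeriv φ φ')
    (k : HasTorusDeriv φ φ'') : φ' = φ'' := by
  funext x
  obtain ⟨x, rfl⟩ := exists_coe_eq x
  exact (h x).unique (k x)

lemma exists_bound_of_continuous {φ : Torus → ℝ} (h : Continuous φ) :
    ∃ M, 0 ≤ M ∧ ∀ x, |φ x| ≤ M := by
  obtain ⟨M, hM⟩ := isCompact_univ.exists_bound_of_continuousOn h.continuousOn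
  exact ⟨M, (norm_nonneg _).trans (hM 0 (mem_univ _)), fun x => hM x (mem_univ x)⟩

lemma hasTorusDeriv_conv {φ φ' u : Torus → ℝ} (h : HasTorusDeriv φ φ') (hφ' : Continuous φ')
    (hu : Integrable u) :
    HasTorusDeriv (fun x => ∫ w, φ (x - w) * u w) (fun x => ∫ w, φ' (x - w) * u w) := by
  intro x
  obtain ⟨M, hM0, hM⟩ := exists_bound_of_continuous hφ'
  obtain ⟨N, hN0, hN⟩ := exists_bound_of_continuous h.continuous
  have hm : ∀ {ψ : Torus → ℝ} (y : Torus), Continuous ψ →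
      AEStronglyMeasurable (fun w => ψ (y - w) * u w) volume := fun y hψ =>
    ((hψ.comp (by fun_prop : Continuous fun w => y - w)).aestronglyMeasurable).mul
      hu.aestronglyMeasurable
  refine (hasDerivAt_integral_of_dominated_loc_of_deriv_le (μ := volume)
    (F := fun (y : ℝ) w => φ ((y : Torus) - w) * u w)
    (F' := fun (y : ℝ) w => φ' ((y : Torus) - w) * u w) (x₀ := x) (s := univ)
    (bound := fun w => M * ‖u w‖) univ_mem
    (Eventually.of_forall fun y => hm _ h.continuous) ?_ (hm _ hφ') ?_ (hu.norm.const_mul M) ?_).2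
  · exact (hu.norm.const_mul N).mono' (hm _ h.continuous) (Eventually.of_forall fun w => by
      rw [norm_mul]; gcongr; exact hN _)
  · exact Eventually.of_forall fun w y _ => by rw [norm_mul]; gcongr; exact hM _
  · exact Eventually.of_forall fun w y _ => ((h.comp_sub_const w) y).mul_const _

/-- Both sides are the derivative in x of the semigroup identity. -/
lemma heatD_conv {s t : ℝ} (hs : 0 < s) (ht : 0 < t) (x y : Torus) :
    ∫ w : Torus, heatD s (x - w) * heat t (w - y) = heatD (s + t) (x - y) := by
  have hu : Integrable fun w => heat t (w - y) :=
    ((continuous_heat ht).comp (by fun_prop : Continuous fun w => w - y)).integrable_torus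
  have h1 := hasTorusDeriv_conv (hasTorusDeriv_heat hs) (continuous_heatD hs) hu
  simp only [heat_conv hs ht] at h1
  exact congrFun (h1.unique ((hasTorusDeriv_heat (add_pos hs ht)).comp_sub_const y)) x

lemma heat_conv_heatD {s t : ℝ} (hs : 0 < s) (ht : 0 < t) (x y : Torus) :
    ∫ w : Torus, heat s (x - w) * heatD t (w - y) = heatD (s + t) (x - y) := by
  have h := heatD_conv ht hs y x
  rw [← neg_sub x y, heatD_neg, add_comm t s] at h
  rw [← neg_eq_iff_eq_neg.2 h, ← integral_neg]
  congr 1; funext w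
  rw [← neg_sub w y, heatD_neg, heat_sub_comm s w x]; ring

/-- Functions on a finite measure space which are measurable and bounded are integrable. -/
lemma integrable_of_measurable_of_bound {α : Type*} [MeasurableSpace α] {μ : Measure α}
    [IsFiniteMeasure μ] {f : α → ℝ} (hf : Measurable f) {M : ℝ} (hM : ∀ x, |f x| ≤ M) :
    Integrable f μ :=
  Integrable.of_bound hf.aestronglyMeasurable M (Eventually.of_forall hM)

lemma exists_bound_of_continuous_uncurry {φ : Torus × Torus → ℝ} (h : Continuous φ) :
    ∃ M, 0 ≤ M ∧ ∀ p, |φ p| ≤ M := by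
  obtain ⟨M, hM⟩ := isCompact_univ.exists_bound_of_continuousOn h.continuousOn
  exact ⟨M, (norm_nonneg _).trans (hM (0, 0) (mem_univ _)), fun x => hM x (mem_univ x)⟩

lemma integral_mul_integral_swap {u : Torus → ℝ} (hu : Integrable u) {φ : Torus × Torus → ℝ}
    (hφ : Continuous φ) {ρ : Torus → ℝ} (hρ : Continuous ρ) :
    ∫ w, u w * ∫ z, φ (z, w) * ρ z = ∫ z, (∫ w, u w * φ (z, w)) * ρ z := by
  obtain ⟨M, hM0, hM⟩ := exists_bound_of_continuous_uncurry
    (φ := fun p => φ (p.2, p.1) * ρ p.2) (by fun_prop)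
  have hi : Integrable (Function.uncurry fun w z => u w * (φ (z, w) * ρ z))
      ((volume : Measure Torus).prod volume) := by
    have hmeas : AEStronglyMeasurable (fun p : Torus × Torus => φ (p.2, p.1) * ρ p.2)
        ((volume : Measure Torus).prod volume) :=
      (by fun_prop : Continuous fun p : Torus × Torus => φ (p.2, p.1) * ρ p.2).aestronglyMeasurable
    exact (hu.comp_fst volume).mul_bdd hmeas (Eventually.of_forall hM)
  have := integral_integral_swap hi
  simp only [integral_const_mul] at this
  rw [this]
  congr 1; funext z
  rw [← integral_mul_const]
  congr 1; funext w; ring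

/-- After integration by parts a Stieltjes integral is a Lebesgue integral, so Fubini exchanges it
with integration against any integrable weight. -/
lemma integral_mul_pairing {κ : ℝ} {ρ : Torus → ℝ} (hρ : Continuous ρ) {u : Torus → ℝ}
    (hu : Integrable u) {φ φ' : Torus × Torus → ℝ} (hφ : Continuous φ) (hφ' : Continuous φ') :
    ∫ w, u w * pairing κ ρ (fun z => φ (z, w)) (fun z => φ' (z, w)) =
      pairing κ ρ (fun z => ∫ w, u w * φ (z, w)) (fun z => ∫ w, u w * φ' (z, w)) := by
  have h1 := integral_mul_integral_swap hu hφ (continuous_const (y := (1 : ℝ)))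
  have h2 := integral_mul_integral_swap hu hφ' hρ
  simp only [mul_one] at h1
  have hb : ∀ {ψ : Torus × Torus → ℝ}, Continuous ψ → Integrable fun w => u w * ∫ z, ψ (z, w) := by
    intro ψ hψ
    obtain ⟨M, hM0, hM⟩ := exists_bound_of_continuous_uncurry hψ
    have hψ' : Measurable fun w => ∫ z, ψ (z, w) :=
      (StronglyMeasurable.integral_prod_right' (f := fun p : Torus × Torus => ψ (p.2, p.1))
        (hψ.comp continuous_swap).stronglyMeasurable).measurable
    refine hu.mul_bdd (c := M) hψ'.aestronglyMeasurable (Eventually.of_forall fun w => ?_)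
    refine (norm_integral_le_of_norm_le_const (Eventually.of_forall fun z => hM (z, w))).trans ?_
    simp
  simp only [pairing]
  rw [← h1, ← h2, ← integral_const_mul, ← integral_sub ((hb hφ).const_mul κ)
    (hb (ψ := fun p => φ' p * ρ p.1) (by fun_prop))]
  congr 1; funext w; ring

/-! ### One rough step between two heat kernels -/

/-- The integral of `z ↦ p(a; w, z) p(b; z, w')` against `κ dx + dρ`. -/
def stepKernel (κ : ℝ) (ρ : Torus → ℝ) (a b : ℝ) (w w' : Torus) : ℝ :=
  pairing κ ρ (fun z => heat a (w - z) * heat b (z - w'))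
    (fun z => -heatD a (w - z) * heat b (z - w') + heat a (w - z) * heatD b (z - w'))

lemma measurable_stepKernel {κ : ℝ} {ρ : Torus → ℝ} (hρ : Measurable ρ) :
    Measurable fun p : (ℝ × ℝ) × Torus × Torus => stepKernel κ ρ p.1.1 p.1.2 p.2.1 p.2.2 := by
  have h : ∀ {f : ((ℝ × ℝ) × Torus × Torus) × Torus → ℝ}, Measurable f →
      Measurable fun p => ∫ z, f (p, z) := fun hf =>
    (StronglyMeasurable.integral_prod_right' hf.stronglyMeasurable).measurable
  unfold stepKernel pairing
  have ha : Measurable fun q : ((ℝ × ℝ) × Torus × Torus) × Torus => q.1.1.1 := by fun_prop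
  have hb : Measurable fun q : ((ℝ × ℝ) × Torus × Torus) × Torus => q.1.1.2 := by fun_prop
  have hw : Measurable fun q : ((ℝ × ℝ) × Torus × Torus) × Torus => q.1.2.1 - q.2 := by fun_prop
  have hw' : Measurable fun q : ((ℝ × ℝ) × Torus × Torus) × Torus => q.2 - q.1.2.2 := by fun_prop
  refine ((h ((ha.heat hw).mul (hb.heat hw'))).const_mul κ).sub ?_
  exact h (((((ha.heatD hw).neg).mul (hb.heat hw')).add ((ha.heat hw).mul (hb.heatD hw'))).mul
    (hρ.comp measurable_snd))

lemma _root_.Measurable.stepKernel {β : Type*} [MeasurableSpace β] {κ : ℝ} {ρ : Torus → ℝ}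
    (hρ : Measurable ρ) {a b : β → ℝ} {w w' : β → Torus} (ha : Measurable a) (hb : Measurable b)
    (hw : Measurable w) (hw' : Measurable w') :
    Measurable fun p => RoughTorus.stepKernel κ ρ (a p) (b p) (w p) (w' p) :=
  (measurable_stepKernel hρ).comp ((ha.prodMk hb).prodMk (hw.prodMk hw'))

lemma rpow_neg_le_rpow_neg {a b g : ℝ} (ha : 0 < a) (hab : a ≤ b) (hg : 0 ≤ g) :
    b ^ (-g) ≤ a ^ (-g) :=
  Real.rpow_le_rpow_of_nonpos ha hab (by linarith)

/-- The rough step is bounded by a Gaussian with an integrable singularity in time. -/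
lemma abs_stepKernel_le {κ C α T a b : ℝ} {ρ : Torus → ℝ} (hα : 0 < α) (hα1 : α ≤ 1)
    (hρ : HolderTorus C α ρ) (ha : 0 < a) (hb : 0 < b) (haT : a ≤ T) (w w' : Torus) :
    |stepKernel κ ρ a b w w'| ≤ (32 * C + 2 * |κ| * T ^ ((1 - α) / 2)) *
      (a ^ (-((1 - α) / 2)) + b ^ (-((1 - α) / 2))) * heat (4 * (a + b)) (w - w') := by
  have hC := hρ.nonneg
  have hρc := hρ.continuous hα
  set g := (1 - α) / 2 with hg
  have hg0 : 0 ≤ g := by rw [hg]; linarith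
  have hab := add_pos ha hb
  set H := heat (4 * (a + b)) (w - w') with hH
  have hH0 : 0 ≤ H := heat_nonneg _ _
  have ca : Continuous fun z => heat a (w - z) := (continuous_heat ha).comp (by fun_prop)
  have cb : Continuous fun z => heat b (z - w') := (continuous_heat hb).comp (by fun_prop)
  have cda : Continuous fun z => heatD a (w - z) := (continuous_heatD ha).comp (by fun_prop)
  have cdb : Continuous fun z => heatD b (z - w') := (continuous_heatD hb).comp (by fun_prop)
  have ca2 : Continuous fun z => heat (2 * a) (w - z) :=
    (continuous_heat (by linarith)).comp (by fun_prop)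
  have cb2 : Continuous fun z => heat (2 * b) (z - w') :=
    (continuous_heat (by linarith)).comp (by fun_prop)
  set T1 := ∫ z, -heatD a (w - z) * heat b (z - w') * (ρ z - ρ w) with hT1
  set T2 := ∫ z, heat a (w - z) * heatD b (z - w') * (ρ z - ρ w') with hT2
  -- Each derivative is paired with the increment of ρ from its own singular point: w for the kernel
  -- at time a, w' for the kernel at time b. By the semigroup law the two subtracted constants sum
  -- to the increment ρ(w') − ρ(w) against the derivative at time a + b, which is again of Hölder
  -- type.
  have e : stepKernel κ ρ a b w w' = κ * heat (a + b) (w - w') -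
      (T1 + T2 + (ρ w' - ρ w) * heatD (a + b) (w - w')) := by
    have e1 : ∫ z, -heatD a (w - z) * heat b (z - w') * ρ w = -heatD (a + b) (w - w') * ρ w := by
      rw [integral_mul_const, ← heatD_conv ha hb, ← integral_neg]
      simp only [neg_mul]
    have e2 : ∫ z, heat a (w - z) * heatD b (z - w') * ρ w' = heatD (a + b) (w - w') * ρ w' := by
      rw [integral_mul_const, heat_conv_heatD ha hb]
    rw [stepKernel, pairing, heat_conv ha hb]
    congr 1
    have e3 : ∀ z, (-heatD a (w - z) * heat b (z - w') + heat a (w - z) * heatD b (z - w')) * ρ z =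
      ((-heatD a (w - z) * heat b (z - w') * (ρ z - ρ w) +
        heat a (w - z) * heatD b (z - w') * (ρ z - ρ w')) +
        -heatD a (w - z) * heat b (z - w') * ρ w) + heat a (w - z) * heatD b (z - w') * ρ w' := by
      intro z; ring
    simp only [e3]
    rw [integral_add (Continuous.integrable_torus (by fun_prop))
        (Continuous.integrable_torus (by fun_prop)),
      integral_add (Continuous.integrable_torus (by fun_prop))
        (Continuous.integrable_torus (by fun_prop)),
      integral_add (Continuous.integrable_torus (by fun_prop))
        (Continuous.integrable_torus (by fun_prop)), e1, e2]
    ring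
  have hexp : (α - 1) / 2 = -g := by rw [hg]; ring
  -- All Gaussians that occur have times between a + b and 4(a + b); comparing with the largest one
  -- costs √4.
  have hscale : ∀ c, a + b ≤ c → c ≤ 4 * (a + b) → heat c (w - w') ≤ 2 * H := by
    intro c h1 h2
    have hc : 0 < c := hab.trans_le h1
    refine (heat_le_of_le hc h2 _).trans ?_
    gcongr
    rw [Real.sqrt_le_left (by norm_num), div_le_iff₀ hc]
    linarith
  have b1 : |T1| ≤ 16 * C * a ^ (-g) * H := by
    have : |T1| ≤ ∫ z, C * (8 * a ^ (-g)) * (heat (2 * a) (w - z) * heat b (z - w')) := by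
      rw [← Real.norm_eq_abs]
      refine norm_integral_le_of_norm_le (Continuous.integrable_torus (by fun_prop))
        (Eventually.of_forall fun z => ?_)
      rw [norm_mul, norm_mul, norm_neg, Real.norm_eq_abs, Real.norm_eq_abs, Real.norm_eq_abs,
        abs_of_nonneg (heat_nonneg b _)]
      have h1 := abs_heatD_mul_rpow_le ha hα.le hα1 (w - z)
      rw [hexp] at h1
      have h2 := hρ z w
      rw [norm_sub_rev] at h2
      have hb0 := heat_nonneg b (z - w')
      calc _ ≤ |heatD a (w - z)| * heat b (z - w') * (C * ‖w - z‖ ^ α) := by gcongr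
        _ = C * (|heatD a (w - z)| * ‖w - z‖ ^ α) * heat b (z - w') := by ring
        _ ≤ C * (8 * a ^ (-g) * heat (2 * a) (w - z)) * heat b (z - w') := by gcongr
        _ = _ := by ring
    rw [integral_const_mul, heat_conv (by linarith) hb] at this
    have h3 := hscale (2 * a + b) (by linarith) (by linarith)
    calc _ ≤ _ := this
      _ ≤ C * (8 * a ^ (-g)) * (2 * H) := by gcongr
      _ = _ := by ring
  have b2 : |T2| ≤ 16 * C * b ^ (-g) * H := by
    have : |T2| ≤ ∫ z, C * (8 * b ^ (-g)) * (heat a (w - z) * heat (2 * b) (z - w')) := by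
      rw [← Real.norm_eq_abs]
      refine norm_integral_le_of_norm_le (Continuous.integrable_torus (by fun_prop))
        (Eventually.of_forall fun z => ?_)
      rw [norm_mul, norm_mul, Real.norm_eq_abs, Real.norm_eq_abs, Real.norm_eq_abs,
        abs_of_nonneg (heat_nonneg a _)]
      have h1 := abs_heatD_mul_rpow_le hb hα.le hα1 (z - w')
      rw [hexp] at h1
      have h2 := hρ z w'
      have ha0 := heat_nonneg a (w - z)
      calc _ ≤ heat a (w - z) * |heatD b (z - w')| * (C * ‖z - w'‖ ^ α) := by gcongr
        _ = C * (|heatD b (z - w')| * ‖z - w'‖ ^ α) * heat a (w - z) := by ring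
        _ ≤ C * (8 * b ^ (-g) * heat (2 * b) (z - w')) * heat a (w - z) := by gcongr
        _ = _ := by ring
    rw [integral_const_mul, heat_conv ha (by linarith)] at this
    have h3 := hscale (a + 2 * b) (by linarith) (by linarith)
    calc _ ≤ _ := this
      _ ≤ C * (8 * b ^ (-g)) * (2 * H) := by gcongr
      _ = _ := by ring
  have b3 : |(ρ w' - ρ w) * heatD (a + b) (w - w')| ≤ 16 * C * a ^ (-g) * H := by
    rw [abs_mul]
    have h1 := abs_heatD_mul_rpow_le hab hα.le hα1 (w - w')
    rw [hexp] at h1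
    have h2 := hρ w' w
    rw [norm_sub_rev] at h2
    have h3 := hscale (2 * (a + b)) (by linarith) (by linarith)
    have h4 : (a + b) ^ (-g) ≤ a ^ (-g) := rpow_neg_le_rpow_neg ha (by linarith) hg0
    calc _ ≤ C * ‖w - w'‖ ^ α * |heatD (a + b) (w - w')| := by gcongr
      _ = C * (|heatD (a + b) (w - w')| * ‖w - w'‖ ^ α) := by ring
      _ ≤ C * (8 * (a + b) ^ (-g) * heat (2 * (a + b)) (w - w')) := by gcongr
      _ ≤ C * (8 * a ^ (-g) * (2 * H)) := by
          have := heat_nonneg (2 * (a + b)) (w - w')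
          gcongr
      _ = _ := by ring
  -- The drift term is not singular; a factor (T/a)^g ≥ 1 brings it to the common form.
  have b4 : |κ * heat (a + b) (w - w')| ≤ 2 * |κ| * T ^ g * a ^ (-g) * H := by
    rw [abs_mul, abs_of_nonneg (heat_nonneg _ _)]
    have h3 := hscale (a + b) le_rfl (by linarith)
    have h4 : 1 ≤ T ^ g * a ^ (-g) := by
      rw [Real.rpow_neg ha.le, ← div_eq_mul_inv, one_le_div (by positivity)]
      gcongr
    calc _ ≤ |κ| * (2 * H) := by gcongr
      _ = 2 * |κ| * H * 1 := by ring
      _ ≤ 2 * |κ| * H * (T ^ g * a ^ (-g)) := by gcongr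
      _ = _ := by ring
  have hT : 0 ≤ T := ha.le.trans haT
  rw [e]
  have hbg : 0 ≤ b ^ (-g) := by positivity
  have hTg : 0 ≤ T ^ g := by positivity
  calc _ ≤ |κ * heat (a + b) (w - w')| +
        |T1 + T2 + (ρ w' - ρ w) * heatD (a + b) (w - w')| := abs_sub _ _
    _ ≤ 2 * |κ| * T ^ g * a ^ (-g) * H +
        (16 * C * a ^ (-g) * H + 16 * C * b ^ (-g) * H + 16 * C * a ^ (-g) * H) := by
        refine add_le_add b4 ((abs_add_le _ _).trans (add_le_add ((abs_add_le _ _).trans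
          (add_le_add b1 b2)) b3))
    _ ≤ _ := by
        have h5 : 0 ≤ (16 * C + 2 * |κ| * T ^ g) * b ^ (-g) * H := by positivity
        nlinarith

/-- The left variable enters only through the kernel at time a and its derivative, on which
convolution acts by the semigroup law. -/
lemma heat_conv_stepKernel {κ : ℝ} {ρ : Torus → ℝ} (hρ : Continuous ρ) {c a b : ℝ} (hc : 0 < c)
    (ha : 0 < a) (hb : 0 < b) (x w : Torus) :
    ∫ v, heat c (x - v) * stepKernel κ ρ a b v w = stepKernel κ ρ (c + a) b x w := by
  have hu : Integrable fun v => heat c (x - v) :=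
    ((continuous_heat hc).comp (by fun_prop : Continuous fun v => x - v)).integrable_torus
  have ch := continuous_heat ha
  have chD := continuous_heatD ha
  have chb := continuous_heat hb
  have chDb := continuous_heatD hb
  have h := integral_mul_pairing (κ := κ) hρ hu
    (φ := fun p => heat a (p.2 - p.1) * heat b (p.1 - w))
    (φ' := fun p => -heatD a (p.2 - p.1) * heat b (p.1 - w) + heat a (p.2 - p.1) * heatD b (p.1 - w))
    (by fun_prop) (by fun_prop)
  simp only [stepKernel]
  rw [h]
  have ch' := continuous_heat hc
  congr 1
  · funext z
    simp only [← mul_assoc]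
    rw [integral_mul_const, heat_conv hc ha]
  · funext z
    have e : ∀ v, heat c (x - v) * (-heatD a (v - z) * heat b (z - w) + heat a (v - z) * heatD b (z - w))
        = heat c (x - v) * heatD a (v - z) * (-heat b (z - w)) +
          heat c (x - v) * heat a (v - z) * heatD b (z - w) := by intro v; ring
    simp only [e]
    rw [integral_add (Continuous.integrable_torus (by fun_prop))
        (Continuous.integrable_torus (by fun_prop)), integral_mul_const, integral_mul_const,
      heat_conv hc ha, heat_conv_heatD hc ha]
    ring

end RoughTorus
end

/-! ### Chains of rough steps and their Gaussian bounds. -/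

noncomputable section

namespace RoughTorus

/-! ### Chains of rough steps -/

/-- Drop the first time and halve the second one. -/
def halve {n : ℕ} (s : Fin (n + 2) → ℝ) : Fin (n + 1) → ℝ :=
  Fin.cons (α := fun _ => ℝ) (s 1 / 2) fun i => s i.succ.succ

/-- The integral of `∏ p(sᵢ; xᵢ, xᵢ₊₁)` against `κ dx + dρ` in all intermediate variables, written
with the heat kernels following a rough step split in the middle. -/
def chain (κ : ℝ) (ρ : Torus → ℝ) : (n : ℕ) → (Fin (n + 1) → ℝ) → Torus → Torus → ℝ
  | 0, s, x, y => heat (s 0) (x - y)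
  | n + 1, s, x, y => ∫ w, stepKernel κ ρ (s 0) (s 1 / 2) x w * chain κ ρ n (halve s) w y

lemma halve_zero {n : ℕ} (s : Fin (n + 2) → ℝ) : halve s 0 = s 1 / 2 := rfl

lemma halve_succ {n : ℕ} (s : Fin (n + 2) → ℝ) (i : Fin n) : halve s i.succ = s i.succ.succ := rfl

lemma halve_pos {n : ℕ} {s : Fin (n + 2) → ℝ} (hs : ∀ i, 0 < s i) (i : Fin (n + 1)) :
    0 < halve s i := by
  refine Fin.cases ?_ (fun j => ?_) i
  · exact half_pos (hs 1)
  · exact hs _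

lemma halve_le {n : ℕ} {s : Fin (n + 2) → ℝ} {τ : ℝ} (hs : ∀ i, 0 < s i) (hτ : ∀ i, s i ≤ τ)
    (i : Fin (n + 1)) : halve s i ≤ τ := by
  refine Fin.cases ?_ (fun j => ?_) i
  · exact (half_le_self (hs 1).le).trans (hτ 1)
  · exact hτ _

/-- Halving loses no time: the Gaussians of the step and of the remaining chain convolve to one at
four times the total time. -/
lemma sum_halve {n : ℕ} (s : Fin (n + 2) → ℝ) : s 0 + s 1 / 2 + ∑ i, halve s i = ∑ i, s i := by
  rw [Fin.sum_univ_succ, Fin.sum_univ_succ (n := n + 1), Fin.sum_univ_succ (n := n)]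
  simp only [halve_zero, halve_succ]
  have : (Fin.succ 0 : Fin (n + 2)) = 1 := rfl
  rw [this]; ring

lemma measurable_halve {n : ℕ} : Measurable (halve (n := n)) := by
  refine measurable_pi_iff.2 fun i => ?_
  refine Fin.cases ?_ (fun j => ?_) i
  · exact (measurable_pi_apply 1).div_const 2
  · exact measurable_pi_apply _

variable {κ : ℝ} {ρ : Torus → ℝ}

lemma measurable_chain (hρ : Measurable ρ) : ∀ n : ℕ,
    Measurable fun p : (Fin (n + 1) → ℝ) × Torus × Torus => chain κ ρ n p.1 p.2.1 p.2.2
  | 0 => ((measurable_pi_apply 0).comp measurable_fst).heat (by fun_prop)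
  | n + 1 => by
    have ih := measurable_chain hρ n
    have h : ∀ {f : ((Fin (n + 2) → ℝ) × Torus × Torus) × Torus → ℝ}, Measurable f →
        Measurable fun p => ∫ z, f (p, z) := fun hf =>
      (StronglyMeasurable.integral_prod_right' hf.stronglyMeasurable).measurable
    simp only [chain]
    refine h (f := fun q => stepKernel κ ρ (q.1.1 0) (q.1.1 1 / 2) q.1.2.1 q.2 *
      chain κ ρ n (halve q.1.1) q.2 q.1.2.2) ?_
    have h0 : Measurable fun q : ((Fin (n + 2) → ℝ) × Torus × Torus) × Torus => q.1.1 0 := by fun_prop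
    have h1 : Measurable fun q : ((Fin (n + 2) → ℝ) × Torus × Torus) × Torus => q.1.1 1 / 2 := by
      fun_prop
    refine (Measurable.stepKernel hρ h0 h1 (by fun_prop) measurable_snd).mul ?_
    exact ih.comp (((measurable_halve.comp (measurable_fst.comp measurable_fst))).prodMk
      (measurable_snd.prodMk (by fun_prop)))

lemma measurable_chain_left (hρ : Measurable ρ) {n : ℕ} (s : Fin (n + 1) → ℝ) (y : Torus) :
    Measurable fun x => chain κ ρ n s x y :=
  (measurable_chain hρ n).comp
    (measurable_const.prodMk (measurable_id.prodMk measurable_const))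

/-- The time weight bounding a chain. -/
def chainWeight (A τ g : ℝ) {n : ℕ} (s : Fin (n + 1) → ℝ) : ℝ :=
  2 * A ^ n * τ ^ (g * (n + 1)) * (s 0) ^ (-g) * ∏ i : Fin n, (s i.succ) ^ (-(2 * g))

lemma chainWeight_nonneg {A τ g : ℝ} (hA : 0 ≤ A) (hτ : 0 ≤ τ) {n : ℕ} {s : Fin (n + 1) → ℝ}
    (hs : ∀ i, 0 < s i) : 0 ≤ chainWeight A τ g s := by
  have : 0 ≤ ∏ i : Fin n, (s i.succ) ^ (-(2 * g)) :=
    Finset.prod_nonneg fun i _ => Real.rpow_nonneg (hs _).le _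
  have := Real.rpow_nonneg (hs 0).le (-g)
  unfold chainWeight
  positivity

/-- Induction step for the time weight. The second time is singular with exponent −g at the end of
the step and again at the start of the remaining chain, hence −2g = α − 1 in total, still
integrable. Where a power is missing, a factor (τ/s)^g ≥ 1 supplies it. The two summands and the
halving produce the 4 that cancels A/4. -/
lemma chainWeight_halve_le {A τ g : ℝ} (hA : 0 ≤ A) (hg0 : 0 ≤ g) (hg1 : 2 * g ≤ 1) {n : ℕ}
    {s : Fin (n + 2) → ℝ} (hs : ∀ i, 0 < s i) (hτ : ∀ i, s i ≤ τ) :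
    A / 4 * ((s 0) ^ (-g) + (s 1 / 2) ^ (-g)) * chainWeight A τ g (halve s) ≤
      chainWeight A τ g s := by
  have h0 := hs 0
  have h1 := hs 1
  have hτ0 : 0 < τ := h0.trans_le (hτ 0)
  have hP : 0 ≤ ∏ i : Fin n, (s i.succ.succ) ^ (-(2 * g)) :=
    Finset.prod_nonneg fun i _ => Real.rpow_nonneg (hs _).le _
  have key : ((s 0) ^ (-g) + (s 1 / 2) ^ (-g)) * (s 1 / 2) ^ (-g) ≤
      4 * τ ^ g * (s 0) ^ (-g) * (s 1) ^ (-(2 * g)) := by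
    have e1 : (s 1 / 2) ^ (-g) = (s 1 / 2) ^ g * (s 1 / 2) ^ (-(2 * g)) := by
      rw [← Real.rpow_add (half_pos h1)]; congr 1; ring
    have e2 : (s 1 / 2) ^ (-g) * (s 1 / 2) ^ (-g) = (s 1 / 2) ^ (-(2 * g)) := by
      rw [← Real.rpow_add (half_pos h1)]; congr 1; ring
    have e3 : (s 0) ^ g * (s 0) ^ (-g) = 1 := by
      rw [← Real.rpow_add h0, add_neg_cancel, Real.rpow_zero]
    have l1 : (s 1 / 2) ^ g ≤ τ ^ g := by
      have := hτ 1
      gcongr; linarith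
    have l2 : (s 0) ^ g ≤ τ ^ g := by
      have := hτ 0
      gcongr
    have l3 : (s 1 / 2) ^ (-(2 * g)) ≤ 2 * (s 1) ^ (-(2 * g)) := by
      rw [Real.div_rpow h1.le two_pos.le, Real.rpow_neg two_pos.le, div_inv_eq_mul, mul_comm]
      have : (2 : ℝ) ^ (2 * g) ≤ 2 := by
        calc (2 : ℝ) ^ (2 * g) ≤ 2 ^ (1 : ℝ) :=
              Real.rpow_le_rpow_of_exponent_le one_le_two hg1
          _ = 2 := Real.rpow_one 2
      gcongr
    have p0 : 0 ≤ (s 0) ^ (-g) := by positivity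
    have p1 : 0 ≤ (s 1 / 2) ^ (-(2 * g)) := by positivity
    calc ((s 0) ^ (-g) + (s 1 / 2) ^ (-g)) * (s 1 / 2) ^ (-g)
        = (s 0) ^ (-g) * (s 1 / 2) ^ (-g) + (s 1 / 2) ^ (-g) * (s 1 / 2) ^ (-g) := by ring
      _ = (s 0) ^ (-g) * ((s 1 / 2) ^ g * (s 1 / 2) ^ (-(2 * g))) +
          ((s 0) ^ g * (s 0) ^ (-g)) * (s 1 / 2) ^ (-(2 * g)) := by rw [e2, e3, one_mul, ← e1]
      _ ≤ (s 0) ^ (-g) * (τ ^ g * (s 1 / 2) ^ (-(2 * g))) +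
          (τ ^ g * (s 0) ^ (-g)) * (s 1 / 2) ^ (-(2 * g)) := by gcongr
      _ = 2 * τ ^ g * (s 0) ^ (-g) * (s 1 / 2) ^ (-(2 * g)) := by ring
      _ ≤ 2 * τ ^ g * (s 0) ^ (-g) * (2 * (s 1) ^ (-(2 * g))) := by gcongr
      _ = _ := by ring
  have e4 : τ ^ (g * ((n + 1 : ℕ) + 1)) = τ ^ (g * (n + 1)) * τ ^ g := by
    rw [← Real.rpow_add hτ0]; congr 1; push_cast; ring
  have e5 : ∏ i : Fin (n + 1), (s i.succ) ^ (-(2 * g)) =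
      (s 1) ^ (-(2 * g)) * ∏ i : Fin n, (s i.succ.succ) ^ (-(2 * g)) := by
    rw [Fin.prod_univ_succ]; rfl
  unfold chainWeight
  rw [e4, e5, pow_succ]
  simp only [halve_zero, halve_succ]
  set P := ∏ i : Fin n, (s i.succ.succ) ^ (-(2 * g))
  calc _ = A / 4 * (2 * A ^ n * τ ^ (g * (n + 1)) * P) *
        (((s 0) ^ (-g) + (s 1 / 2) ^ (-g)) * (s 1 / 2) ^ (-g)) := by ring
    _ ≤ A / 4 * (2 * A ^ n * τ ^ (g * (n + 1)) * P) *
        (4 * τ ^ g * (s 0) ^ (-g) * (s 1) ^ (-(2 * g))) := by gcongr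
    _ = _ := by ring

/-- The constant in the bounds for times up to `T`. -/
def chainConst (κ C α T : ℝ) : ℝ := 4 * (32 * C + 2 * |κ| * T ^ ((1 - α) / 2))

lemma chainConst_nonneg {κ C α T : ℝ} (hC : 0 ≤ C) (hT : 0 ≤ T) : 0 ≤ chainConst κ C α T := by
  unfold chainConst; positivity

/-- The Gaussian bound for chains. -/
lemma abs_chain_le {C α T : ℝ} (hα : 0 < α) (hα1 : α ≤ 1) (hρ : HolderTorus C α ρ) {τ : ℝ}
    (hτT : τ ≤ T) : ∀ {n : ℕ} {s : Fin (n + 1) → ℝ}, (∀ i, 0 < s i) → (∀ i, s i ≤ τ) → ∀ x y,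
    |chain κ ρ n s x y| ≤ chainWeight (chainConst κ C α T) τ ((1 - α) / 2) s *
      heat (4 * ∑ i, s i) (x - y)
  | 0, s, hs, hτ, x, y => by
    have h0 := hs 0
    have hτ0 : 0 < τ := h0.trans_le (hτ 0)
    rw [chain, abs_of_nonneg (heat_nonneg _ _)]
    have h1 : 1 ≤ τ ^ ((1 - α) / 2 * ((0 : ℕ) + 1)) * (s 0) ^ (-((1 - α) / 2)) := by
      rw [Real.rpow_neg h0.le, ← div_eq_mul_inv, one_le_div (by positivity)]
      have := hτ 0
      have hg : 0 ≤ (1 - α) / 2 := by linarith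
      have e : (1 - α) / 2 * (((0 : ℕ) : ℝ) + 1) = (1 - α) / 2 := by push_cast; ring
      rw [e]
      gcongr
    have hH := heat_nonneg (4 * s 0) (x - y)
    rw [chainWeight, Fin.sum_univ_one]
    simp only [pow_zero, mul_one, Finset.univ_eq_empty, Finset.prod_empty]
    calc heat (s 0) (x - y) ≤ 2 * heat (4 * s 0) (x - y) * 1 := by
          rw [mul_one]; exact heat_le_four h0 _
      _ ≤ 2 * heat (4 * s 0) (x - y) *
          (τ ^ ((1 - α) / 2 * ((0 : ℕ) + 1)) * (s 0) ^ (-((1 - α) / 2))) := by gcongr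
      _ = _ := by ring
  | n + 1, s, hs, hτ, x, y => by
    have ih := abs_chain_le hα hα1 hρ hτT (halve_pos hs) (halve_le hs hτ)
    have h0 := hs 0
    have h1 := half_pos (hs 1)
    have hτ0 : 0 < τ := h0.trans_le (hτ 0)
    have hT0 : 0 ≤ T := hτ0.le.trans hτT
    have hA := chainConst_nonneg (κ := κ) (α := α) hρ.nonneg hT0
    set A := chainConst κ C α T with hAdef
    set g := (1 - α) / 2 with hg
    have hsum : 0 < ∑ i, halve s i :=
      Finset.sum_pos (fun i _ => halve_pos hs i) ⟨0, Finset.mem_univ _⟩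
    have c1 := continuous_heat (by linarith : 0 < 4 * (s 0 + s 1 / 2))
    have c2 := continuous_heat (by linarith : 0 < 4 * ∑ i, halve s i)
    set B := A / 4 * ((s 0) ^ (-g) + (s 1 / 2) ^ (-g)) with hB
    have hB0 : 0 ≤ B := by positivity
    set W := chainWeight A τ g (halve s) with hW
    have hW0 : 0 ≤ W := chainWeight_nonneg hA hτ0.le (halve_pos hs)
    have key : |chain κ ρ (n + 1) s x y| ≤
        ∫ w, B * W * (heat (4 * (s 0 + s 1 / 2)) (x - w) * heat (4 * ∑ i, halve s i) (w - y)) := by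
      rw [chain, ← Real.norm_eq_abs]
      refine norm_integral_le_of_norm_le (Continuous.integrable_torus (by fun_prop))
        (Eventually.of_forall fun w => ?_)
      rw [norm_mul, Real.norm_eq_abs, Real.norm_eq_abs]
      have hk := abs_stepKernel_le (κ := κ) hα hα1 hρ h0 h1 ((hτ 0).trans hτT) x w
      have hAB : (32 * C + 2 * |κ| * T ^ ((1 - α) / 2)) = A / 4 := by
        rw [hAdef, chainConst]; ring
      rw [hAB] at hk
      have := heat_nonneg (4 * (s 0 + s 1 / 2)) (x - w)
      calc _ ≤ (B * heat (4 * (s 0 + s 1 / 2)) (x - w)) *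
            (W * heat (4 * ∑ i, halve s i) (w - y)) := by
            gcongr
            exact ih w y
        _ = _ := by ring
    -- The factor 4 in the times is preserved by convolution, so the Gaussian does not widen with
    -- the number of steps.
    rw [integral_const_mul, heat_conv (by linarith) (by linarith), ← mul_add, sum_halve] at key
    refine key.trans ?_
    gcongr
    · exact heat_nonneg _ _
    · exact chainWeight_halve_le hA (by rw [hg]; linarith) (by rw [hg]; linarith) hs hτ

lemma exists_chain_bound {C α : ℝ} (hα : 0 < α) (hα1 : α ≤ 1) (hρ : HolderTorus C α ρ) {n : ℕ}
    {s : Fin (n + 1) → ℝ} (hs : ∀ i, 0 < s i) : ∃ M, ∀ x y, |chain κ ρ n s x y| ≤ M := by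
  have hτ : ∀ i, s i ≤ ∑ i, s i := fun i =>
    Finset.single_le_sum (f := s) (fun j _ => (hs j).le) (Finset.mem_univ i)
  have hpos : 0 < ∑ i, s i := (hs 0).trans_le (hτ 0)
  refine ⟨_, fun x y => (abs_chain_le hα hα1 hρ le_rfl hs hτ x y).trans
    (mul_le_mul_of_nonneg_left (heat_le_zero (by linarith) _)
      (chainWeight_nonneg (chainConst_nonneg hρ.nonneg hpos.le) hpos.le hs))⟩

lemma integrable_chain_left {C α : ℝ} (hα : 0 < α) (hα1 : α ≤ 1) (hρ : HolderTorus C α ρ) {n : ℕ}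
    {s : Fin (n + 1) → ℝ} (hs : ∀ i, 0 < s i) (y : Torus) :
    Integrable fun x => chain κ ρ n s x y := by
  obtain ⟨M, hM⟩ := exists_chain_bound (κ := κ) hα hα1 hρ hs
  exact integrable_of_measurable_of_bound
    (measurable_chain_left (hρ.continuous hα).measurable s y) fun x => hM x y

/-- Adding to the first time of a chain is convolving with the heat kernel. -/
lemma heat_conv_chain {C α : ℝ} (hα : 0 < α) (hα1 : α ≤ 1) (hρ : HolderTorus C α ρ) {a : ℝ}
    (ha : 0 < a) {n : ℕ} {s s' : Fin (n + 1) → ℝ} (hs : ∀ i, 0 < s i) (hs0 : s' 0 = a + s 0)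
    (hs' : ∀ i : Fin n, s' i.succ = s i.succ) (x y : Torus) :
    ∫ w, heat a (x - w) * chain κ ρ n s w y = chain κ ρ n s' x y := by
  have hρc := hρ.continuous hα
  cases n with
  | zero => rw [chain, hs0]; exact heat_conv ha (hs 0) x y
  | succ n =>
    have h1 : s' 1 = s 1 := hs' 0
    have hh : halve s' = halve s := by
      funext i
      refine Fin.cases ?_ (fun j => ?_) i
      · rw [halve_zero, halve_zero, h1]
      · rw [halve_succ, halve_succ, hs']
    simp only [chain, hs0, h1, hh]
    obtain ⟨M, hM⟩ := exists_chain_bound (κ := κ) hα hα1 hρ (halve_pos hs)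
    obtain ⟨N, hN0, hN⟩ := exists_bound_of_continuous (continuous_heat ha)
    obtain ⟨H, hH0, hH⟩ := exists_bound_of_continuous
      (continuous_heat (by linarith [hs 0, hs 1] : 0 < 4 * (s 0 + s 1 / 2)))
    obtain ⟨K, hK⟩ : ∃ K, ∀ w v, |stepKernel κ ρ (s 0) (s 1 / 2) w v| ≤ K := by
      have hC := hρ.nonneg
      have h0 := hs 0
      have h1 := hs 1
      refine ⟨_, fun w v => (abs_stepKernel_le hα hα1 hρ h0 (half_pos h1) le_rfl w v).trans
        (mul_le_mul_of_nonneg_left ((le_abs_self _).trans (hH _)) (by positivity))⟩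
    have hi : Integrable (Function.uncurry fun w v => heat a (x - w) *
        (stepKernel κ ρ (s 0) (s 1 / 2) w v * chain κ ρ n (halve s) v y))
        ((volume : Measure Torus).prod volume) := by
      refine integrable_of_measurable_of_bound (M := N * (K * M)) ?_ fun p => ?_
      · have h2 : Measurable fun p : Torus × Torus => heat a (x - p.1) :=
          measurable_const.heat (by fun_prop)
        have h3 : Measurable fun p : Torus × Torus => stepKernel κ ρ (s 0) (s 1 / 2) p.1 p.2 :=
          Measurable.stepKernel hρc.measurable measurable_const measurable_const
            measurable_fst measurable_snd
        exact h2.mul (h3.mul ((measurable_chain_left hρc.measurable (halve s) y).comp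
          measurable_snd))
      · rw [Function.uncurry_def, abs_mul, abs_mul]
        have := (abs_nonneg _).trans (hK p.1 p.2)
        gcongr
        · exact hN _
        · exact hK _ _
        · exact hM _ _
    have hsw := integral_integral_swap hi
    simp only [integral_const_mul] at hsw
    rw [hsw]
    congr 1; funext v
    simp only [← mul_assoc]
    rw [integral_mul_const, heat_conv_stepKernel hρc ha (hs 0) (half_pos (hs 1))]

/-- One half of the first time stays in the chain; the other half becomes a smooth heat kernel that
carries all dependence on the starting point. -/
lemma exists_halve_first {n : ℕ} {s : Fin (n + 1) → ℝ} (hs : ∀ i, 0 < s i) :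
    ∃ s' : Fin (n + 1) → ℝ, s' = Fin.cons (α := fun _ => ℝ) (s 0 / 2) (fun i => s i.succ) ∧
      (∀ i, 0 < s' i) ∧ s 0 = s 0 / 2 + s' 0 ∧ ∀ i : Fin n, s i.succ = s' i.succ := by
  refine ⟨_, rfl, fun i => ?_, ?_, fun i => rfl⟩
  · refine Fin.cases ?_ (fun j => ?_) i
    · exact half_pos (hs 0)
    · exact hs _
  · rw [Fin.cons_zero]; ring

/-- A chain is a smooth function of its starting point. -/
lemma hasTorusDeriv_chain {C α : ℝ} (hα : 0 < α) (hα1 : α ≤ 1) (hρ : HolderTorus C α ρ) {n : ℕ}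
    {s : Fin (n + 1) → ℝ} (hs : ∀ i, 0 < s i) (y : Torus) :
    HasTorusDeriv (fun x => chain κ ρ n s x y) (fun x => ∫ w, heatD (s 0 / 2) (x - w) *
      chain κ ρ n (Fin.cons (α := fun _ => ℝ) (s 0 / 2) (fun i => s i.succ)) w y) := by
  obtain ⟨s', rfl, hs', h0, h1⟩ := exists_halve_first hs
  have h := hasTorusDeriv_conv (hasTorusDeriv_heat (half_pos (hs 0)))
    (continuous_heatD (half_pos (hs 0))) (integrable_chain_left (κ := κ) hα hα1 hρ hs' y)
  simp only [heat_conv_chain hα hα1 hρ (half_pos (hs 0)) hs' h0 h1] at h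
  exact h

lemma continuous_conv {φ u : Torus → ℝ} (hφ : Continuous φ) (hu : Integrable u) :
    Continuous fun x => ∫ w, φ (x - w) * u w := by
  obtain ⟨N, hN0, hN⟩ := exists_bound_of_continuous hφ
  refine continuous_of_dominated (bound := fun w => N * ‖u w‖) (fun x => ?_) (fun x => ?_)
    (hu.norm.const_mul N) ?_
  · exact ((hφ.comp (by fun_prop : Continuous fun w => x - w)).aestronglyMeasurable).mul
      hu.aestronglyMeasurable
  · exact Eventually.of_forall fun w => by rw [norm_mul]; gcongr; exact hN _
  · exact Eventually.of_forall fun w =>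
      (hφ.comp (by fun_prop : Continuous fun x => x - w)).mul continuous_const

/-- Prepending a heat kernel and integrating against `κ dx + dρ` lengthens the chain. -/
lemma pairing_heat_mul_chain {C α : ℝ} (hα : 0 < α) (hα1 : α ≤ 1) (hρ : HolderTorus C α ρ) {n : ℕ}
    {s : Fin (n + 2) → ℝ} (hs : ∀ i, 0 < s i) (x y : Torus) :
    ∃ φ', HasTorusDeriv (fun z => heat (s 0) (x - z) * chain κ ρ n (Fin.tail s) z y) φ' ∧
      Continuous φ' ∧
      pairing κ ρ (fun z => heat (s 0) (x - z) * chain κ ρ n (Fin.tail s) z y) φ' =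
        chain κ ρ (n + 1) s x y := by
  have hρc := hρ.continuous hα
  have ht : ∀ i, 0 < Fin.tail s i := fun i => hs _
  have h1 : 0 < s 1 / 2 := half_pos (hs 1)
  have hu := integrable_chain_left (κ := κ) hα hα1 hρ (halve_pos hs) y
  have hd := (hasTorusDeriv_heat (hs 0)).comp_const_sub x
  have hc := hasTorusDeriv_chain (κ := κ) hα hα1 hρ ht y
  -- The half kept in the derivative formula for the shorter chain is the one used in the recursion
  -- for chains.
  have hhalve : Fin.cons (α := fun _ => ℝ) (Fin.tail s 0 / 2) (fun i => Fin.tail s i.succ) =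
    halve s := rfl
  rw [hhalve] at hc
  have ht0 : Fin.tail s 0 = s 1 := rfl
  rw [ht0] at hc
  have c1 : Continuous fun z => heat (s 0) (x - z) := (continuous_heat (hs 0)).comp (by fun_prop)
  have c2 : Continuous fun z => heatD (s 0) (x - z) := (continuous_heatD (hs 0)).comp (by fun_prop)
  have ch := continuous_heat h1
  have chD := continuous_heatD h1
  have ch0 := continuous_heat (hs 0)
  have chD0 := continuous_heatD (hs 0)
  have c3 := continuous_conv chD hu
  refine ⟨_, hd.mul hc, ?_, ?_⟩
  · exact (c2.neg.mul hc.continuous).add (c1.mul c3)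
  · have hconv : ∀ z, ∫ w, heat (s 1 / 2) (z - w) * chain κ ρ n (halve s) w y =
        chain κ ρ n (Fin.tail s) z y := fun z =>
      heat_conv_chain (s' := Fin.tail s) hα hα1 hρ h1 (halve_pos hs) (by rw [ht0, halve_zero]; ring)
        (fun i => rfl) z y
    -- The shorter chain is the heat kernel at time s₁/2 convolved with the halved chain. Moving the
    -- rough integral under this convolution makes it a rough step.
    have hp := integral_mul_pairing (κ := κ) hρc hu
      (φ := fun p => heat (s 0) (x - p.1) * heat (s 1 / 2) (p.1 - p.2))
      (φ' := fun p => -heatD (s 0) (x - p.1) * heat (s 1 / 2) (p.1 - p.2) +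
        heat (s 0) (x - p.1) * heatD (s 1 / 2) (p.1 - p.2))
      (by fun_prop) (by fun_prop)
    rw [chain]
    simp only [stepKernel, mul_comm (pairing _ _ _ _)]
    rw [hp]
    have hi1 : ∀ z, Integrable fun w => chain κ ρ n (halve s) w y * heat (s 1 / 2) (z - w) := by
      intro z
      obtain ⟨N, hN0, hN⟩ := exists_bound_of_continuous ch
      exact hu.mul_bdd (c := N) (Continuous.aestronglyMeasurable (by fun_prop))
        (Eventually.of_forall fun w => hN _)
    have hi2 : ∀ z, Integrable fun w => chain κ ρ n (halve s) w y * heatD (s 1 / 2) (z - w) := by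
      intro z
      obtain ⟨N, hN0, hN⟩ := exists_bound_of_continuous chD
      exact hu.mul_bdd (c := N) (Continuous.aestronglyMeasurable (by fun_prop))
        (Eventually.of_forall fun w => hN _)
    congr 1
    · funext z
      rw [← hconv z, ← integral_const_mul]
      congr 1; funext w; ring
    · funext z
      rw [← hconv z, ← integral_const_mul, ← integral_const_mul]
      have e : ∀ w, chain κ ρ n (halve s) w y * (-heatD (s 0) (x - z) * heat (s 1 / 2) (z - w) +
          heat (s 0) (x - z) * heatD (s 1 / 2) (z - w)) =
          -heatD (s 0) (x - z) * (chain κ ρ n (halve s) w y * heat (s 1 / 2) (z - w)) +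
          heat (s 0) (x - z) * (chain κ ρ n (halve s) w y * heatD (s 1 / 2) (z - w)) := by
        intro w; ring
      simp only [e]
      rw [integral_add ((hi1 z).const_mul _) ((hi2 z).const_mul _)]
      congr 1 <;> (congr 1; funext w; ring)

/-- The iterated Riemann–Stieltjes integrals exist and are given by chains. -/
theorem rsIntegrableN_and_innerTerm_eq {C α : ℝ} {R : ℝ → ℝ} (hα : 0 < α) (hα1 : α ≤ 1)
    (hR : ContinuousOn R (Icc 0 1)) (hρ : HolderTorus C α (periodicPart R)) :
    ∀ {n : ℕ} {s : Fin (n + 1) → ℝ}, (∀ i, 0 < s i) → ∀ x y,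
      RSIntegrableN R n (pathWeight s x y) ∧
        innerTerm R s x y = chain (R 1 - R 0) (periodicPart R) n s x y
  | 0, s, hs, x, y => by
    refine ⟨trivial, ?_⟩
    rw [innerTerm, rsIntegralN, pathWeight, Fin.prod_univ_one, heatKernel_eq_heat (hs 0), chain]
    rfl
  | n + 1, s, hs, x, y => by
    have ht : ∀ i, 0 < Fin.tail s i := fun i => hs _
    have ih := rsIntegrableN_and_innerTerm_eq hα hα1 hR hρ ht
    obtain ⟨φ', h1, h2, h3⟩ := pairing_heat_mul_chain (κ := R 1 - R 0) hα hα1 hρ hs x y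
    refine rsIntegrableN_pathWeight_succ (fun z => (ih z y).1) ?_
    simp only [heatKernel_eq_heat (hs 0), (ih _ y).2]
    rw [← h3]
    exact hasRSIntegral_pairing h1 h2 hR

end RoughTorus
end

/-! ### Integration over simplices: Dirichlet integrals and the Mittag-Leffler series. -/

noncomputable section

namespace RoughTorus

/-! ### Integration over simplices -/

lemma measurableSet_simplex (n : ℕ) (t : ℝ) : MeasurableSet (simplex n t) := by
  have h1 : MeasurableSet {s : Fin n → ℝ | ∀ i, 0 < s i} := by
    rw [ofPred_forall]
    exact MeasurableSet.iInter fun i => measurableSet_lt measurable_const (measurable_pi_apply i)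
  have h2 : MeasurableSet {s : Fin n → ℝ | ∑ i, s i < t} :=
    measurableSet_lt (Finset.measurable_sum _ fun i _ => measurable_pi_apply i) measurable_const
  exact h1.inter h2

lemma simplex_eq_empty {n : ℕ} {t : ℝ} (ht : t ≤ 0) : simplex n t = ∅ := by
  ext s
  simp only [simplex, mem_ofPred_eq, mem_empty_iff_false, iff_false, not_and, not_lt]
  exact fun h => ht.trans (Finset.sum_nonneg fun i _ => (h i).le)

lemma cons_mem_simplex {n : ℕ} {t a : ℝ} {s : Fin n → ℝ} :
    Fin.cons (α := fun _ => ℝ) a s ∈ simplex (n + 1) t ↔ 0 < a ∧ s ∈ simplex n (t - a) := by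
  simp only [simplex, mem_ofPred_eq, Fin.forall_fin_succ, Fin.cons_zero, Fin.cons_succ,
    Fin.sum_univ_succ, lt_sub_iff_add_lt', and_assoc]

/-- The same slicing with the new coordinate innermost, as needed for the fundamental theorem of
calculus in that time; the other slicing drives the Dirichlet recursion. -/
lemma cons_mem_simplex' {n : ℕ} {t a : ℝ} {s : Fin n → ℝ} :
    Fin.cons (α := fun _ => ℝ) a s ∈ simplex (n + 1) t ↔ s ∈ simplex n t ∧ 0 < a ∧ a < t - ∑ i, s i := by
  simp only [simplex, mem_ofPred_eq, Fin.forall_fin_succ, Fin.cons_zero, Fin.cons_succ,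
    Fin.sum_univ_succ, lt_sub_iff_add_lt]
  constructor
  · rintro ⟨⟨h1, h2⟩, h3⟩; exact ⟨⟨h2, by linarith⟩, h1, h3⟩
  · rintro ⟨⟨h2, _⟩, h1, h3⟩; exact ⟨⟨h1, h2⟩, h3⟩

lemma measurePreserving_cons (n : ℕ) :
    MeasurePreserving (fun p : ℝ × (Fin n → ℝ) => Fin.cons (α := fun _ => ℝ) p.1 p.2 :
      ℝ × (Fin n → ℝ) → Fin (n + 1) → ℝ) (volume.prod volume) volume := by
  have h := (volume_preserving_piFinSuccAbove (fun _ : Fin (n + 1) => ℝ) 0).symm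
  have e : (fun p : ℝ × (Fin n → ℝ) => Fin.cons (α := fun _ => ℝ) p.1 p.2 :
      ℝ × (Fin n → ℝ) → Fin (n + 1) → ℝ) =
      (MeasurableEquiv.piFinSuccAbove (fun _ : Fin (n + 1) => ℝ) 0).symm := by
    funext p
    rw [MeasurableEquiv.piFinSuccAbove_symm_apply]
    exact (Fin.insertNth_zero' p.1 p.2).symm
  rw [e]
  exact h

lemma measurableEmbedding_cons (n : ℕ) :
    MeasurableEmbedding (fun p : ℝ × (Fin n → ℝ) => Fin.cons (α := fun _ => ℝ) p.1 p.2 :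
      ℝ × (Fin n → ℝ) → Fin (n + 1) → ℝ) := by
  have e : (fun p : ℝ × (Fin n → ℝ) => Fin.cons (α := fun _ => ℝ) p.1 p.2 :
      ℝ × (Fin n → ℝ) → Fin (n + 1) → ℝ) =
      (MeasurableEquiv.piFinSuccAbove (fun _ : Fin (n + 1) => ℝ) 0).symm := by
    funext p
    rw [MeasurableEquiv.piFinSuccAbove_symm_apply]
    exact (Fin.insertNth_zero' p.1 p.2).symm
  rw [e]
  exact MeasurableEquiv.measurableEmbedding _

open Classical in
lemma lintegral_simplex_succ {n : ℕ} {t : ℝ} {f : (Fin (n + 1) → ℝ) → ENNReal} (hf : Measurable f) :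
    ∫⁻ s in simplex (n + 1) t, f s = ∫⁻ a in Ioo 0 t, ∫⁻ s in simplex n (t - a),
      f (Fin.cons (α := fun _ => ℝ) a s) := by
  rw [← lintegral_indicator (measurableSet_simplex _ _),
    ← (measurePreserving_cons n).lintegral_comp (hf.indicator (measurableSet_simplex _ _)),
    lintegral_prod (fun p : ℝ × (Fin n → ℝ) => (simplex (n + 1) t).indicator f
      (Fin.cons (α := fun _ => ℝ) p.1 p.2)) ((hf.indicator (measurableSet_simplex _ _)).comp
      (measurePreserving_cons n).measurable).aemeasurable, ← lintegral_indicator measurableSet_Ioo]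
  congr 1; funext a
  by_cases ha : a ∈ Ioo 0 t
  · rw [indicator_of_mem ha, ← lintegral_indicator (measurableSet_simplex _ _)]
    congr 1; funext s
    simp only [indicator_apply, cons_mem_simplex, ha.1, true_and]
  · rw [indicator_of_notMem ha]
    have : ∀ s : Fin n → ℝ, (simplex (n + 1) t).indicator f (Fin.cons (α := fun _ => ℝ) a s) = 0 := by
      intro s
      refine indicator_of_notMem (fun h => ha ?_) _
      rw [cons_mem_simplex] at h
      refine ⟨h.1, ?_⟩
      by_contra hle
      rw [simplex_eq_empty (by linarith)] at h
      exact h.2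
    simp only [this, lintegral_zero]

lemma integral_simplex_succ {n : ℕ} {t : ℝ} {f : (Fin (n + 1) → ℝ) → ℝ}
    (hf : IntegrableOn f (simplex (n + 1) t)) :
    ∫ s in simplex (n + 1) t, f s = ∫ s in simplex n t, ∫ a in (0 : ℝ)..(t - ∑ i, s i),
      f (Fin.cons (α := fun _ => ℝ) a s) ∧
    IntegrableOn (fun s => ∫ a in (0 : ℝ)..(t - ∑ i, s i), f (Fin.cons (α := fun _ => ℝ) a s))
      (simplex n t) ∧
    ∀ᵐ s ∂(volume.restrict (simplex n t)), IntegrableOn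
      (fun a => f (Fin.cons (α := fun _ => ℝ) a s)) (Ioo 0 (t - ∑ i, s i)) := by
  classical
  have hi : Integrable ((simplex (n + 1) t).indicator f) :=
    (integrable_indicator_iff (measurableSet_simplex _ _)).2 hf
  have hi2 := ((measurePreserving_cons n).integrable_comp_emb (measurableEmbedding_cons n)).2 hi
  have key : ∀ s : Fin n → ℝ, s ∈ simplex n t → ∀ a : ℝ,
      (simplex (n + 1) t).indicator f (Fin.cons (α := fun _ => ℝ) a s) =
      (Ioo 0 (t - ∑ i, s i)).indicator (fun a => f (Fin.cons (α := fun _ => ℝ) a s)) a := by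
    intro s hs a
    simp only [indicator_apply, cons_mem_simplex', hs, true_and, mem_Ioo]
  have key0 : ∀ s : Fin n → ℝ, s ∉ simplex n t → ∀ a : ℝ,
      (simplex (n + 1) t).indicator f (Fin.cons (α := fun _ => ℝ) a s) = 0 := by
    intro s hs a
    simp only [indicator_apply, cons_mem_simplex', hs, false_and, if_false]
  have hin : (fun s => ∫ a, (simplex (n + 1) t).indicator f (Fin.cons (α := fun _ => ℝ) a s)) =
      (simplex n t).indicator fun s => ∫ a in (0 : ℝ)..(t - ∑ i, s i),
        f (Fin.cons (α := fun _ => ℝ) a s) := by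
    funext s
    by_cases hs : s ∈ simplex n t
    · rw [indicator_of_mem hs]
      simp only [key s hs]
      have := hs.2
      rw [integral_indicator measurableSet_Ioo, intervalIntegral.integral_of_le (by linarith),
        integral_Ioc_eq_integral_Ioo]
    · rw [indicator_of_notMem hs]
      simp only [key0 s hs, integral_zero]
  have hout := hi2.integral_prod_right
  simp only [Function.comp_def, hin] at hout
  refine ⟨?_, (integrable_indicator_iff (measurableSet_simplex _ _)).1 hout, ?_⟩
  · rw [← integral_indicator (measurableSet_simplex _ _), ← integral_indicator (measurableSet_simplex _ _),
      ← (measurePreserving_cons n).integral_comp (measurableEmbedding_cons n),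
      ← hin]
    exact integral_prod_symm _ hi2
  · rw [ae_restrict_iff' (measurableSet_simplex _ _)]
    filter_upwards [hi2.prod_left_ae] with s hs hmem
    simp only [Function.comp_def, key s hmem] at hs
    exact (integrable_indicator_iff measurableSet_Ioo).1 hs

/-! ### Dirichlet integrals -/

/-- For t = 1 this is the normalisation of the Beta distribution; scaling by t does the rest. -/
lemma lintegral_beta {a b t : ℝ} (ha : 0 < a) (hb : 0 < b) (ht : 0 < t) :
    ∫⁻ x in Ioo 0 t, ENNReal.ofReal (x ^ (a - 1) * (t - x) ^ (b - 1)) =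
      ENNReal.ofReal (Real.Gamma a * Real.Gamma b / Real.Gamma (a + b) * t ^ (a + b - 1)) := by
  have h1 := ProbabilityTheory.lintegral_betaPDF_eq_one ha hb
  rw [ProbabilityTheory.lintegral_betaPDF] at h1
  have hB := ProbabilityTheory.beta_pos ha hb
  set B := ProbabilityTheory.beta a b with hBdef
  have h2 : ∫⁻ x in Ioo (0 : ℝ) 1, ENNReal.ofReal (x ^ (a - 1) * (1 - x) ^ (b - 1)) =
      ENNReal.ofReal B := by
    have e : ∀ x : ℝ, ENNReal.ofReal (1 / B * x ^ (a - 1) * (1 - x) ^ (b - 1)) =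
        ENNReal.ofReal (1 / B) * ENNReal.ofReal (x ^ (a - 1) * (1 - x) ^ (b - 1)) := by
      intro x
      rw [← ENNReal.ofReal_mul (by positivity), mul_assoc]
    simp only [e] at h1
    rw [lintegral_const_mul _ (by fun_prop)] at h1
    calc _ = ENNReal.ofReal B * (ENNReal.ofReal (1 / B) *
          ∫⁻ x in Ioo (0 : ℝ) 1, ENNReal.ofReal (x ^ (a - 1) * (1 - x) ^ (b - 1))) := by
          rw [← mul_assoc, ← ENNReal.ofReal_mul hB.le, mul_one_div_cancel hB.ne',
            ENNReal.ofReal_one, one_mul]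
      _ = _ := by rw [h1, mul_one]
  have himg : (fun x : ℝ => t * x) '' Ioo 0 1 = Ioo 0 t := by
    rw [image_mul_left_Ioo ht, mul_zero, mul_one]
  have h3 := lintegral_image_eq_lintegral_abs_deriv_mul (s := Ioo (0 : ℝ) 1)
    (f := fun x : ℝ => t * x) (f' := fun _ => t) measurableSet_Ioo
    (fun x _ => by simpa using ((hasDerivAt_id x).const_mul t).hasDerivWithinAt)
    (fun x _ y _ h => mul_left_cancel₀ ht.ne' h)
    (fun x => ENNReal.ofReal (x ^ (a - 1) * (t - x) ^ (b - 1)))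
  rw [himg] at h3
  rw [h3]
  have h4 : ∀ x ∈ Ioo (0 : ℝ) 1, ENNReal.ofReal |t| *
      ENNReal.ofReal ((t * x) ^ (a - 1) * (t - t * x) ^ (b - 1)) =
      ENNReal.ofReal (t ^ (a + b - 1)) * ENNReal.ofReal (x ^ (a - 1) * (1 - x) ^ (b - 1)) := by
    intro x hx
    rw [← ENNReal.ofReal_mul (abs_nonneg t), ← ENNReal.ofReal_mul (by positivity), abs_of_pos ht]
    congr 1
    have hx1 : 0 ≤ 1 - x := by linarith [hx.2]
    rw [show t - t * x = t * (1 - x) by ring, Real.mul_rpow ht.le hx.1.le, Real.mul_rpow ht.le hx1,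
      show a + b - 1 = 1 + (a - 1) + (b - 1) by ring, Real.rpow_add ht, Real.rpow_add ht,
      Real.rpow_one]
    ring
  rw [setLIntegral_congr_fun measurableSet_Ioo h4, lintegral_const_mul _ (by fun_prop), h2,
    ← ENNReal.ofReal_mul (by positivity), mul_comm]
  rfl

lemma measurable_simplexWeight {n : ℕ} (t a : ℝ) (b : Fin n → ℝ) : Measurable fun s : Fin n → ℝ =>
    (t - ∑ i, s i) ^ (a - 1) * ∏ i, (s i) ^ (b i - 1) := by
  refine Measurable.mul ?_ (Finset.measurable_fun_prod _ fun i _ =>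
    (measurable_pi_apply i).pow_const _)
  exact (measurable_const.sub
    (Finset.measurable_fun_sum _ fun i _ => measurable_pi_apply i)).pow_const _

/-- The Dirichlet integral over a simplex. -/
lemma lintegral_dirichlet {a : ℝ} (ha : 0 < a) : ∀ {n : ℕ} {b : Fin n → ℝ}, (∀ i, 0 < b i) →
    ∀ {t : ℝ}, 0 < t →
    ∫⁻ s in simplex n t, ENNReal.ofReal ((t - ∑ i, s i) ^ (a - 1) * ∏ i, (s i) ^ (b i - 1)) =
      ENNReal.ofReal (Real.Gamma a * (∏ i, Real.Gamma (b i)) / Real.Gamma (a + ∑ i, b i) *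
        t ^ (a + ∑ i, b i - 1))
  | 0, b, _, t, ht => by
    have hu : simplex 0 t = univ := by
      ext s; simp [simplex, ht]
    rw [hu, Measure.restrict_univ]
    have : (volume : Measure (Fin 0 → ℝ)) univ = 1 := by
      rw [volume_pi, Measure.pi_empty_univ]
    simp only [Finset.univ_eq_empty, Finset.sum_empty, Finset.prod_empty, sub_zero, mul_one,
      add_zero, lintegral_const, this]
    rw [div_self (Real.Gamma_pos_of_pos ha).ne', one_mul]
  | n + 1, b, hb, t, ht => by
    rw [lintegral_simplex_succ (measurable_simplexWeight t a b).ennreal_ofReal]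
    set S := ∑ i : Fin n, b i.succ with hS
    set P := ∏ i : Fin n, Real.Gamma (b i.succ) with hP
    have hS0 : 0 ≤ S := Finset.sum_nonneg fun i _ => (hb _).le
    have hP0 : 0 < P := Finset.prod_pos fun i _ => Real.Gamma_pos_of_pos (hb _)
    have hGa := Real.Gamma_pos_of_pos ha
    have hGS := Real.Gamma_pos_of_pos (by linarith : 0 < a + S)
    -- For a fixed first time r the induction hypothesis on the simplex of size t − r yields a power
    -- of t − r, and the integral over r is a Beta integral.
    have inner : ∀ r ∈ Ioo (0 : ℝ) t, ∫⁻ s in simplex n (t - r), ENNReal.ofReal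
        ((t - ∑ i, Fin.cons (α := fun _ => ℝ) r s i) ^ (a - 1) *
          ∏ i, (Fin.cons (α := fun _ => ℝ) r s i : ℝ) ^ (b i - 1)) =
        ENNReal.ofReal (Real.Gamma a * P / Real.Gamma (a + S)) *
          ENNReal.ofReal (r ^ (b 0 - 1) * (t - r) ^ (a + S - 1)) := by
      intro r hr
      have ih := lintegral_dirichlet ha (b := fun i : Fin n => b i.succ) (fun i => hb _)
        (t := t - r) (by linarith [hr.2])
      have e : ∀ s : Fin n → ℝ, ENNReal.ofReal
          ((t - ∑ i, Fin.cons (α := fun _ => ℝ) r s i) ^ (a - 1) *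
          ∏ i, (Fin.cons (α := fun _ => ℝ) r s i : ℝ) ^ (b i - 1)) =
          ENNReal.ofReal (r ^ (b 0 - 1)) * ENNReal.ofReal ((t - r - ∑ i, s i) ^ (a - 1) *
            ∏ i, (s i) ^ (b i.succ - 1)) := by
        intro s
        rw [← ENNReal.ofReal_mul (Real.rpow_nonneg hr.1.le _), Fin.sum_univ_succ,
          Fin.prod_univ_succ]
        simp only [Fin.cons_zero, Fin.cons_succ]
        congr 1
        rw [sub_add_eq_sub_sub]; ring
      simp only [e]
      rw [lintegral_const_mul _ (measurable_simplexWeight (t - r) a _).ennreal_ofReal, ih,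
        ← ENNReal.ofReal_mul (Real.rpow_nonneg hr.1.le _), ← ENNReal.ofReal_mul (by positivity)]
      congr 1; ring
    rw [setLIntegral_congr_fun measurableSet_Ioo inner, lintegral_const_mul _ (by fun_prop),
      lintegral_beta (hb 0) (by linarith) ht, ← ENNReal.ofReal_mul (by positivity),
      Fin.sum_univ_succ, Fin.prod_univ_succ]
    congr 1
    rw [show b 0 + (a + S) = a + (b 0 + S) by ring, ← hS, ← hP]
    field_simp

/-- Restricting the Gamma integral to (L, ∞), where the power is at least L^(c-1). As L is
arbitrary, Gamma outgrows every geometric sequence, without Stirling's formula. -/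
lemma exp_neg_mul_rpow_le_Gamma {c L : ℝ} (hc : 1 ≤ c) (hL : 0 < L) :
    Real.exp (-L) * L ^ (c - 1) ≤ Real.Gamma c := by
  rw [Real.Gamma_eq_integral (by linarith)]
  have hi := Real.GammaIntegral_convergent (s := c) (by linarith)
  have h1 : ∫ x in Ioi L, Real.exp (-x) * L ^ (c - 1) = Real.exp (-L) * L ^ (c - 1) := by
    rw [integral_mul_const, integral_exp_neg_Ioi]
  rw [← h1]
  calc _ ≤ ∫ x in Ioi L, Real.exp (-x) * x ^ (c - 1) := by
        refine setIntegral_mono_on ?_ (hi.mono_set (Ioi_subset_Ioi hL.le)) measurableSet_Ioi ?_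
        · exact (integrableOn_exp_neg_Ioi L).mul_const _
        · intro x hx
          have : L < x := hx
          have : 0 ≤ c - 1 := by linarith
          gcongr
    _ ≤ _ := by
        refine setIntegral_mono_set hi ?_ (Ioi_subset_Ioi hL.le).eventuallyLE
        rw [EventuallyLE, ae_restrict_iff' measurableSet_Ioi]
        exact Eventually.of_forall fun x hx => by
          have : (0 : ℝ) < x := hx
          simp only [Pi.zero_apply]
          positivity

/-- The Mittag-Leffler series converges. -/
lemma summable_pow_div_Gamma {α a B : ℝ} (hα : 0 < α) (ha : 0 < a) (hB : 0 ≤ B) :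
    Summable fun n : ℕ => B ^ n / Real.Gamma (a + n * α) := by
  -- Chosen so that L^α = 2(B + 1): each unit of n contributes a ratio B/L^α ≤ 1/2.
  set L := (2 * (B + 1)) ^ (1 / α) with hL
  have hL0 : 0 < L := by positivity
  have hLα : L ^ α = 2 * (B + 1) := by
    rw [hL, ← Real.rpow_mul (by positivity), one_div_mul_cancel hα.ne', Real.rpow_one]
  have hgeo : Summable fun n : ℕ => Real.exp L * L ^ (1 - a) * (1 / 2 : ℝ) ^ n :=
    (summable_geometric_of_lt_one (by norm_num) (by norm_num)).mul_left _
  obtain ⟨N, hN⟩ := exists_nat_gt (1 / α)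
  refine Summable.of_norm_bounded_eventually_nat hgeo ?_
  filter_upwards [eventually_ge_atTop N] with n hn
  have hn1 : 1 ≤ a + n * α := by
    have : 1 / α < n := hN.trans_le (by exact_mod_cast hn)
    rw [div_lt_iff₀ hα] at this
    linarith
  have hG := exp_neg_mul_rpow_le_Gamma hn1 hL0
  have hG0 : 0 < Real.exp (-L) * L ^ (a + n * α - 1) := by positivity
  rw [Real.norm_of_nonneg (div_nonneg (by positivity) (hG0.le.trans hG))]
  calc _ ≤ B ^ n / (Real.exp (-L) * L ^ (a + n * α - 1)) := by gcongr
    _ = Real.exp L * L ^ (1 - a) * (B / (2 * (B + 1))) ^ n := by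
        have e1 : L ^ (a + n * α - 1) = (2 * (B + 1)) ^ n / L ^ (1 - a) := by
          rw [eq_div_iff (by positivity), ← Real.rpow_add hL0, ← hLα, ← Real.rpow_mul_natCast hL0.le]
          congr 1; ring
        rw [e1, Real.exp_neg, div_pow]
        field_simp
    _ ≤ _ := by
        have : B / (2 * (B + 1)) ≤ 1 / 2 := by
          rw [div_le_div_iff₀ (by positivity) (by norm_num)]; linarith
        gcongr ?_ * ?_ ^ n

end RoughTorus
end

/-! ### Bounds for the terms of the series and for its sum. -/

noncomputable section

namespace RoughTorus

variable {κ : ℝ} {ρ : Torus → ℝ}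

/-! ### Regularity of chains in the starting point -/

lemma half_rpow_neg_le {a e : ℝ} (ha : 0 < a) (he1 : e ≤ 1) : (a / 2) ^ (-e) ≤ 2 * a ^ (-e) := by
  rw [Real.div_rpow ha.le two_pos.le, Real.rpow_neg two_pos.le, div_inv_eq_mul, mul_comm]
  have : (2 : ℝ) ^ e ≤ 2 := by
    calc (2 : ℝ) ^ e ≤ 2 ^ (1 : ℝ) := Real.rpow_le_rpow_of_exponent_le one_le_two he1
      _ = 2 := Real.rpow_one 2
  gcongr

lemma chainWeight_cons_half_le {A τ g : ℝ} (hA : 0 ≤ A) (hτ : 0 ≤ τ) (hg1 : g ≤ 1) {n : ℕ}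
    {s s' : Fin (n + 1) → ℝ} (hs : ∀ i, 0 < s i) (h0 : s 0 = s 0 / 2 + s' 0)
    (h1 : ∀ i : Fin n, s i.succ = s' i.succ) :
    chainWeight A τ g s' ≤ 2 * chainWeight A τ g s := by
  have hP : 0 ≤ ∏ i : Fin n, (s i.succ) ^ (-(2 * g)) :=
    Finset.prod_nonneg fun i _ => Real.rpow_nonneg (hs _).le _
  have e0 : s' 0 = s 0 / 2 := by linarith
  have := half_rpow_neg_le (hs 0) hg1
  unfold chainWeight
  simp only [← h1, e0]
  calc _ ≤ 2 * A ^ n * τ ^ (g * (n + 1)) * (2 * (s 0) ^ (-g)) *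
        ∏ i : Fin n, (s i.succ) ^ (-(2 * g)) := by gcongr
    _ = _ := by ring

/-- Half of the first heat kernel is split off, and its Hölder estimate is integrated against the
Gaussian bound of the rest. The constant is 24 times 2 for each of the two halved powers. -/
lemma abs_chain_sub_le {C α T : ℝ} (hα : 0 < α) (hα1 : α ≤ 1) (hρ : HolderTorus C α ρ) {τ u : ℝ}
    (hτT : τ ≤ T) (hu0 : 0 < u) (hu1 : u ≤ 1) {n : ℕ} {s : Fin (n + 1) → ℝ} (hs : ∀ i, 0 < s i)
    (hτ : ∀ i, s i ≤ τ) (x x' y : Torus) :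
    |chain κ ρ n s x y - chain κ ρ n s x' y| ≤ 96 * dist x x' ^ u *
      ((s 0) ^ (-(u / 2)) * chainWeight (chainConst κ C α T) τ ((1 - α) / 2) s) *
      (heat (4 * ∑ i, s i) (x - y) + heat (4 * ∑ i, s i) (x' - y)) := by
  obtain ⟨s', rfl, hs', h0, h1⟩ := exists_halve_first hs
  set s' := Fin.cons (α := fun _ => ℝ) (s 0 / 2) (fun i => s i.succ) with hs'def
  have hsp := half_pos (hs 0)
  have hτ' : ∀ i, s' i ≤ τ := by
    intro i
    refine Fin.cases ?_ (fun j => ?_) i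
    · exact (half_le_self (hs 0).le).trans (hτ 0)
    · exact hτ _
  have hτ0 : 0 < τ := (hs 0).trans_le (hτ 0)
  have hA := chainConst_nonneg (κ := κ) (α := α) hρ.nonneg (hτ0.le.trans hτT)
  set A := chainConst κ C α T
  set g := (1 - α) / 2 with hg
  have hi := integrable_chain_left (κ := κ) hα hα1 hρ hs' y
  have hsum : ∑ i, s i = s 0 / 2 + ∑ i, s' i := by
    rw [Fin.sum_univ_succ, Fin.sum_univ_succ (n := n)]
    simp only [hs'def, Fin.cons_zero, Fin.cons_succ]; ring
  have hsum0 : 0 < ∑ i, s' i := Finset.sum_pos (fun i _ => hs' i) ⟨0, Finset.mem_univ _⟩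
  have ch := continuous_heat hsp
  have ch2 := continuous_heat (by linarith : 0 < 4 * (s 0 / 2))
  have ch3 := continuous_heat (by linarith : 0 < 4 * ∑ i, s' i)
  obtain ⟨N, hN0, hN⟩ := exists_bound_of_continuous ch
  have hii : ∀ x, Integrable fun w => heat (s 0 / 2) (x - w) * chain κ ρ n s' w y := fun x =>
    hi.bdd_mul (c := N) (Continuous.aestronglyMeasurable (by fun_prop))
      (Eventually.of_forall fun w => hN _)
  rw [← heat_conv_chain (κ := κ) hα hα1 hρ hsp hs' h0 h1 x y,
    ← heat_conv_chain (κ := κ) hα hα1 hρ hsp hs' h0 h1 x' y, ← integral_sub (hii x) (hii x')]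
  set W := chainWeight A τ g s' with hW
  have hW0 : 0 ≤ W := chainWeight_nonneg hA hτ0.le hs'
  set B := 24 * (dist x x' ^ u * (s 0 / 2) ^ (-u / 2)) * W with hB
  have key : |∫ w, (heat (s 0 / 2) (x - w) * chain κ ρ n s' w y -
      heat (s 0 / 2) (x' - w) * chain κ ρ n s' w y)| ≤
      ∫ w, B * (heat (4 * (s 0 / 2)) (x - w) * heat (4 * ∑ i, s' i) (w - y) +
        heat (4 * (s 0 / 2)) (x' - w) * heat (4 * ∑ i, s' i) (w - y)) := by
    rw [← Real.norm_eq_abs]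
    refine norm_integral_le_of_norm_le (Continuous.integrable_torus (by fun_prop))
      (Eventually.of_forall fun w => ?_)
    rw [← sub_mul, norm_mul, Real.norm_eq_abs, Real.norm_eq_abs]
    have k1 := abs_heat_sub_heat_le hsp hu0 hu1 (x - w) (x' - w)
    rw [dist_sub_right] at k1
    have k2 := abs_chain_le (κ := κ) hα hα1 hρ hτT hs' hτ' w y
    have k3 := heat_nonneg (4 * (s 0 / 2)) (x - w)
    have k4 := heat_nonneg (4 * (s 0 / 2)) (x' - w)
    calc _ ≤ (24 * (dist x x' ^ u * (s 0 / 2) ^ (-u / 2)) *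
          (heat (4 * (s 0 / 2)) (x - w) + heat (4 * (s 0 / 2)) (x' - w))) *
          (W * heat (4 * ∑ i, s' i) (w - y)) := by gcongr
      _ = _ := by ring
  refine key.trans ?_
  rw [integral_const_mul, integral_add (Continuous.integrable_torus (by fun_prop))
    (Continuous.integrable_torus (by fun_prop)), heat_conv (by linarith) (by linarith),
    heat_conv (by linarith) (by linarith), ← mul_add, ← hsum]
  have q1 := heat_nonneg (4 * ∑ i, s i) (x - y)
  have q2 := heat_nonneg (4 * ∑ i, s i) (x' - y)
  gcongr
  have q3 : (s 0 / 2) ^ (-u / 2) ≤ 2 * (s 0) ^ (-(u / 2)) := by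
    rw [neg_div]; exact half_rpow_neg_le (hs 0) (by linarith)
  have q4 : W ≤ 2 * chainWeight A τ g s :=
    chainWeight_cons_half_le hA hτ0.le (by rw [hg]; linarith) hs h0 h1
  have q5 : 0 ≤ (s 0) ^ (-(u / 2)) := Real.rpow_nonneg (hs 0).le _
  calc B ≤ 24 * (dist x x' ^ u * (2 * (s 0) ^ (-(u / 2)))) * (2 * chainWeight A τ g s) := by
        rw [hB]; gcongr
    _ = _ := by ring

/-! ### The terms of the series -/

lemma fullTimes_pos {n : ℕ} {t : ℝ} {s : Fin n → ℝ} (hs : s ∈ simplex n t) (i : Fin (n + 1)) :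
    0 < fullTimes t s i := by
  refine Fin.cases ?_ (fun j => ?_) i
  · exact sub_pos.2 hs.2
  · exact hs.1 j

lemma sum_fullTimes {n : ℕ} (t : ℝ) (s : Fin n → ℝ) : ∑ i, fullTimes t s i = t := by
  rw [Fin.sum_univ_succ]
  simp [fullTimes]

lemma fullTimes_le {n : ℕ} {t : ℝ} {s : Fin n → ℝ} (hs : s ∈ simplex n t) (i : Fin (n + 1)) :
    fullTimes t s i ≤ t :=
  (Finset.single_le_sum (f := fullTimes t s) (fun j _ => (fullTimes_pos hs j).le)
    (Finset.mem_univ i)).trans_eq (sum_fullTimes t s)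

lemma measurable_fullTimes {n : ℕ} (t : ℝ) : Measurable (fullTimes (n := n) t) := by
  refine measurable_pi_iff.2 fun i => ?_
  refine Fin.cases ?_ (fun j => ?_) i
  · exact measurable_const.sub (Finset.measurable_fun_sum _ fun i _ => measurable_pi_apply i)
  · exact measurable_pi_apply _

lemma pos_of_mem_simplex {n : ℕ} {t : ℝ} {s : Fin n → ℝ} (hs : s ∈ simplex n t) : 0 < t := by
  by_contra h
  rw [simplex_eq_empty (not_lt.1 h)] at hs
  exact hs

lemma measurable_chainWeight {A τ g : ℝ} {n : ℕ} :
    Measurable (chainWeight A τ g : (Fin (n + 1) → ℝ) → ℝ) := by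
  unfold chainWeight
  exact (((measurable_pi_apply 0).pow_const _).const_mul _).mul
    (Finset.measurable_fun_prod _ fun i _ => (measurable_pi_apply _).pow_const _)

/-- A Dirichlet integral with parameter (1+α)/2 − v for the first time and α for each other one.
Here v is the power lost to regularity in x; v ≤ 1/2 and α > 0 keep the first parameter positive. -/
lemma lintegral_chainWeight {A α v t : ℝ} (hα : 0 < α) (hA : 0 ≤ A) (hv1 : v ≤ 1 / 2)
    (ht : 0 < t) (n : ℕ) :
    ∫⁻ s in simplex n t, ENNReal.ofReal ((fullTimes t s 0) ^ (-v) *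
      chainWeight A t ((1 - α) / 2) (fullTimes t s)) = ENNReal.ofReal (2 * A ^ n *
        t ^ ((1 - α) / 2 * (n + 1)) * (Real.Gamma ((1 + α) / 2 - v) * Real.Gamma α ^ n /
        Real.Gamma ((1 + α) / 2 - v + n * α) * t ^ ((1 + α) / 2 - v + n * α - 1))) := by
  have ha : 0 < (1 + α) / 2 - v := by linarith
  have hd := lintegral_dirichlet ha (n := n) (b := fun _ => α) (fun _ => hα) ht
  simp only [Finset.prod_const, Finset.sum_const, Finset.card_univ, Fintype.card_fin,
    nsmul_eq_mul] at hd
  have e : ∀ s ∈ simplex n t, ENNReal.ofReal ((fullTimes t s 0) ^ (-v) *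
      chainWeight A t ((1 - α) / 2) (fullTimes t s)) =
      ENNReal.ofReal (2 * A ^ n * t ^ ((1 - α) / 2 * (n + 1))) *
      ENNReal.ofReal ((t - ∑ i, s i) ^ ((1 + α) / 2 - v - 1) * ∏ i, (s i) ^ (α - 1)) := by
    intro s hs
    rw [← ENNReal.ofReal_mul (by positivity)]
    congr 1
    have h0 : fullTimes t s 0 = t - ∑ i, s i := rfl
    have h1 : ∀ i : Fin n, fullTimes t s i.succ = s i := fun i => rfl
    have hpos : 0 < t - ∑ i, s i := fullTimes_pos hs 0
    unfold chainWeight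
    simp only [h0, h1]
    have e1 : (t - ∑ i, s i) ^ ((1 + α) / 2 - v - 1) =
        (t - ∑ i, s i) ^ (-v) * (t - ∑ i, s i) ^ (-((1 - α) / 2)) := by
      rw [← Real.rpow_add hpos]; congr 1; ring
    rw [e1, show -(2 * ((1 - α) / 2)) = α - 1 by ring]
    ring
  rw [setLIntegral_congr_fun (measurableSet_simplex n t) e,
    lintegral_const_mul _ (measurable_simplexWeight t _ fun _ => α).ennreal_ofReal, hd,
    ← ENNReal.ofReal_mul (by positivity)]

/-- Each further step contributes t^((1-α)/2) from the weight and t^α from the simplex, so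
t^((1+α)/2) in all. One power of t is kept in front of a summable sequence; it must later absorb the
t^(-1/2) from the supremum of a Gaussian. -/
lemma exists_chainWeight_bound {A α v T : ℝ} (hα : 0 < α) (hA : 0 ≤ A)
    (hv1 : v ≤ 1 / 2) (hT : 0 < T) :
    ∃ D : ℕ → ℝ, Summable D ∧ (∀ n, 0 ≤ D n) ∧ ∀ t, 0 < t → t ≤ T → ∀ n,
      ∫ s in simplex (n + 1) t, (fullTimes t s 0) ^ (-v) *
        chainWeight A t ((1 - α) / 2) (fullTimes t s) ≤ t ^ ((1 + α) / 2 - v) * D n := by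
  have ha : 0 < (1 + α) / 2 - v := by linarith
  set a := (1 + α) / 2 - v with hadef
  have hG : ∀ c, 0 < c → 0 < Real.Gamma c := fun c => Real.Gamma_pos_of_pos
  have hGa := hG a ha
  have hGα := hG α hα
  set B := A * T ^ ((1 + α) / 2) * Real.Gamma α with hB
  have hB0 : 0 ≤ B := by positivity
  have hs := (summable_pow_div_Gamma hα (by linarith : 0 < a + α) hB0).mul_left
    (2 * A * Real.Gamma a * Real.Gamma α)
  refine ⟨_, hs, fun n => ?_, fun t ht htT n => ?_⟩
  · have := hG (a + α + n * α) (by positivity)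
    positivity
  · have hGn := hG (a + α + n * α) (by positivity)
    rw [integral_eq_lintegral_of_nonneg_ae]
    rotate_left
    · rw [EventuallyLE, ae_restrict_iff' (measurableSet_simplex _ _)]
      exact Eventually.of_forall fun s hs => mul_nonneg (Real.rpow_nonneg (fullTimes_pos hs 0).le _)
        (chainWeight_nonneg hA ht.le (fullTimes_pos hs))
    · exact ((((measurable_pi_apply 0).comp (measurable_fullTimes t)).pow_const _).mul
        (measurable_chainWeight.comp (measurable_fullTimes t))).aestronglyMeasurable
    rw [lintegral_chainWeight hα hA hv1 ht, ← hadef]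
    have e1 : a + ((n + 1 : ℕ) : ℝ) * α = a + α + n * α := by push_cast; ring
    rw [e1, ENNReal.toReal_ofReal (by positivity)]
    have e2 : t ^ ((1 - α) / 2 * (((n + 1 : ℕ) : ℝ) + 1)) * t ^ (a + α + n * α - 1) =
        t ^ a * (t ^ ((1 + α) / 2)) ^ n := by
      rw [← Real.rpow_mul_natCast ht.le, ← Real.rpow_add ht, ← Real.rpow_add ht]
      congr 1; push_cast; ring
    calc _ = 2 * A ^ (n + 1) * (Real.Gamma a * Real.Gamma α ^ (n + 1) / Real.Gamma (a + α + n * α)) *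
          (t ^ ((1 - α) / 2 * (((n + 1 : ℕ) : ℝ) + 1)) * t ^ (a + α + n * α - 1)) := by ring
      _ = 2 * A ^ (n + 1) * (Real.Gamma a * Real.Gamma α ^ (n + 1) / Real.Gamma (a + α + n * α)) *
          (t ^ a * (t ^ ((1 + α) / 2)) ^ n) := by rw [e2]
      _ ≤ 2 * A ^ (n + 1) * (Real.Gamma a * Real.Gamma α ^ (n + 1) / Real.Gamma (a + α + n * α)) *
          (t ^ a * (T ^ ((1 + α) / 2)) ^ n) := by
          have : 0 ≤ (1 + α) / 2 := by linarith
          gcongr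
      _ = _ := by rw [hB]; simp only [mul_pow, pow_succ]; ring

lemma integrableOn_chainWeight {A α v t : ℝ} (hα : 0 < α) (hA : 0 ≤ A)
    (hv1 : v ≤ 1 / 2) (n : ℕ) :
    IntegrableOn (fun s => (fullTimes t s 0) ^ (-v) *
      chainWeight A t ((1 - α) / 2) (fullTimes t s)) (simplex n t) := by
  rcases le_or_gt t 0 with ht | ht
  · rw [simplex_eq_empty ht]; exact integrableOn_empty
  · refine ⟨((((measurable_pi_apply 0).comp (measurable_fullTimes t)).pow_const _).mul
        (measurable_chainWeight.comp (measurable_fullTimes t))).aestronglyMeasurable, ?_⟩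
    rw [hasFiniteIntegral_iff_ofReal]
    · rw [lintegral_chainWeight hα hA hv1 ht]; exact ENNReal.ofReal_lt_top
    · rw [EventuallyLE, ae_restrict_iff' (measurableSet_simplex _ _)]
      exact Eventually.of_forall fun s hs => mul_nonneg (Real.rpow_nonneg (fullTimes_pos hs 0).le _)
        (chainWeight_nonneg hA ht.le (fullTimes_pos hs))

/-- The terms of the kernel series, written with chains. -/
def kernelTerm (κ : ℝ) (ρ : Torus → ℝ) (n : ℕ) (t : ℝ) (x y : Torus) : ℝ :=
  ∫ s in simplex n t, chain κ ρ n (fullTimes t s) x y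

lemma measurable_chain_fullTimes (hρ : Measurable ρ) {n : ℕ} (t : ℝ) (x y : Torus) :
    Measurable fun s => chain κ ρ n (fullTimes (n := n) t s) x y :=
  (measurable_chain hρ n).comp ((measurable_fullTimes t).prodMk
    (measurable_const (a := ((x, y) : Torus × Torus))))

lemma measurable_kernelTerm (hρ : Measurable ρ) (n : ℕ) (t : ℝ) :
    Measurable fun p : Torus × Torus => kernelTerm κ ρ n t p.1 p.2 := by
  have h : Measurable fun q : (Torus × Torus) × (Fin n → ℝ) =>
      chain κ ρ n (fullTimes t q.2) q.1.1 q.1.2 :=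
    (measurable_chain hρ n).comp (((measurable_fullTimes t).comp measurable_snd).prodMk
      measurable_fst)
  exact (StronglyMeasurable.integral_prod_right' (ν := volume.restrict (simplex n t))
    h.stronglyMeasurable).measurable

variable {C α T : ℝ}

lemma abs_chain_fullTimes_le (hα : 0 < α) (hα1 : α ≤ 1) (hρ : HolderTorus C α ρ) {n : ℕ} {t : ℝ}
    (htT : t ≤ T) {s : Fin n → ℝ} (hs : s ∈ simplex n t) (x y : Torus) :
    |chain κ ρ n (fullTimes t s) x y| ≤
      ((fullTimes t s 0) ^ (-(0 : ℝ)) *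
        chainWeight (chainConst κ C α T) t ((1 - α) / 2) (fullTimes t s)) * heat (4 * t) (x - y) := by
  have := abs_chain_le (κ := κ) hα hα1 hρ htT (fullTimes_pos hs) (fullTimes_le hs) x y
  rw [sum_fullTimes] at this
  rwa [neg_zero, Real.rpow_zero, one_mul]

lemma integrableOn_chain_fullTimes (hα : 0 < α) (hα1 : α ≤ 1) (hρ : HolderTorus C α ρ) {n : ℕ}
    {t : ℝ} (x y : Torus) :
    IntegrableOn (fun s => chain κ ρ n (fullTimes t s) x y) (simplex n t) := by
  rcases le_or_gt t 0 with ht | ht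
  · rw [simplex_eq_empty ht]; exact integrableOn_empty
  refine Integrable.mono' ((integrableOn_chainWeight hα
    (chainConst_nonneg (κ := κ) (α := α) hρ.nonneg ht.le) (v := 0) (by norm_num) n).mul_const
      (heat (4 * t) (x - y)))
    (measurable_chain_fullTimes (hρ.continuous hα).measurable t x y).aestronglyMeasurable ?_
  rw [ae_restrict_iff' (measurableSet_simplex _ _)]
  exact Eventually.of_forall fun s hs => abs_chain_fullTimes_le hα hα1 hρ le_rfl hs x y

lemma kernelTerm_of_nonpos {n : ℕ} {t : ℝ} (ht : t ≤ 0) (x y : Torus) : kernelTerm κ ρ n t x y = 0 := by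
  rw [kernelTerm, simplex_eq_empty ht, Measure.restrict_empty, integral_zero_measure]

/-- Gaussian bounds for the terms of the series. -/
lemma exists_kernelTerm_bound (hα : 0 < α) (hα1 : α ≤ 1) (hρ : HolderTorus C α ρ) (hT : 0 < T) :
    ∃ D : ℕ → ℝ, Summable D ∧ (∀ n, 0 ≤ D n) ∧ ∀ t, 0 < t → t ≤ T → ∀ n x y,
      |kernelTerm κ ρ (n + 1) t x y| ≤ t ^ ((1 + α) / 2) * D n * heat (4 * t) (x - y) := by
  have hA := chainConst_nonneg (κ := κ) (α := α) hρ.nonneg hT.le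
  obtain ⟨D, hD, hD0, hb⟩ := exists_chainWeight_bound hα hA (v := 0) (by norm_num) hT
  refine ⟨D, hD, hD0, fun t ht htT n x y => ?_⟩
  have h1 : |kernelTerm κ ρ (n + 1) t x y| ≤ ∫ s in simplex (n + 1) t,
      ((fullTimes t s 0) ^ (-(0 : ℝ)) *
        chainWeight (chainConst κ C α T) t ((1 - α) / 2) (fullTimes t s)) * heat (4 * t) (x - y) := by
    rw [← Real.norm_eq_abs]
    refine norm_integral_le_of_norm_le ((integrableOn_chainWeight hα hA (by norm_num) _).mul_const _) ?_
    rw [ae_restrict_iff' (measurableSet_simplex _ _)]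
    exact Eventually.of_forall fun s hs => abs_chain_fullTimes_le hα hα1 hρ htT hs x y
  rw [integral_mul_const] at h1
  have h2 := hb t ht htT n
  rw [sub_zero] at h2
  have := heat_nonneg (4 * t) (x - y)
  exact h1.trans (by gcongr)

lemma exists_kernelTerm_sub_bound (hα : 0 < α) (hα1 : α ≤ 1) (hρ : HolderTorus C α ρ) (hT : 0 < T)
    {u : ℝ} (hu0 : 0 < u) (hu1 : u ≤ 1) :
    ∃ D : ℕ → ℝ, Summable D ∧ (∀ n, 0 ≤ D n) ∧ ∀ t, 0 < t → t ≤ T → ∀ n x x' y,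
      |kernelTerm κ ρ (n + 1) t x y - kernelTerm κ ρ (n + 1) t x' y| ≤
        dist x x' ^ u * (t ^ ((1 + α) / 2 - u / 2) * D n) *
          (heat (4 * t) (x - y) + heat (4 * t) (x' - y)) := by
  have hA := chainConst_nonneg (κ := κ) (α := α) hρ.nonneg hT.le
  have hu2 : u / 2 ≤ 1 / 2 := by linarith
  obtain ⟨D, hD, hD0, hb⟩ := exists_chainWeight_bound hα hA hu2 hT
  refine ⟨fun n => 96 * D n, hD.mul_left _, fun n => mul_nonneg (by norm_num) (hD0 n),
    fun t ht htT n x x' y => ?_⟩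
  set H := heat (4 * t) (x - y) + heat (4 * t) (x' - y) with hH
  have hH0 : 0 ≤ H := add_nonneg (heat_nonneg _ _) (heat_nonneg _ _)
  have h1 : |kernelTerm κ ρ (n + 1) t x y - kernelTerm κ ρ (n + 1) t x' y| ≤
      ∫ s in simplex (n + 1) t, 96 * dist x x' ^ u * H * ((fullTimes t s 0) ^ (-(u / 2)) *
        chainWeight (chainConst κ C α T) t ((1 - α) / 2) (fullTimes t s)) := by
    rw [kernelTerm, kernelTerm, ← integral_sub (integrableOn_chain_fullTimes hα hα1 hρ x y)
      (integrableOn_chain_fullTimes hα hα1 hρ x' y), ← Real.norm_eq_abs]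
    refine norm_integral_le_of_norm_le ((integrableOn_chainWeight hα hA hu2 _).const_mul _) ?_
    rw [ae_restrict_iff' (measurableSet_simplex _ _)]
    refine Eventually.of_forall fun s hs => ?_
    have := abs_chain_sub_le (κ := κ) hα hα1 hρ htT hu0 hu1 (fullTimes_pos hs) (fullTimes_le hs) x x' y
    rw [sum_fullTimes, ← hH] at this
    rw [Real.norm_eq_abs]
    exact this.trans_eq (by ring)
  rw [integral_const_mul] at h1
  refine h1.trans ?_
  calc _ ≤ 96 * dist x x' ^ u * H * (t ^ ((1 + α) / 2 - u / 2) * D n) := by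
        gcongr; exact hb t ht htT n
    _ = _ := by ring

/-! ### The sum of the series -/

/-- The remainder of the kernel series, written with chains. -/
def remainderSum (κ : ℝ) (ρ : Torus → ℝ) (t : ℝ) (x y : Torus) : ℝ :=
  ∑' n : ℕ, kernelTerm κ ρ (n + 1) t x y

/-- The supremum t^(-1/2) of the Gaussian is beaten by t^((1+α)/2), leaving t^(α/2). For t ≤ 0 the
simplex is empty and the terms vanish, so the bound is uniform down to time 0. -/
lemma exists_kernelTerm_uniform_bound (hα : 0 < α) (hα1 : α ≤ 1) (hρ : HolderTorus C α ρ) (T : ℝ) :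
    ∃ D : ℕ → ℝ, Summable D ∧ (∀ n, 0 ≤ D n) ∧ ∀ t ≤ T, ∀ n x y,
      |kernelTerm κ ρ (n + 1) t x y| ≤ D n := by
  have hT' : 0 < max T 1 := lt_max_of_lt_right one_pos
  obtain ⟨D, hD, hD0, hb⟩ := exists_kernelTerm_bound (κ := κ) hα hα1 hρ hT'
  set T' := max T 1
  set c := Real.sqrt (4 * T') * heat (4 * T') 0 with hc
  have hc0 : 0 ≤ c := mul_nonneg (Real.sqrt_nonneg _) (heat_nonneg _ _)
  refine ⟨fun n => T' ^ (α / 2) * c * D n, hD.mul_left _, fun n => ?_, fun t ht n x y => ?_⟩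
  · have := hD0 n; positivity
  have hDn := hD0 n
  rcases le_or_gt t 0 with h0 | h0
  · rw [kernelTerm_of_nonpos h0, abs_zero]; positivity
  have htT' : t ≤ T' := ht.trans (le_max_left _ _)
  refine (hb t h0 htT' n x y).trans ?_
  have h1 := heat_sup_le (by linarith : 0 < 4 * t) (by linarith : 4 * t ≤ 4 * T') (x - y)
  have h2 : (4 * t) ^ (-(1 / 2) : ℝ) ≤ t ^ (-(1 / 2) : ℝ) :=
    rpow_neg_le_rpow_neg h0 (by linarith) (by norm_num)
  calc _ ≤ t ^ ((1 + α) / 2) * D n * (c * t ^ (-(1 / 2) : ℝ)) := by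
        exact mul_le_mul_of_nonneg_left (h1.trans (mul_le_mul_of_nonneg_left h2 hc0))
          (mul_nonneg (Real.rpow_nonneg h0.le _) hDn)
    _ = (t ^ ((1 + α) / 2) * t ^ (-(1 / 2) : ℝ)) * c * D n := by ring
    _ = t ^ (α / 2) * c * D n := by
        rw [← Real.rpow_add h0]; congr 3; ring
    _ ≤ T' ^ (α / 2) * c * D n := by gcongr

lemma summable_abs_kernelTerm (hα : 0 < α) (hα1 : α ≤ 1) (hρ : HolderTorus C α ρ) (t : ℝ)
    (x y : Torus) : Summable fun n : ℕ => |kernelTerm κ ρ (n + 1) t x y| := by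
  obtain ⟨D, hD, hD0, hb⟩ := exists_kernelTerm_uniform_bound (κ := κ) hα hα1 hρ t
  exact Summable.of_nonneg_of_le (fun _ => abs_nonneg _) (fun n => hb t le_rfl n x y) hD

lemma exists_remainderSum_bound (hα : 0 < α) (hα1 : α ≤ 1) (hρ : HolderTorus C α ρ) (T : ℝ) :
    ∃ c, 0 ≤ c ∧ ∀ t ≤ T, ∀ x y, |remainderSum κ ρ t x y| ≤ c := by
  obtain ⟨D, hD, hD0, hb⟩ := exists_kernelTerm_uniform_bound (κ := κ) hα hα1 hρ T
  refine ⟨∑' n, D n, tsum_nonneg hD0, fun t ht x y => ?_⟩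
  rw [remainderSum, ← Real.norm_eq_abs]
  exact tsum_of_norm_bounded hD.hasSum fun n => hb t ht n x y

lemma measurable_remainderSum (hα : 0 < α) (hα1 : α ≤ 1) (hρ : HolderTorus C α ρ) (t : ℝ) :
    Measurable fun p : Torus × Torus => remainderSum κ ρ t p.1 p.2 :=
  measurable_tsum_of_summable (fun n => measurable_kernelTerm (hρ.continuous hα).measurable (n + 1) t)
    fun p => (summable_abs_kernelTerm hα hα1 hρ t p.1 p.2).of_abs

lemma exists_remainderSum_sub_bound (hα : 0 < α) (hα1 : α ≤ 1) (hρ : HolderTorus C α ρ) (T : ℝ)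
    {u : ℝ} (hu0 : 0 < u) (hu1 : u ≤ 1) :
    ∃ c, 0 ≤ c ∧ ∀ t, 0 < t → t ≤ T → ∀ x x' y,
      |remainderSum κ ρ t x y - remainderSum κ ρ t x' y| ≤
        dist x x' ^ u * (t ^ ((1 + α) / 2 - u / 2) * c) *
          (heat (4 * t) (x - y) + heat (4 * t) (x' - y)) := by
  obtain ⟨D, hD, hD0, hb⟩ := exists_kernelTerm_sub_bound (κ := κ) hα hα1 hρ
    (lt_max_of_lt_right one_pos : 0 < max T 1) hu0 hu1
  refine ⟨∑' n, D n, tsum_nonneg hD0, fun t ht htT x x' y => ?_⟩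
  rw [remainderSum, remainderSum, ← (summable_abs_kernelTerm hα hα1 hρ t x y).of_abs.tsum_sub
    (summable_abs_kernelTerm hα hα1 hρ t x' y).of_abs, ← Real.norm_eq_abs]
  refine tsum_of_norm_bounded (((hD.hasSum.mul_left (t ^ ((1 + α) / 2 - u / 2))).mul_left
    (dist x x' ^ u)).mul_right _) fun n => hb t ht (htT.trans (le_max_left _ _)) n x x' y

end RoughTorus
end

noncomputable section

namespace RoughTorus

variable {C α : ℝ} {κ : ℝ} {ρ : Torus → ℝ} {R : ℝ → ℝ}

/-! ### Integrated and pointwise regularity of the remainder -/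

lemma remainderSum_of_nonpos {t : ℝ} (ht : t ≤ 0) (x y : Torus) : remainderSum κ ρ t x y = 0 := by
  simp [remainderSum, kernelTerm_of_nonpos ht]

lemma measurable_remainderSum_right (hα : 0 < α) (hα1 : α ≤ 1) (hρ : HolderTorus C α ρ) (t : ℝ)
    (x : Torus) : Measurable fun y : Torus => remainderSum κ ρ t x y :=
  (measurable_remainderSum hα hα1 hρ t).comp (measurable_const.prodMk measurable_id)

lemma integrable_remainderSum (hα : 0 < α) (hα1 : α ≤ 1) (hρ : HolderTorus C α ρ) (t : ℝ)
    (x : Torus) : Integrable fun y : Torus => remainderSum κ ρ t x y := by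
  obtain ⟨c, -, hc⟩ := exists_remainderSum_bound (κ := κ) hα hα1 hρ t
  exact integrable_of_measurable_of_bound (measurable_remainderSum_right hα hα1 hρ t x)
    fun y => hc t le_rfl x y

/-- The two Gaussians have mass one each and the exponent (1+α−u)/2 is nonnegative, so no
singularity in t remains. -/
lemma exists_integral_remainderSum_sub_bound (hα : 0 < α) (hα1 : α ≤ 1) (hρ : HolderTorus C α ρ)
    (T : ℝ) {u : ℝ} (hu0 : 0 < u) (hu1 : u ≤ 1) :
    ∃ c, 0 ≤ c ∧ ∀ t ≤ T, ∀ x x', ∫ y, |remainderSum κ ρ t x y - remainderSum κ ρ t x' y| ≤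
      dist x x' ^ u * c := by
  obtain ⟨c, hc0, hc⟩ := exists_remainderSum_sub_bound (κ := κ) hα hα1 hρ T hu0 hu1
  have he : 0 ≤ (1 + α) / 2 - u / 2 := by linarith
  have hM : 0 ≤ max T 0 := le_max_right _ _
  refine ⟨max T 0 ^ ((1 + α) / 2 - u / 2) * c * 2, by positivity, fun t ht x x' => ?_⟩
  rcases le_or_gt t 0 with h0 | h0
  · simp only [remainderSum_of_nonpos h0, sub_self, abs_zero, integral_zero]
    positivity
  have ht4 : 0 < 4 * t := by linarith
  have ch := continuous_heat ht4
  have e1 : ∫ y, (heat (4 * t) (x - y) + heat (4 * t) (x' - y)) = 2 := by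
    rw [integral_add (Continuous.integrable_torus (by fun_prop))
      (Continuous.integrable_torus (by fun_prop)), integral_heat_sub_right ht4,
      integral_heat_sub_right ht4]
    norm_num
  calc _ ≤ ∫ y, dist x x' ^ u * (t ^ ((1 + α) / 2 - u / 2) * c) *
        (heat (4 * t) (x - y) + heat (4 * t) (x' - y)) :=
        integral_mono_of_nonneg (Eventually.of_forall fun _ => abs_nonneg _)
          (Continuous.integrable_torus (by fun_prop))
          (Eventually.of_forall fun y => hc t h0 ht x x' y)
    _ = dist x x' ^ u * (t ^ ((1 + α) / 2 - u / 2) * c * 2) := by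
        rw [integral_const_mul, e1]; ring
    _ ≤ _ := by
        have : t ≤ max T 0 := ht.trans (le_max_left _ _)
        gcongr

lemma exists_heat_four_sup_le (T : ℝ) :
    ∃ c, 0 ≤ c ∧ ∀ t, 0 < t → t ≤ T → ∀ x, heat (4 * t) x ≤ c * t ^ (-(1 / 2) : ℝ) := by
  have hc0 : 0 ≤ Real.sqrt (4 * T) * heat (4 * T) 0 :=
    mul_nonneg (Real.sqrt_nonneg _) (heat_nonneg _ _)
  refine ⟨_, hc0, fun t h0 ht x => ?_⟩
  exact (heat_sup_le (by linarith : 0 < 4 * t) (by linarith : 4 * t ≤ 4 * T) x).trans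
    (mul_le_mul_of_nonneg_left (rpow_neg_le_rpow_neg h0 (by linarith) (by norm_num)) hc0)

/-- Pointwise the Gaussians cost t^(-1/2), and t^((1+α-u)/2) t^(-1/2) = t^(α/2)/t^(u/2). -/
lemma exists_remainderSum_sub_sup_bound (hα : 0 < α) (hα1 : α ≤ 1) (hρ : HolderTorus C α ρ)
    (T : ℝ) {u : ℝ} (hu0 : 0 < u) (hu1 : u ≤ 1) :
    ∃ c, 0 ≤ c ∧ ∀ t, 0 < t → t ≤ T → ∀ x x' y,
      |remainderSum κ ρ t x y - remainderSum κ ρ t x' y| ≤ dist x x' ^ u / t ^ (u / 2) * c := by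
  obtain ⟨c, hc0, hc⟩ := exists_remainderSum_sub_bound (κ := κ) hα hα1 hρ T hu0 hu1
  obtain ⟨d, hd0, hd⟩ := exists_heat_four_sup_le T
  have hM : 0 ≤ max T 0 := le_max_right _ _
  refine ⟨max T 0 ^ (α / 2) * c * (2 * d), by positivity, fun t h0 ht x x' y => ?_⟩
  refine (hc t h0 ht x x' y).trans ?_
  have h1 := hd t h0 ht (x - y)
  have h2 := hd t h0 ht (x' - y)
  have hnn : 0 ≤ t ^ ((1 + α) / 2 - u / 2) := Real.rpow_nonneg h0.le _
  have e : t ^ ((1 + α) / 2 - u / 2) * t ^ (-(1 / 2) : ℝ) = t ^ (α / 2) / t ^ (u / 2) := by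
    rw [← Real.rpow_add h0, ← Real.rpow_sub h0]; congr 1; ring
  have htM : t ≤ max T 0 := ht.trans (le_max_left _ _)
  calc _ ≤ dist x x' ^ u * (t ^ ((1 + α) / 2 - u / 2) * c) *
        (d * t ^ (-(1 / 2) : ℝ) + d * t ^ (-(1 / 2) : ℝ)) := by gcongr
    _ = dist x x' ^ u * (t ^ ((1 + α) / 2 - u / 2) * t ^ (-(1 / 2) : ℝ)) * c * (2 * d) := by ring
    _ = dist x x' ^ u / t ^ (u / 2) * (t ^ (α / 2) * c * (2 * d)) := by rw [e]; ring
    _ ≤ _ := by gcongr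

/-! ### Identification with the series of iterated Riemann–Stieltjes integrals -/

lemma seriesTerm_eq_kernelTerm (hα : 0 < α) (hα1 : α ≤ 1) (hR : ContinuousOn R (Icc 0 1))
    (hρ : HolderTorus C α (periodicPart R)) (n : ℕ) (t : ℝ) (x y : Torus) :
    seriesTerm R n t x y = kernelTerm (R 1 - R 0) (periodicPart R) n t x y :=
  setIntegral_congr_fun (measurableSet_simplex n t) fun _ hs =>
    (rsIntegrableN_and_innerTerm_eq hα hα1 hR hρ (fullTimes_pos hs) x y).2

lemma remainder_eq_remainderSum (hα : 0 < α) (hα1 : α ≤ 1) (hR : ContinuousOn R (Icc 0 1))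
    (hρ : HolderTorus C α (periodicPart R)) (t : ℝ) (x y : Torus) :
    remainder R t x y = remainderSum (R 1 - R 0) (periodicPart R) t x y := by
  simp only [remainder, remainderSum, seriesTerm_eq_kernelTerm hα hα1 hR hρ]

lemma integrableOn_innerTerm (hα : 0 < α) (hα1 : α ≤ 1) (hR : ContinuousOn R (Icc 0 1))
    (hρ : HolderTorus C α (periodicPart R)) (n : ℕ) (t : ℝ) (x y : Torus) :
    IntegrableOn (fun s => innerTerm R (fullTimes t s) x y) (simplex n t) :=
  (integrableOn_chain_fullTimes hα hα1 hρ x y).congr_fun (fun _ hs =>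
    (rsIntegrableN_and_innerTerm_eq hα hα1 hR hρ (fullTimes_pos hs) x y).2.symm)
    (measurableSet_simplex n t)

lemma series_bounds (hα : 0 < α) (hα1 : α ≤ 1) (hR : ContinuousOn R (Icc 0 1))
    (hρ : HolderTorus C α (periodicPart R)) (T : ℝ) :
    (∀ t ∈ Set.Icc 0 T, ∀ x y : Torus, Summable fun n : ℕ => |seriesTerm R (n + 1) t x y|) ∧
    TendstoUniformlyOn
      (fun (N : ℕ) (q : ℝ × Torus × Torus) =>
        ∑ n ∈ Finset.range N, seriesTerm R (n + 1) q.1 q.2.1 q.2.2)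
      (fun q => remainder R q.1 q.2.1 q.2.2) atTop (Set.Icc 0 T ×ˢ Set.univ) ∧
    (∀ t ∈ Set.Icc 0 T, ∀ x : Torus, Integrable fun y => remainder R t x y) ∧
    (∃ c : ℝ, ∀ t ∈ Set.Icc 0 T, ∀ x : Torus, ∫ y, |remainder R t x y| ≤ c) ∧
    (∀ u ∈ Set.Ioc (0 : ℝ) 1, ∃ c : ℝ, ∀ t ∈ Set.Icc 0 T, ∀ x x' : Torus,
      ∫ y, |remainder R t x y - remainder R t x' y| ≤ dist x x' ^ u * c) ∧
    (∃ c : ℝ, ∀ t ∈ Set.Icc 0 T, ∀ x y : Torus, |remainder R t x y| ≤ c) ∧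
    (∀ u ∈ Set.Ioc (0 : ℝ) 1, ∃ c : ℝ, ∀ t ∈ Set.Ioc 0 T, ∀ x x' y : Torus,
      |remainder R t x y - remainder R t x' y| ≤ dist x x' ^ u / t ^ (u / 2) * c) := by
  simp only [remainder_eq_remainderSum hα hα1 hR hρ, seriesTerm_eq_kernelTerm hα hα1 hR hρ]
  obtain ⟨c, hc0, hc⟩ := exists_remainderSum_bound (κ := R 1 - R 0) hα hα1 hρ T
  refine ⟨fun t _ x y => summable_abs_kernelTerm hα hα1 hρ t x y, ?_,
    fun t _ x => integrable_remainderSum hα hα1 hρ t x, ⟨c, fun t ht x => ?_⟩, fun u hu => ?_,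
    ⟨c, fun t ht x y => hc t ht.2 x y⟩, fun u hu => ?_⟩
  · obtain ⟨D, hD, -, hb⟩ := exists_kernelTerm_uniform_bound (κ := R 1 - R 0) hα hα1 hρ T
    exact tendstoUniformlyOn_tsum_nat hD fun n q hq => hb q.1 hq.1.2 n q.2.1 q.2.2
  · calc _ ≤ ∫ _ : Torus, c := integral_mono_of_nonneg (Eventually.of_forall fun _ => abs_nonneg _)
          (integrable_const _) (Eventually.of_forall fun y => hc t ht.2 x y)
      _ = c := by simp
  · obtain ⟨d, -, hd⟩ := exists_integral_remainderSum_sub_bound (κ := R 1 - R 0) hα hα1 hρ T hu.1 hu.2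
    exact ⟨d, fun t ht => hd t ht.2⟩
  · obtain ⟨d, -, hd⟩ := exists_remainderSum_sub_sup_bound (κ := R 1 - R 0) hα hα1 hρ T hu.1 hu.2
    exact ⟨d, fun t ht => hd t ht.1 ht.2⟩

end RoughTorus
end

/-! ### Integral operators and the heat semigroup on L². -/

noncomputable section

namespace RoughTorus

/-! ### Integral operators on `L²` -/

lemma integrable_coeFn (f : L2) : Integrable (f : Torus → ℝ) := (Lp.memLp f).integrable one_le_two

lemma integrable_coeFn_mul (f g : L2) : Integrable fun x => f x * g x :=
  (Lp.memLp f).integrable_mul (Lp.memLp g)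

lemma inner_eq_integral (f g : L2) : inner ℝ f g = ∫ x, f x * g x := by
  rw [L2.inner_def]
  exact integral_congr_ae (Eventually.of_forall fun x => by simp [mul_comm])

lemma norm_sq_eq_integral (f : L2) : ‖f‖ ^ 2 = ∫ x, f x ^ 2 := by
  rw [← real_inner_self_eq_norm_sq, inner_eq_integral]
  simp only [sq]

lemma integrable_coeFn_sq (f : L2) : Integrable fun x => f x ^ 2 := by
  simpa only [sq] using integrable_coeFn_mul f f

lemma integrable_bdd_mul {K : Torus → ℝ} (hK : Measurable K) {M : ℝ} (hM : ∀ x, |K x| ≤ M)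
    {f : Torus → ℝ} (hf : Integrable f) : Integrable fun x => K x * f x :=
  hf.bdd_mul (c := M) hK.aestronglyMeasurable (Eventually.of_forall hM)

/-- Cauchy–Schwarz on a probability space through Young's inequality |f| ≤ f²/(2c) + c/2; the choice
c = ∫|f| closes it. -/
lemma integral_abs_le_norm (f : L2) : ∫ x, |f x| ≤ ‖f‖ := by
  have h : ∫ x, (|f x| * 1 : ℝ) ≤ Real.sqrt (∫ x, f x ^ 2) := by
    have h2 : ∀ c : ℝ, 0 < c → ∫ x, |f x| ≤ (∫ x, f x ^ 2) / (2 * c) + c / 2 := by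
      intro c hc
      have : ∫ x, |f x| ≤ ∫ x, (f x ^ 2 / (2 * c) + c / 2) := by
        refine integral_mono (integrable_coeFn f).abs
          (((integrable_coeFn_sq f).div_const _).add (integrable_const _)) fun x => ?_
        have := sq_nonneg (|f x| - c)
        have h3 := sq_abs (f x)
        simp only
        rw [← h3]
        field_simp
        nlinarith
      rwa [integral_add ((integrable_coeFn_sq f).div_const _) (integrable_const _),
        integral_div, integral_const, probReal_univ, one_smul] at this
    simp only [mul_one]
    refine Real.le_sqrt_of_sq_le ?_
    rcases (integral_nonneg fun x => abs_nonneg (f x) : 0 ≤ ∫ x, |f x|).eq_or_lt with h0 | h0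
    · rw [← h0]; simpa using integral_nonneg fun x => sq_nonneg (f x)
    · have := h2 _ h0
      field_simp at this
      nlinarith
  simp only [mul_one] at h
  rwa [← norm_sq_eq_integral, Real.sqrt_sq (norm_nonneg f)] at h

section Schur

variable {K : Torus × Torus → ℝ} {M A : ℝ}

lemma Measurable.integral_kernel_mul (hK : Measurable K) (f : L2) :
    Measurable fun x : Torus => ∫ y, K (x, y) * f y :=
  (StronglyMeasurable.integral_prod_right' (f := fun p : Torus × Torus => K p * f p.2)
    (hK.mul ((Lp.stronglyMeasurable f).measurable.comp measurable_snd)).stronglyMeasurable).measurable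

lemma abs_integral_kernel_mul_le (hM : ∀ p, |K p| ≤ M) (f : L2) (x : Torus) :
    |∫ y, K (x, y) * f y| ≤ M * ‖f‖ := by
  have hM0 : 0 ≤ M := (abs_nonneg _).trans (hM (x, x))
  calc |∫ y, K (x, y) * f y| ≤ ∫ y, M * |f y| := by
        rw [← Real.norm_eq_abs]
        refine norm_integral_le_of_norm_le ((integrable_coeFn f).abs.const_mul M)
          (Eventually.of_forall fun y => ?_)
        rw [norm_mul]
        exact mul_le_mul_of_nonneg_right (hM _) (abs_nonneg _)
    _ ≤ M * ‖f‖ := by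
        rw [integral_const_mul]
        exact mul_le_mul_of_nonneg_left (integral_abs_le_norm f) hM0

lemma memLp_integral_kernel_mul (hK : Measurable K) (hM : ∀ p, |K p| ≤ M) (f : L2) :
    MemLp (fun x : Torus => ∫ y, K (x, y) * f y) 2 :=
  MemLp.of_bound (Measurable.integral_kernel_mul hK f).aestronglyMeasurable (M * ‖f‖)
    (Eventually.of_forall fun x => abs_integral_kernel_mul_le hM f x)

/-- Cauchy–Schwarz for the weight |K(x, ·)|, again through Young's inequality, with c the left-hand
integral divided by A. -/
lemma sq_integral_kernel_mul_le (hK : Measurable K) (hM : ∀ p, |K p| ≤ M) (hA : 0 < A)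
    (h1 : ∀ x, ∫ y, |K (x, y)| ≤ A) (f : L2) (x : Torus) :
    (∫ y, K (x, y) * f y) ^ 2 ≤ A * ∫ y, |K (x, y)| * f y ^ 2 := by
  have hKx : Measurable fun y => K (x, y) := hK.comp (measurable_const.prodMk measurable_id)
  have hi0 : Integrable fun y => |K (x, y)| :=
    (integrable_of_measurable_of_bound hKx fun y => hM (x, y)).abs
  have hKa : Measurable fun y => |K (x, y)| := by fun_prop
  have hi1 : Integrable fun y => |K (x, y)| * f y ^ 2 :=
    integrable_bdd_mul hKa (fun y => (abs_abs _).trans_le (hM (x, y))) (integrable_coeFn_sq f)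
  set Q := ∫ y, |K (x, y)| * f y ^ 2 with hQ
  have hQ0 : 0 ≤ Q := integral_nonneg fun y => mul_nonneg (abs_nonneg _) (sq_nonneg _)
  have key : ∀ c : ℝ, 0 < c → |∫ y, K (x, y) * f y| ≤ Q / (2 * c) + c / 2 * A := by
    intro c hc
    have : |∫ y, K (x, y) * f y| ≤
        ∫ y, (|K (x, y)| * f y ^ 2 / (2 * c) + c / 2 * |K (x, y)|) := by
      rw [← Real.norm_eq_abs]
      refine norm_integral_le_of_norm_le ((hi1.div_const _).add (hi0.const_mul _))
        (Eventually.of_forall fun y => ?_)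
      rw [norm_mul, Real.norm_eq_abs, Real.norm_eq_abs]
      have h := mul_nonneg (abs_nonneg (K (x, y))) (sq_nonneg (|f y| - c))
      have h3 := sq_abs (f y)
      rw [← h3]
      field_simp
      nlinarith
    rw [integral_add (hi1.div_const _) (hi0.const_mul _), integral_div, integral_const_mul] at this
    refine this.trans ?_
    have := h1 x
    gcongr
  rw [← sq_abs]
  rcases (abs_nonneg (∫ y, K (x, y) * f y)).eq_or_lt with h0 | h0
  · rw [← h0, zero_pow two_ne_zero]; positivity
  · set J := |∫ y, K (x, y) * f y|
    have := key (J / A) (by positivity)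
    field_simp at this
    nlinarith

lemma integral_sq_kernel_le (hK : Measurable K) (hM : ∀ p, |K p| ≤ M) (hA : 0 < A)
    (h1 : ∀ x, ∫ y, |K (x, y)| ≤ A) (h2 : ∀ y, ∫ x, |K (x, y)| ≤ A) (f : L2) :
    ∫ x, (∫ y, K (x, y) * f y) ^ 2 ≤ A ^ 2 * ‖f‖ ^ 2 := by
  have hint : Integrable (fun p : Torus × Torus => |K p| * f p.2 ^ 2) (volume.prod volume) :=
    (Integrable.comp_snd (integrable_coeFn_sq f) volume).bdd_mul (c := M)
      (by fun_prop) (Eventually.of_forall fun p => (abs_abs _).trans_le (hM p))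
  have hsq : Integrable fun x : Torus => (∫ y, K (x, y) * f y) ^ 2 :=
    (memLp_integral_kernel_mul hK hM f).integrable_sq
  calc ∫ x, (∫ y, K (x, y) * f y) ^ 2 ≤ ∫ x, A * ∫ y, |K (x, y)| * f y ^ 2 :=
        integral_mono hsq (hint.integral_prod_left.const_mul A)
          fun x => sq_integral_kernel_mul_le hK hM hA h1 f x
    _ = A * ∫ y, ∫ x, |K (x, y)| * f y ^ 2 := by
        rw [integral_const_mul, integral_integral_swap hint]
    _ ≤ A * ∫ y, A * f y ^ 2 := by
        refine mul_le_mul_of_nonneg_left (integral_mono hint.integral_prod_right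
          ((integrable_coeFn_sq f).const_mul A) fun y => ?_) hA.le
        simp only
        rw [integral_mul_const]
        exact mul_le_mul_of_nonneg_right (h2 y) (sq_nonneg _)
    _ = _ := by rw [integral_const_mul, ← norm_sq_eq_integral]; ring

/-- Schur's test. -/
theorem exists_kernel_operator (hK : Measurable K) (hM : ∀ p, |K p| ≤ M) (hA : 0 < A)
    (h1 : ∀ x, ∫ y, |K (x, y)| ≤ A) (h2 : ∀ y, ∫ x, |K (x, y)| ≤ A) :
    ∃ S : L2 →L[ℝ] L2, ‖S‖ ≤ A ∧ ∀ f, S f =ᵐ[volume] fun x => ∫ y, K (x, y) * f y := by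
  have hm := memLp_integral_kernel_mul hK hM
  have hi : ∀ (f : L2) x, Integrable fun y => K (x, y) * f y := fun f x =>
    integrable_bdd_mul (hK.comp (measurable_const.prodMk measurable_id)) (fun y => hM (x, y))
      (integrable_coeFn f)
  let L : L2 →ₗ[ℝ] L2 :=
    { toFun := fun f => (hm f).toLp _
      map_add' := fun f g => by
        rw [← MemLp.toLp_add]
        refine (MemLp.toLp_eq_toLp_iff _ _).2 (Eventually.of_forall fun x => ?_)
        simp only [Pi.add_apply]
        rw [← integral_add (hi f x) (hi g x)]
        refine integral_congr_ae ?_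
        filter_upwards [Lp.coeFn_add f g] with y hy
        rw [hy, Pi.add_apply, mul_add]
      map_smul' := fun c f => by
        rw [RingHom.id_apply, ← MemLp.toLp_const_smul]
        refine (MemLp.toLp_eq_toLp_iff _ _).2 (Eventually.of_forall fun x => ?_)
        simp only [Pi.smul_apply, smul_eq_mul]
        rw [← integral_const_mul]
        refine integral_congr_ae ?_
        filter_upwards [Lp.coeFn_smul c f] with y hy
        rw [hy, Pi.smul_apply, smul_eq_mul]; ring }
  have hL : ∀ f, L f =ᵐ[volume] fun x => ∫ y, K (x, y) * f y := fun f => MemLp.coeFn_toLp (hm f)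
  have hb : ∀ f, ‖L f‖ ≤ A * ‖f‖ := fun f => by
    refine abs_le_of_sq_le_sq' ?_ (by positivity) |>.2
    rw [norm_sq_eq_integral, mul_pow]
    refine le_trans (le_of_eq (integral_congr_ae ?_)) (integral_sq_kernel_le hK hM hA h1 h2 f)
    filter_upwards [hL f] with x hx
    rw [hx]
  exact ⟨L.mkContinuous A hb, L.mkContinuous_norm_le hA.le hb, hL⟩

/-- Transposing the kernel gives the adjoint. Symmetry of the rough kernel is not evident from the
series, so both operators are kept until the eigenvectors identify them. -/
lemma inner_kernel_operator (hK : Measurable K) (hM : ∀ p, |K p| ≤ M) {S S' : L2 →L[ℝ] L2}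
    (hS : ∀ f, S f =ᵐ[volume] fun x => ∫ y, K (x, y) * f y)
    (hS' : ∀ f, S' f =ᵐ[volume] fun x => ∫ y, K (y, x) * f y) (f g : L2) :
    inner ℝ (S f) g = inner ℝ f (S' g) := by
  have hint : Integrable (fun p : Torus × Torus => K p * (g p.1 * f p.2)) (volume.prod volume) :=
    ((integrable_coeFn g).mul_prod (integrable_coeFn f)).bdd_mul (c := M)
      hK.aestronglyMeasurable (Eventually.of_forall hM)
  calc inner ℝ (S f) g = ∫ x, ∫ y, K (x, y) * (g x * f y) := by
        rw [inner_eq_integral]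
        refine integral_congr_ae ?_
        filter_upwards [hS f] with x hx
        rw [hx, ← integral_mul_const]
        exact integral_congr_ae (Eventually.of_forall fun y => by simp only; ring)
    _ = ∫ y, ∫ x, K (x, y) * (g x * f y) := integral_integral_swap hint
    _ = inner ℝ f (S' g) := by
        rw [inner_eq_integral]
        refine integral_congr_ae ?_
        filter_upwards [hS' g] with y hy
        rw [hy, ← integral_const_mul]
        exact integral_congr_ae (Eventually.of_forall fun y => by simp only; ring)

end Schur

/-! ### Continuous functions in `L²` -/

/-- A continuous function on the torus as an element of `L²`. -/
abbrev toL2 : C(Torus, ℝ) →L[ℝ] L2 := ContinuousMap.toLp 2 volume ℝ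

lemma coeFn_toL2 (φ : C(Torus, ℝ)) : toL2 φ =ᵐ[volume] φ := ContinuousMap.coeFn_toLp volume φ

lemma denseRange_toL2 : DenseRange toL2 :=
  ContinuousMap.toLp_denseRange ℝ volume ℝ (by norm_num)

lemma inner_toL2 (f : L2) (φ : C(Torus, ℝ)) : inner ℝ f (toL2 φ) = ∫ x, f x * φ x := by
  rw [inner_eq_integral]
  refine integral_congr_ae ?_
  filter_upwards [coeFn_toL2 φ] with x hx
  rw [hx]

lemma toL2_injective : Function.Injective toL2 := ContinuousMap.toLp_injective (μ := volume)

/-! ### The heat semigroup on `L²` -/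

lemma exists_heat_operator {t : ℝ} (ht : 0 < t) : ∃ S : L2 →L[ℝ] L2, ‖S‖ ≤ 1 ∧
    ∀ f, S f =ᵐ[volume] fun x => ∫ y, heat t (x - y) * f y := by
  have hc := continuous_heat ht
  obtain ⟨M, -, hM⟩ := exists_bound_of_continuous hc
  refine exists_kernel_operator (K := fun p => heat t (p.1 - p.2)) (M := M)
    (Continuous.measurable (by fun_prop)) (fun p => hM _) one_pos (fun x => ?_) fun y => ?_
  · simp only [abs_of_nonneg (heat_nonneg _ _), integral_heat_sub_right ht, le_refl]
  · simp only [abs_of_nonneg (heat_nonneg _ _), integral_heat_sub_left ht, le_refl]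

open Classical in
/-- The heat semigroup on `L²` (the identity at nonpositive times). -/
def heatOp (t : ℝ) : L2 →L[ℝ] L2 :=
  if ht : 0 < t then (exists_heat_operator ht).choose else ContinuousLinearMap.id ℝ L2

lemma heatOp_coeFn {t : ℝ} (ht : 0 < t) (f : L2) :
    heatOp t f =ᵐ[volume] fun x => ∫ y, heat t (x - y) * f y := by
  rw [heatOp, dif_pos ht]
  exact (exists_heat_operator ht).choose_spec.2 f

lemma norm_heatOp_le {t : ℝ} (ht : 0 < t) : ‖heatOp t‖ ≤ 1 := by
  rw [heatOp, dif_pos ht]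
  exact (exists_heat_operator ht).choose_spec.1

lemma norm_heatOp_apply_le {t : ℝ} (ht : 0 < t) (f : L2) : ‖heatOp t f‖ ≤ ‖f‖ := by
  simpa using (heatOp t).le_of_opNorm_le (norm_heatOp_le ht) f

/-- A bound on a dense set and a uniform operator bound give convergence everywhere. -/
lemma tendsto_of_dense {ι E F : Type*} [SeminormedAddCommGroup E] [NormedSpace ℝ E]
    [SeminormedAddCommGroup F] [NormedSpace ℝ F] {l : Filter ι} {S : ι → E →L[ℝ] F} {S₀ : E →L[ℝ] F}
    {M : ℝ} (hS : ∀ᶠ i in l, ‖S i‖ ≤ M) {D : Set E} (hD : Dense D)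
    (h : ∀ f ∈ D, Tendsto (fun i => S i f) l (𝓝 (S₀ f))) (f : E) :
    Tendsto (fun i => S i f) l (𝓝 (S₀ f)) := by
  rw [Metric.tendsto_nhds]
  intro ε hε
  set N := max M 0 + ‖S₀‖ + 1 with hN
  have hN0 : 0 < N := by have := le_max_right M 0; have := norm_nonneg S₀; linarith
  obtain ⟨g, hg, hfg⟩ := Metric.dense_iff.1 hD f (ε / (2 * N)) (by positivity)
  have h2 := (Metric.tendsto_nhds.1 (h g hfg)) (ε / 2) (by positivity)
  filter_upwards [hS, h2] with i hi h2
  rw [dist_eq_norm] at h2 ⊢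
  have hfg' : ‖f - g‖ < ε / (2 * N) := by
    rw [← dist_eq_norm, dist_comm]; exact hg
  have e : S i f - S₀ f = S i (f - g) + (S i g - S₀ g) - S₀ (f - g) := by
    simp only [map_sub]; abel
  have b1 : ‖S i (f - g)‖ ≤ max M 0 * ‖f - g‖ :=
    (S i).le_of_opNorm_le (hi.trans (le_max_left _ _)) _
  have b2 : ‖S₀ (f - g)‖ ≤ ‖S₀‖ * ‖f - g‖ := S₀.le_opNorm _
  have b3 : N * ‖f - g‖ ≤ ε / 2 := by
    calc N * ‖f - g‖ ≤ N * (ε / (2 * N)) := by gcongr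
      _ = ε / 2 := by field_simp
  have b4 := norm_nonneg (f - g)
  calc _ ≤ ‖S i (f - g)‖ + ‖S i g - S₀ g‖ + ‖S₀ (f - g)‖ := by
        rw [e]; exact (norm_sub_le _ _).trans (by gcongr; exact norm_add_le _ _)
    _ < ε := by nlinarith

lemma tendsto_heatOp (f : L2) : Tendsto (fun t => heatOp t f) (𝓝[>] 0) (𝓝 f) := by
  refine tendsto_of_dense (S₀ := ContinuousLinearMap.id ℝ L2) (M := 1) ?_ denseRange_toL2 ?_ f
  · filter_upwards [self_mem_nhdsWithin] with t ht using norm_heatOp_le ht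
  · rintro _ ⟨φ, rfl⟩
    rw [Metric.tendsto_nhds]
    intro ε hε
    obtain ⟨δ, hδ, h⟩ := exists_heat_approx φ.continuous (half_pos hε)
    filter_upwards [Ioo_mem_nhdsGT hδ] with t ht
    rw [dist_eq_norm, ContinuousLinearMap.id_apply]
    have : ‖heatOp t (toL2 φ) - toL2 φ‖ ^ 2 ≤ (ε / 2) ^ 2 := by
      rw [norm_sq_eq_integral]
      calc _ ≤ ∫ _ : Torus, (ε / 2) ^ 2 := by
            refine integral_mono_ae (integrable_coeFn_sq _) (integrable_const _) ?_
            filter_upwards [Lp.coeFn_sub (heatOp t (toL2 φ)) (toL2 φ), heatOp_coeFn ht.1 (toL2 φ),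
              coeFn_toL2 φ] with x h1 h2 h3
            rw [h1, Pi.sub_apply, h2, h3, ← sq_abs]
            have e : ∫ y, heat t (x - y) * toL2 φ y = ∫ y, heat t (x - y) * φ y := by
              refine integral_congr_ae ?_
              filter_upwards [coeFn_toL2 φ] with y hy
              rw [hy]
            rw [e]
            have := h t ht.1 ht.2 x
            gcongr
        _ = _ := by simp
    have := (abs_le_of_sq_le_sq' this (by positivity)).2
    linarith

end RoughTorus
end

/-! ### The Sobolev space H¹: representatives and mollification by the heat flow. -/

noncomputable section

namespace RoughTorus

/-! ### Continuously differentiable functions on the torus -/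

lemma integral_Ioc_sq_le {g : Torus → ℝ} (hg : Continuous g) {a b : ℝ}
    (hb : b ≤ a + 1) : ∫ x in a..b, g (x : Torus) ^ 2 ≤ ∫ x : Torus, g x ^ 2 := by
  have hc : Continuous fun x : ℝ => g (x : Torus) ^ 2 :=
    (hg.comp (AddCircle.continuous_mk' 1)).pow 2
  rw [← AddCircle.intervalIntegral_preimage 1 a,
    ← intervalIntegral.integral_add_adjacent_intervals (hc.intervalIntegrable a b)
      (hc.intervalIntegrable b (a + 1))]
  have := intervalIntegral.integral_nonneg (μ := volume) hb fun x _ => sq_nonneg (g (x : Torus))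
  linarith

lemma norm_toL2_sq (φ : C(Torus, ℝ)) : ‖toL2 φ‖ ^ 2 = ∫ x, φ x ^ 2 := by
  rw [norm_sq_eq_integral]
  refine integral_congr_ae ?_
  filter_upwards [coeFn_toL2 φ] with x hx
  rw [hx]

/-- Cauchy–Schwarz on [a, b]; as b − a ≤ 1, the integral of φ'² over [a, b] is at most that over a
period. -/
lemma HasTorusDeriv.abs_sub_le {φ φ' : C(Torus, ℝ)} (h : HasTorusDeriv φ φ') {a b : ℝ} (hab : a ≤ b)
    (hb : b ≤ a + 1) : |φ (b : Torus) - φ (a : Torus)| ≤ Real.sqrt (b - a) * ‖toL2 φ'‖ := by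
  have hc : Continuous fun x : ℝ => φ' (x : Torus) := φ'.continuous.comp (AddCircle.continuous_mk' 1)
  rw [← intervalIntegral.integral_eq_sub_of_hasDerivAt (fun x _ => h x) (hc.intervalIntegrable a b)]
  set J := |∫ x in a..b, φ' (x : Torus)| with hJ
  set N := ‖toL2 φ'‖ with hN
  have h2 : ∫ x in a..b, φ' (x : Torus) ^ 2 ≤ N ^ 2 := by
    rw [hN, norm_toL2_sq]; exact integral_Ioc_sq_le φ'.continuous hb
  have key : ∀ c : ℝ, 0 < c → J ≤ N ^ 2 / (2 * c) + c / 2 * (b - a) := by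
    intro c hc0
    have h3 : J ≤ ∫ x in a..b, (φ' (x : Torus) ^ 2 / (2 * c) + c / 2) := by
      rw [hJ, ← Real.norm_eq_abs]
      refine intervalIntegral.norm_integral_le_of_norm_le hab (Eventually.of_forall fun x _ => ?_)
        (Continuous.intervalIntegrable (by fun_prop) _ _)
      rw [Real.norm_eq_abs, ← sq_abs]
      have := sq_nonneg (|φ' (x : Torus)| - c)
      field_simp
      nlinarith
    rw [intervalIntegral.integral_add (Continuous.intervalIntegrable (by fun_prop) _ _)
      (Continuous.intervalIntegrable (by fun_prop) _ _), intervalIntegral.integral_div,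
      intervalIntegral.integral_const, smul_eq_mul, mul_comm (b - a)] at h3
    refine h3.trans ?_
    gcongr
  rcases hab.eq_or_lt with rfl | hlt
  · simp [hJ]
  have hba : 0 < b - a := sub_pos.2 hlt
  have hJ0 : 0 ≤ J := abs_nonneg _
  clear_value J
  rcases hJ0.eq_or_lt with h0 | h0
  · rw [← h0]; positivity
  · have hk := key (J / (b - a)) (by positivity)
    rw [show N ^ 2 / (2 * (J / (b - a))) + J / (b - a) / 2 * (b - a) =
      (N ^ 2 * (b - a) / J + J) / 2 by field_simp] at hk
    have hk2 : J ≤ N ^ 2 * (b - a) / J := by linarith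
    rw [le_div_iff₀ h0] at hk2
    have : J ^ 2 ≤ (Real.sqrt (b - a) * N) ^ 2 := by
      rw [mul_pow, Real.sq_sqrt hba.le]; nlinarith
    exact (abs_le_of_sq_le_sq' this (by positivity)).2

/-- The shorter arc between two points, oriented so that its lift is increasing. -/
lemma exists_lift_le (x y : Torus) : ∃ a b : ℝ, ((a : Torus) = x ∧ (b : Torus) = y ∨
    (a : Torus) = y ∧ (b : Torus) = x) ∧ a ≤ b ∧ b ≤ a + 1 ∧ b - a = ‖x - y‖ := by
  obtain ⟨b0, rfl⟩ := exists_coe_eq y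
  obtain ⟨d, hd⟩ := exists_coe_eq (x - (b0 : Torus))
  have e : ((d - round d : ℝ) : Torus) = x - (b0 : Torus) := by
    rw [← hd, AddCircle.coe_sub, sub_eq_self]
    exact (AddCircle.coe_eq_zero_iff 1).2 ⟨round d, by simp⟩
  have hn : ‖x - (b0 : Torus)‖ = |d - round d| := by
    rw [← hd, AddCircle.norm_eq]; simp
  have hr := abs_sub_round d
  set r := d - round d
  have ex : x = ((b0 + r : ℝ) : Torus) := by
    rw [AddCircle.coe_add, e]; abel
  rcases le_total 0 r with h | h
  · refine ⟨b0, b0 + r, Or.inr ⟨rfl, ex.symm⟩, by linarith, ?_, ?_⟩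
    · rw [abs_of_nonneg h] at hr; linarith
    · rw [hn, abs_of_nonneg h]; ring
  · refine ⟨b0 + r, b0, Or.inl ⟨ex.symm, rfl⟩, by linarith, ?_, ?_⟩
    · rw [abs_of_nonpos h] at hr; linarith
    · rw [hn, abs_of_nonpos h]; ring

lemma HasTorusDeriv.abs_sub_le_sqrt {φ φ' : C(Torus, ℝ)} (h : HasTorusDeriv φ φ') (x y : Torus) :
    |φ x - φ y| ≤ Real.sqrt ‖x - y‖ * ‖toL2 φ'‖ := by
  obtain ⟨a, b, hab, h1, h2, h3⟩ := exists_lift_le x y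
  have := h.abs_sub_le h1 h2
  rw [h3] at this
  rcases hab with ⟨ha, hb⟩ | ⟨ha, hb⟩
  · rwa [ha, hb, abs_sub_comm] at this
  · rwa [ha, hb] at this

lemma norm_torus_le_one (x : Torus) : ‖x‖ ≤ 1 := by
  obtain ⟨x, rfl⟩ := exists_coe_eq x
  rw [AddCircle.norm_eq]
  have := abs_sub_round x
  simp only [inv_one, one_mul, mul_one]
  linarith

/-- The Sobolev inequality in one dimension. -/
lemma HasTorusDeriv.norm_le {φ φ' : C(Torus, ℝ)} (h : HasTorusDeriv φ φ') :
    ‖φ‖ ≤ ‖toL2 φ‖ + ‖toL2 φ'‖ := by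
  refine (ContinuousMap.norm_le _ (by positivity)).2 fun x => ?_
  have h1 : ∀ y, |φ x| ≤ |φ y| + ‖toL2 φ'‖ := fun y => by
    have h2 := h.abs_sub_le_sqrt x y
    have h3 : Real.sqrt ‖x - y‖ ≤ 1 := Real.sqrt_le_one.2 (norm_torus_le_one _)
    have h4 : Real.sqrt ‖x - y‖ * ‖toL2 φ'‖ ≤ 1 * ‖toL2 φ'‖ := by gcongr
    have h5 := abs_sub_abs_le_abs_sub (φ x) (φ y)
    linarith
  have h2 : ∫ _ : Torus, |φ x| ≤ ∫ y, (|φ y| + ‖toL2 φ'‖) :=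
    integral_mono (integrable_const _) (Continuous.integrable_torus (by fun_prop)) h1
  rw [integral_add (Continuous.integrable_torus (by fun_prop)) (integrable_const _)] at h2
  simp only [integral_const, probReal_univ, one_smul] at h2
  have h3 : ∫ y, |φ y| ≤ ‖toL2 φ‖ := by
    refine le_trans (le_of_eq (integral_congr_ae ?_)) (integral_abs_le_norm (toL2 φ))
    filter_upwards [coeFn_toL2 φ] with y hy
    rw [hy]
  rw [Real.norm_eq_abs]
  linarith

lemma HasTorusDeriv.integral_eq_zero {φ φ' : Torus → ℝ} (h : HasTorusDeriv φ φ')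
    (hφ' : Continuous φ') : ∫ x, φ' x = 0 := by
  have hc : Continuous fun x : ℝ => φ' (x : Torus) := hφ'.comp (AddCircle.continuous_mk' 1)
  rw [integral_torus_eq, intervalIntegral.integral_eq_sub_of_hasDerivAt (fun x _ => h x)
    (hc.intervalIntegrable _ _), sub_eq_zero]
  congr 1
  exact AddCircle.coe_period 1

/-! ### Weak derivatives -/

/-- `f'` is the weak derivative of `f`, tested against continuously differentiable functions. -/
def WeakPair (f f' : L2) : Prop := ∀ φ φ' : C(Torus, ℝ), HasTorusDeriv φ φ' →
  inner ℝ f (toL2 φ') = - inner ℝ f' (toL2 φ)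

lemma HasTorusDeriv.weakPair {φ φ' : C(Torus, ℝ)} (h : HasTorusDeriv φ φ') :
    WeakPair (toL2 φ) (toL2 φ') := by
  intro ψ ψ' hψ
  have e1 : ∀ a b : C(Torus, ℝ), inner ℝ (toL2 a) (toL2 b) = ∫ x, a x * b x := fun a b => by
    rw [inner_toL2]
    refine integral_congr_ae ?_
    filter_upwards [coeFn_toL2 a] with x hx
    rw [hx]
  have := (h.mul hψ).integral_eq_zero (by fun_prop)
  rw [integral_add (Continuous.integrable_torus (by fun_prop))
    (Continuous.integrable_torus (by fun_prop))] at this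
  rw [e1, e1]
  linarith

/-- The heat semigroup applied to an element of `L²`, as a continuous function. -/
def heatC (t : ℝ) (f : L2) : C(Torus, ℝ) :=
  if ht : 0 < t then ⟨fun x => ∫ y, heat t (x - y) * f y,
    continuous_conv (continuous_heat ht) (integrable_coeFn f)⟩ else 0

lemma heatC_apply {t : ℝ} (ht : 0 < t) (f : L2) (x : Torus) :
    heatC t f x = ∫ y, heat t (x - y) * f y := by
  rw [heatC, dif_pos ht]; rfl

lemma toL2_heatC {t : ℝ} (ht : 0 < t) (f : L2) : toL2 (heatC t f) = heatOp t f := by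
  refine Lp.ext ?_
  filter_upwards [coeFn_toL2 (heatC t f), heatOp_coeFn ht f] with x h1 h2
  rw [h1, h2, heatC_apply ht]

lemma hasTorusDeriv_heatC_of {t : ℝ} (ht : 0 < t) {f f' : L2}
    (h : ∀ x : Torus, ∫ y, heatD t (x - y) * f y = ∫ y, heat t (x - y) * f' y) :
    HasTorusDeriv (heatC t f) (heatC t f') := by
  have h1 := hasTorusDeriv_conv (hasTorusDeriv_heat ht) (continuous_heatD ht) (integrable_coeFn f)
  have e1 : (heatC t f : Torus → ℝ) = fun x => ∫ y, heat t (x - y) * f y :=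
    funext fun x => heatC_apply ht f x
  have e2 : (heatC t f' : Torus → ℝ) = fun x => ∫ y, heatD t (x - y) * f y :=
    funext fun x => by rw [heatC_apply ht, h x]
  rw [e1, e2]
  exact h1

/-- The function y ↦ heat t (x − y) is an admissible test function, so convolution commutes with
weak differentiation. -/
lemma IsWeakDeriv.hasTorusDeriv_heatC {f f' : L2} (h : IsWeakDeriv f f') {t : ℝ} (ht : 0 < t) :
    HasTorusDeriv (heatC t f) (heatC t f') := by
  refine hasTorusDeriv_heatC_of ht fun x => ?_
  obtain ⟨x, rfl⟩ := exists_coe_eq x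
  have hd : ∀ y : ℝ, HasDerivAt (fun y : ℝ => heat t ((x : Torus) - y))
      (-heatD t ((x : Torus) - y)) y := fun y => (hasTorusDeriv_heat ht).comp_const_sub x y
  have := h (fun y : ℝ => heat t ((x : Torus) - y)) ((contDiff_heat ht).comp
    (contDiff_const.sub contDiff_id : ContDiff ℝ _ fun y : ℝ => x - y)) fun y => by
      simp only [AddCircle.coe_add, AddCircle.coe_period, add_zero]
  rw [show deriv (fun y : ℝ => heat t ((x : Torus) - y)) = fun y : ℝ => -heatD t ((x : Torus) - y)
    from funext fun y => (hd y).deriv] at this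
  rw [integral_torus_eq, integral_torus_eq]
  simp only [mul_neg, intervalIntegral.integral_neg, neg_inj] at this
  simp only [mul_comm (heatD t _), mul_comm (heat t _)]
  exact this

lemma WeakPair.of_tendsto {ι : Type*} {l : Filter ι} [l.NeBot] {f f' : L2} {F F' : ι → L2}
    (hF : Tendsto F l (𝓝 f)) (hF' : Tendsto F' l (𝓝 f')) (h : ∀ᶠ i in l, WeakPair (F i) (F' i)) :
    WeakPair f f' := fun φ φ' hφ =>
  tendsto_nhds_unique_of_eventuallyEq (hF.inner tendsto_const_nhds)
    (hF'.inner tendsto_const_nhds).neg (h.mono fun _ hi => hi φ φ' hφ)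

/-- To enlarge the tests from smooth to C¹, mollify f and f' by the heat flow, where integration by
parts is classical, and let the time tend to 0. -/
lemma isWeakDeriv_iff {f f' : L2} : IsWeakDeriv f f' ↔ WeakPair f f' := by
  constructor
  · intro h
    refine WeakPair.of_tendsto (tendsto_heatOp f) (tendsto_heatOp f') ?_
    filter_upwards [self_mem_nhdsWithin] with t ht
    rw [← toL2_heatC ht, ← toL2_heatC ht]
    exact (h.hasTorusDeriv_heatC ht).weakPair
  · intro h φ hφ hp
    have hp' : Function.Periodic (deriv φ) 1 := fun x => by
      rw [← deriv_comp_add_const, show (fun y => φ (y + 1)) = φ from funext hp]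
    have c1 : Continuous (Function.Periodic.lift hp : Torus → ℝ) :=
      continuous_of_comp_coe hφ.continuous
    have c2 : Continuous (Function.Periodic.lift hp' : Torus → ℝ) :=
      continuous_of_comp_coe (hφ.continuous_deriv (by simp))
    have := h ⟨_, c1⟩ ⟨_, c2⟩ fun x => (hφ.differentiable (by simp) x).hasDerivAt
    rw [inner_toL2, inner_toL2, integral_torus_eq, integral_torus_eq] at this
    exact this

lemma WeakPair.hasTorusDeriv_heatC {f f' : L2} (h : WeakPair f f') {t : ℝ} (ht : 0 < t) :
    HasTorusDeriv (heatC t f) (heatC t f') :=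
  (isWeakDeriv_iff.2 h).hasTorusDeriv_heatC ht

/-- The heat flow of u is a C¹ function converging to u; testing with it gives ⟨u, u⟩ = 0. -/
lemma eq_zero_of_forall_inner {u : L2}
    (h : ∀ φ φ' : C(Torus, ℝ), HasTorusDeriv φ φ' → inner ℝ u (toL2 φ) = 0) : u = 0 := by
  refine inner_self_eq_zero (𝕜 := ℝ) |>.1 ?_
  refine tendsto_nhds_unique_of_eventuallyEq (tendsto_const_nhds.inner (tendsto_heatOp u))
    tendsto_const_nhds ?_
  filter_upwards [self_mem_nhdsWithin] with t ht
  have ht' : 0 < t := ht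
  rw [← toL2_heatC ht']
  have h1 := hasTorusDeriv_conv (hasTorusDeriv_heat ht') (continuous_heatD ht') (integrable_coeFn u)
  have e1 : (heatC t u : Torus → ℝ) = fun x => ∫ y, heat t (x - y) * u y :=
    funext fun x => heatC_apply ht' u x
  refine h (heatC t u) ⟨_, continuous_conv (continuous_heatD ht') (integrable_coeFn u)⟩ ?_
  rw [e1]
  exact h1

lemma WeakPair.unique {f f' f'' : L2} (h : WeakPair f f') (h2 : WeakPair f f'') : f' = f'' := by
  refine sub_eq_zero.1 (eq_zero_of_forall_inner fun φ φ' hφ => ?_)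
  rw [inner_sub_left]
  linarith [h φ φ' hφ, h2 φ φ' hφ]

lemma WeakPair.weakDeriv_eq {f f' : L2} (h : WeakPair f f') : weakDeriv f = f' := by
  have hm : MemH1 f := ⟨f', isWeakDeriv_iff.2 h⟩
  rw [weakDeriv, dif_pos hm]
  exact (isWeakDeriv_iff.1 hm.choose_spec).unique h

lemma memH1_iff {f : L2} : MemH1 f ↔ ∃ f', WeakPair f f' := by
  simp only [MemH1, isWeakDeriv_iff]

/-- Elements of `H¹` have Hölder continuous representatives, which their heat flows approach
uniformly. -/
lemma WeakPair.exists_rep {f f' : L2} (h : WeakPair f f') : ∃ F : C(Torus, ℝ), toL2 F = f ∧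
    Tendsto (fun t => heatC t f) (𝓝[>] 0) (𝓝 F) ∧ ‖F‖ ≤ ‖f‖ + ‖f'‖ ∧
    ∀ x y, |F x - F y| ≤ Real.sqrt ‖x - y‖ * ‖f'‖ := by
  -- The Sobolev inequality for differences of heat flows turns L² convergence of f and f' into
  -- uniform convergence.
  have hc : Cauchy (map (fun t => heatC t f) (𝓝[>] 0)) := by
    rw [Metric.cauchy_iff]
    refine ⟨inferInstance, fun ε hε => ?_⟩
    have h1 := (Metric.tendsto_nhds.1 (tendsto_heatOp f)) (ε / 4) (by positivity)
    have h2 := (Metric.tendsto_nhds.1 (tendsto_heatOp f')) (ε / 4) (by positivity)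
    have h3 := (h1.and h2).and self_mem_nhdsWithin
    refine ⟨_, image_mem_map h3, ?_⟩
    rintro _ ⟨t, ⟨⟨a1, a2⟩, a3⟩, rfl⟩ _ ⟨s, ⟨⟨b1, b2⟩, b3⟩, rfl⟩
    have a3' : 0 < t := a3
    have b3' : 0 < s := b3
    have hd : HasTorusDeriv (heatC t f - heatC s f : C(Torus, ℝ))
      (heatC t f' - heatC s f' : C(Torus, ℝ)) := fun x =>
        (h.hasTorusDeriv_heatC a3' x).sub (h.hasTorusDeriv_heatC b3' x)
    have := hd.norm_le
    rw [map_sub, map_sub, toL2_heatC a3', toL2_heatC a3', toL2_heatC b3', toL2_heatC b3',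
      ← dist_eq_norm, ← dist_eq_norm, ← dist_eq_norm] at this
    have c1 := dist_triangle_right (heatOp t f) (heatOp s f) f
    have c2 := dist_triangle_right (heatOp t f') (heatOp s f') f'
    linarith
  obtain ⟨F, hF⟩ := cauchy_map_iff_exists_tendsto.1 hc
  have hcoe : ∀ x, Tendsto (fun t => heatC t f x) (𝓝[>] 0) (𝓝 (F x)) := fun x =>
    ((ContinuousEvalConst.continuous_eval_const x).tendsto F).comp hF
  refine ⟨F, ?_, hF, ?_, fun x y => ?_⟩
  · refine tendsto_nhds_unique_of_eventuallyEq ((toL2.continuous.tendsto F).comp hF)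
      (tendsto_heatOp f) ?_
    filter_upwards [self_mem_nhdsWithin] with t ht using toL2_heatC ht f
  · refine le_of_tendsto hF.norm ?_
    filter_upwards [self_mem_nhdsWithin] with t ht
    have ht' : 0 < t := ht
    refine (h.hasTorusDeriv_heatC ht').norm_le.trans ?_
    rw [toL2_heatC ht', toL2_heatC ht']
    exact add_le_add (norm_heatOp_apply_le ht' _) (norm_heatOp_apply_le ht' _)
  · refine le_of_tendsto ((hcoe x).sub (hcoe y)).abs ?_
    filter_upwards [self_mem_nhdsWithin] with t ht
    have ht' : 0 < t := ht
    refine ((h.hasTorusDeriv_heatC ht').abs_sub_le_sqrt x y).trans ?_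
    rw [toL2_heatC ht']
    have := norm_heatOp_apply_le ht' f'
    gcongr

/-- The chosen continuous representative is F itself, because continuous functions inject into L².
-/
lemma pointValue_toL2 (F : C(Torus, ℝ)) (x : Torus) : pointValue (toL2 F) x = F x := by
  have h : ∃ G : C(Torus, ℝ), (G : Torus → ℝ) =ᵐ[volume] toL2 F := ⟨F, (coeFn_toL2 F).symm⟩
  rw [pointValue, dif_pos h]
  have : h.choose = F := toL2_injective (Lp.ext ((coeFn_toL2 _).trans h.choose_spec))
  rw [this]

/-! ### Multiplication operators -/

lemma exists_mul_operator {m : Torus → ℝ} (hm : Measurable m) {M : ℝ} (hM : ∀ x, |m x| ≤ M) :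
    ∃ S : L2 →L[ℝ] L2, ‖S‖ ≤ M ∧ ∀ f g : L2, inner ℝ (S f) g = ∫ x, f x * g x * m x := by
  have hM0 : 0 ≤ M := (abs_nonneg _).trans (hM 0)
  have hL : ∀ f : L2, MemLp (fun x => m x * f x) 2 := fun f =>
    (Lp.memLp f).of_le_mul (c := M) (hm.mul (Lp.stronglyMeasurable f).measurable).aestronglyMeasurable
      (Eventually.of_forall fun x => by
        rw [norm_mul]; exact mul_le_mul_of_nonneg_right (hM x) (norm_nonneg _))
  let L : L2 →ₗ[ℝ] L2 :=
    { toFun := fun f => (hL f).toLp _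
      map_add' := fun f g => by
        rw [← MemLp.toLp_add]
        refine (MemLp.toLp_eq_toLp_iff _ _).2 ?_
        filter_upwards [Lp.coeFn_add f g] with y hy
        rw [hy, Pi.add_apply, Pi.add_apply, mul_add]
      map_smul' := fun c f => by
        rw [RingHom.id_apply, ← MemLp.toLp_const_smul]
        refine (MemLp.toLp_eq_toLp_iff _ _).2 ?_
        filter_upwards [Lp.coeFn_smul c f] with y hy
        rw [hy, Pi.smul_apply, Pi.smul_apply, smul_eq_mul, smul_eq_mul]; ring }
  have hLf : ∀ f, L f =ᵐ[volume] fun x => m x * f x := fun f => MemLp.coeFn_toLp (hL f)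
  have hb : ∀ f, ‖L f‖ ≤ M * ‖f‖ := fun f => by
    refine Lp.norm_le_mul_norm_of_ae_le_mul ?_
    filter_upwards [hLf f] with x hx
    rw [hx, norm_mul]
    exact mul_le_mul_of_nonneg_right (hM x) (norm_nonneg _)
  refine ⟨L.mkContinuous M hb, L.mkContinuous_norm_le hM0 hb, fun f g => ?_⟩
  rw [inner_eq_integral]
  refine integral_congr_ae ?_
  filter_upwards [hLf f] with x hx
  rw [LinearMap.mkContinuous_apply, hx]; ring

end RoughTorus
end

/-! ### The quadratic form on the circle and the compact embedding of H¹. -/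

noncomputable section

namespace RoughTorus

variable {C α : ℝ} {κ : ℝ} {ρ : Torus → ℝ} {R : ℝ → ℝ}

/-! ### The quadratic form -/

lemma measurable_rep : Measurable rep :=
  measurable_subtype_coe.comp (AddCircle.measurableEquivIco (1 : ℝ) 0).measurable

lemma abs_rep_le (x : Torus) : |rep x| ≤ 1 := by
  have := rep_mem x
  rw [abs_of_nonneg this.1]; exact this.2.le

/-- The quadratic form, with the boundary term absorbed in the periodic part of the potential. -/
def torusForm (κ : ℝ) (ρ : Torus → ℝ) (f f' g g' : L2) : ℝ :=
  1 / 2 * inner ℝ f' g' - κ * inner ℝ f g + ∫ x, (f' x * g x + f x * g' x) * ρ x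

lemma integrable_form_integrand {m : Torus → ℝ} (hm : Measurable m) {M : ℝ} (hM : ∀ x, |m x| ≤ M)
    (f f' g g' : L2) : Integrable fun x => (f' x * g x + f x * g' x) * m x := by
  simpa only [mul_comm _ (m _), Pi.add_apply] using
    integrable_bdd_mul hm hM ((integrable_coeFn_mul f' g).add (integrable_coeFn_mul f g'))

lemma integral_form_integrand {m : Torus → ℝ} {S : L2 →L[ℝ] L2}
    (hm : Measurable m) {M : ℝ} (hM : ∀ x, |m x| ≤ M)
    (hS : ∀ f g : L2, inner ℝ (S f) g = ∫ x, f x * g x * m x) (f f' g g' : L2) :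
    ∫ x, (f' x * g x + f x * g' x) * m x = inner ℝ (S f') g + inner ℝ (S f) g' := by
  rw [hS, hS, ← integral_add]
  · simp only [add_mul]
  · simpa only [mul_comm _ (m _)] using integrable_bdd_mul hm hM (integrable_coeFn_mul f' g)
  · simpa only [mul_comm _ (m _)] using integrable_bdd_mul hm hM (integrable_coeFn_mul f g')

/-- The sawtooth `rep` has distributional derivative 1 minus a Dirac mass at 0. -/
lemma integral_deriv_mul_rep {φ φ' : C(Torus, ℝ)} (h : HasTorusDeriv φ φ') :
    ∫ x, φ' x * rep x = φ ((1 : ℝ) : Torus) - ∫ x, φ x := by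
  have hc : Continuous fun x : ℝ => φ (x : Torus) := φ.continuous.comp (AddCircle.continuous_mk' 1)
  have hc' : Continuous fun x : ℝ => φ' (x : Torus) := φ'.continuous.comp (AddCircle.continuous_mk' 1)
  rw [integral_torus_eq, integral_torus_eq φ]
  have e : ∫ x in (0 : ℝ)..1, φ' (x : Torus) * rep (x : Torus) = ∫ x in (0 : ℝ)..1, φ' (x : Torus) * x :=
    intervalIntegral_congr_Ioo fun x hx => by rw [rep_coe ⟨hx.1.le, hx.2⟩]
  rw [e, intervalIntegral.integral_congr (g := fun x : ℝ => (φ' (x : Torus) * x + φ (x : Torus) * 1) -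
    φ (x : Torus)) (fun x _ => by simp), intervalIntegral.integral_sub
    (Continuous.intervalIntegrable (by fun_prop) _ _) (hc.intervalIntegrable _ _),
    intervalIntegral.integral_deriv_mul_eq_sub (u := fun x : ℝ => φ (x : Torus)) (v := fun x : ℝ => x)
    (fun x _ => h x) (fun x _ => hasDerivAt_id' x) (hc'.intervalIntegrable _ _)
    intervalIntegrable_const]
  simp

/-- The preceding identity for the product fg. It holds for the heat flows by the classical product
rule and passes to the limit, in L² for the integrals and uniformly for the point values. -/
lemma WeakPair.integral_mul_rep {f f' g g' : L2} (hf : WeakPair f f') (hg : WeakPair g g')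
    {F G : C(Torus, ℝ)} (hF : Tendsto (fun t => heatC t f) (𝓝[>] 0) (𝓝 F))
    (hG : Tendsto (fun t => heatC t g) (𝓝[>] 0) (𝓝 G)) :
    ∫ x, (f' x * g x + f x * g' x) * rep x =
      F ((1 : ℝ) : Torus) * G ((1 : ℝ) : Torus) - inner ℝ f g := by
  obtain ⟨S, -, hS⟩ := exists_mul_operator measurable_rep abs_rep_le
  rw [integral_form_integrand measurable_rep abs_rep_le hS]
  have hcoe : ∀ {h : L2} {H : C(Torus, ℝ)}, Tendsto (fun t => heatC t h) (𝓝[>] 0) (𝓝 H) →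
      ∀ x, Tendsto (fun t => heatC t h x) (𝓝[>] 0) (𝓝 (H x)) := fun {_ H} hH x =>
    ((ContinuousEvalConst.continuous_eval_const x).tendsto H).comp hH
  have hSt : ∀ h, Tendsto (fun t => S (heatOp t h)) (𝓝[>] 0) (𝓝 (S h)) := fun h =>
    (S.continuous.tendsto h).comp (tendsto_heatOp h)
  refine tendsto_nhds_unique_of_eventuallyEq
    (((hSt f').inner (tendsto_heatOp g)).add ((hSt f).inner (tendsto_heatOp g')))
    (((hcoe hF _).mul (hcoe hG _)).sub ((tendsto_heatOp f).inner (tendsto_heatOp g))) ?_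
  filter_upwards [self_mem_nhdsWithin] with t ht
  have ht' : 0 < t := ht
  set a := heatC t f
  set a' := heatC t f'
  set b := heatC t g
  set b' := heatC t g'
  have ha : HasTorusDeriv a a' := hf.hasTorusDeriv_heatC ht'
  have hb : HasTorusDeriv b b' := hg.hasTorusDeriv_heatC ht'
  have hab : HasTorusDeriv (a * b : C(Torus, ℝ)) (a' * b + a * b' : C(Torus, ℝ)) := ha.mul hb
  have key := integral_deriv_mul_rep hab
  rw [← integral_form_integrand measurable_rep abs_rep_le hS, ← toL2_heatC ht', ← toL2_heatC ht',
    ← toL2_heatC ht', ← toL2_heatC ht', inner_eq_integral]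
  have e1 : ∫ x, (toL2 a' x * toL2 b x + toL2 a x * toL2 b' x) * rep x =
      ∫ x, (a' * b + a * b' : C(Torus, ℝ)) x * rep x := by
    refine integral_congr_ae ?_
    filter_upwards [coeFn_toL2 a, coeFn_toL2 a', coeFn_toL2 b, coeFn_toL2 b'] with x h1 h2 h3 h4
    rw [h1, h2, h3, h4]; rfl
  have e2 : ∫ x, toL2 a x * toL2 b x = ∫ x, (a * b : C(Torus, ℝ)) x := by
    refine integral_congr_ae ?_
    filter_upwards [coeFn_toL2 a, coeFn_toL2 b] with x h1 h2
    rw [h1, h2]; rfl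
  rw [e1, e2, key]; rfl

/-- On (0,1), R is ρ plus κ times the sawtooth. The point mass of the sawtooth cancels the boundary
term f(1)g(1)κ and leaves −κ⟨f, g⟩. -/
lemma form_eq_torusForm (hρ : Continuous (periodicPart R)) {f f' g g' : L2} (hf : WeakPair f f')
    (hg : WeakPair g g') : form R f g = torusForm (R 1 - R 0) (periodicPart R) f f' g g' := by
  obtain ⟨F, hF, hFt, -⟩ := hf.exists_rep
  obtain ⟨G, hG, hGt, -⟩ := hg.exists_rep
  have e1 : pointValue f ((1 : ℝ) : Torus) = F ((1 : ℝ) : Torus) := by rw [← hF, pointValue_toL2]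
  have e2 : pointValue g ((1 : ℝ) : Torus) = G ((1 : ℝ) : Torus) := by rw [← hG, pointValue_toL2]
  obtain ⟨M, -, hM⟩ := exists_bound_of_continuous hρ
  have key := hf.integral_mul_rep hg hFt hGt
  have e3 : ∫ x in (0 : ℝ)..1, (f' (x : Torus) * g (x : Torus) + f (x : Torus) * g' (x : Torus)) * R x =
      (∫ x, (f' x * g x + f x * g' x) * periodicPart R x) +
        (R 1 - R 0) * ∫ x, (f' x * g x + f x * g' x) * rep x := by
    rw [← integral_const_mul, ← integral_add (integrable_form_integrand hρ.measurable hM _ _ _ _)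
      ((integrable_form_integrand measurable_rep abs_rep_le _ _ _ _).const_mul _), integral_torus_eq]
    refine intervalIntegral_congr_Ioo fun x hx => ?_
    rw [periodicPart, rep_coe ⟨hx.1.le, hx.2⟩]
    ring
  rw [form, torusForm, hf.weakDeriv_eq, hg.weakDeriv_eq, e1, e2, e3, key, inner_eq_integral f' g']
  ring

/-! ### The Sobolev space as a Hilbert space -/

/-- The Sobolev space `H¹`, as a space of pairs. -/
def sobolev : Submodule ℝ (WithLp 2 (L2 × L2)) where
  carrier := {p | WeakPair p.fst p.snd}
  add_mem' := fun {p q} hp hq φ φ' h => by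
    have h1 := hp φ φ' h
    have h2 := hq φ φ' h
    simp only [WithLp.add_fst, WithLp.add_snd, inner_add_left]
    linarith
  zero_mem' := fun φ φ' _ => by simp
  smul_mem' := fun c p hp φ φ' h => by
    have h1 := hp φ φ' h
    simp only [WithLp.smul_fst, WithLp.smul_snd, inner_smul_left, h1]
    simp

lemma isClosed_sobolev : IsClosed (sobolev : Set (WithLp 2 (L2 × L2))) := by
  have e : (sobolev : Set (WithLp 2 (L2 × L2))) = ⋂ (φ : C(Torus, ℝ)) (φ' : C(Torus, ℝ))
      (_ : HasTorusDeriv φ φ'), {p | inner ℝ p.fst (toL2 φ') = - inner ℝ p.snd (toL2 φ)} := by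
    ext p; simp only [mem_iInter]; rfl
  rw [e]
  have c1 : Continuous fun p : WithLp 2 (L2 × L2) => p.fst := (WithLp.fstL 2 ℝ L2 L2).continuous
  have c2 : Continuous fun p : WithLp 2 (L2 × L2) => p.snd := (WithLp.sndL 2 ℝ L2 L2).continuous
  exact isClosed_iInter fun φ => isClosed_iInter fun φ' => isClosed_iInter fun _ =>
    isClosed_eq (c1.inner continuous_const) (c2.inner continuous_const).neg

instance : CompleteSpace sobolev := isClosed_sobolev.completeSpace_coe

/-- The inclusion of `H¹` in `L²`. -/
def sobolevFst : sobolev →L[ℝ] L2 := (WithLp.fstL 2 ℝ L2 L2).comp sobolev.subtypeL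

/-- The weak derivative, as a bounded operator on `H¹`. -/
def sobolevSnd : sobolev →L[ℝ] L2 := (WithLp.sndL 2 ℝ L2 L2).comp sobolev.subtypeL

lemma weakPair_sobolev (v : sobolev) : WeakPair (sobolevFst v) (sobolevSnd v) := v.2

lemma exists_sobolev {f f' : L2} (h : WeakPair f f') :
    ∃ v : sobolev, sobolevFst v = f ∧ sobolevSnd v = f' :=
  ⟨⟨WithLp.toLp 2 (f, f'), h⟩, rfl, rfl⟩

lemma norm_sq_sobolev (v : sobolev) : ‖v‖ ^ 2 = ‖sobolevFst v‖ ^ 2 + ‖sobolevSnd v‖ ^ 2 :=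
  WithLp.prod_norm_sq_eq_of_L2 (v : WithLp 2 (L2 × L2))

lemma sobolev_eq_zero {v : sobolev} (h : sobolevFst v = 0) : v = 0 := by
  have h1 := weakPair_sobolev v
  rw [h] at h1
  have h2 : WeakPair (0 : L2) 0 := fun φ φ' _ => by simp
  have h3 := norm_sq_sobolev v
  rw [h, h1.unique h2] at h3
  simpa using h3

/-- Arzelà–Ascoli. Equicontinuity comes from the common modulus; a pointwise limit keeps this
modulus and is therefore continuous, which closes the set in the compact product. -/
lemma isCompact_hoelder (M : ℝ) :
    IsCompact {φ : C(Torus, ℝ) | (∀ x, |φ x| ≤ M) ∧ ∀ x y, |φ x - φ y| ≤ Real.sqrt ‖x - y‖ * M} := by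
  set S := {φ : C(Torus, ℝ) | (∀ x, |φ x| ≤ M) ∧ ∀ x y, |φ x - φ y| ≤ Real.sqrt ‖x - y‖ * M}
  have hsq : ∀ x : Torus, Tendsto (fun y : Torus => Real.sqrt ‖x - y‖ * M) (𝓝 x) (𝓝 0) := fun x => by
    have : Continuous fun y : Torus => Real.sqrt ‖x - y‖ * M := by fun_prop
    simpa using this.tendsto x
  refine ArzelaAscoli.isCompact_of_equicontinuous S ?_ ?_
  · have e : ContinuousMap.toFun '' S = Set.pi univ (fun _ => Icc (-M) M) ∩
        ⋂ (x : Torus) (y : Torus), {f : Torus → ℝ | |f x - f y| ≤ Real.sqrt ‖x - y‖ * M} := by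
      ext f
      simp only [mem_inter_iff, mem_iInter, mem_image, Set.mem_pi]
      constructor
      · rintro ⟨φ, ⟨h1, h2⟩, rfl⟩
        exact ⟨fun x _ => abs_le.1 (h1 x), h2⟩
      · rintro ⟨h1, h2⟩
        refine ⟨⟨f, continuous_iff_continuousAt.2 fun x => ?_⟩, ⟨fun x => abs_le.2 (h1 x (mem_univ x)), h2⟩, rfl⟩
        refine tendsto_iff_dist_tendsto_zero.2 (squeeze_zero (fun _ => dist_nonneg) (fun y => ?_) (hsq x))
        rw [dist_comm, Real.dist_eq]
        exact h2 x y
    rw [e]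
    refine (isCompact_univ_pi fun _ => isCompact_Icc).inter_right ?_
    exact isClosed_iInter fun x => isClosed_iInter fun y => isClosed_le
      ((continuous_apply x).sub (continuous_apply y)).abs continuous_const
  · refine fun x => Metric.equicontinuousAt_iff_right.2 fun ε hε => ?_
    filter_upwards [(hsq x).eventually (gt_mem_nhds hε)] with y hy φ
    rw [Real.dist_eq]
    exact (φ.2.2 x y).trans_lt hy

/-- Rellich's theorem: the unit ball of H¹ consists of 1/2-Hölder functions bounded by ‖f‖ + ‖f'‖ ≤
2. -/
lemma isCompactOperator_sobolevFst : IsCompactOperator sobolevFst := by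
  refine (isCompactOperator_iff_image_closedBall_subset_compact
    (sobolevFst : sobolev →ₗ[ℝ] L2) one_pos).2
    ⟨_, (isCompact_hoelder 2).image toL2.continuous, ?_⟩
  rintro _ ⟨v, hv, rfl⟩
  have hv1 : ‖v‖ ≤ 1 := by simpa using hv
  have h2 := norm_sq_sobolev v
  have h3 : ‖v‖ ^ 2 ≤ 1 := by have := norm_nonneg v; nlinarith
  have h4 : ‖sobolevFst v‖ ≤ 1 := by
    have := sq_nonneg ‖sobolevSnd v‖
    exact (abs_le_of_sq_le_sq' (by linarith : ‖sobolevFst v‖ ^ 2 ≤ 1 ^ 2) (by norm_num)).2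
  have h5 : ‖sobolevSnd v‖ ≤ 1 := by
    have := sq_nonneg ‖sobolevFst v‖
    exact (abs_le_of_sq_le_sq' (by linarith : ‖sobolevSnd v‖ ^ 2 ≤ 1 ^ 2) (by norm_num)).2
  obtain ⟨F, hF, -, hF1, hF2⟩ := (weakPair_sobolev v).exists_rep
  refine ⟨F, ⟨fun x => (F.norm_coe_le_norm x).trans (by linarith), fun x y => (hF2 x y).trans ?_⟩, hF⟩
  gcongr
  linarith

end RoughTorus
end

/-! ### Resolvent, self-adjointness and totality of the eigenvectors. -/

noncomputable section

namespace RoughTorus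

variable {C α : ℝ} {κ : ℝ} {ρ : Torus → ℝ} {R : ℝ → ℝ}

/-! ### The resolvent -/

section LaxMilgram

variable {E V : Type*} [NormedAddCommGroup E] [InnerProductSpace ℝ E] [CompleteSpace E]
  [NormedAddCommGroup V] [InnerProductSpace ℝ V] [CompleteSpace V]

/-- Lax–Milgram: the functional w ↦ ⟨f, ιw⟩ is represented by the adjoint of ι at f, and the
isomorphism given by B is inverted on it. -/
lemma exists_solution_operator (ι : V →L[ℝ] E) {B : V →L[ℝ] V →L[ℝ] ℝ} (hB : IsCoercive B) :
    ∃ T : E →L[ℝ] V, ∀ f v, T f = v ↔ ∀ w, B v w = inner ℝ f (ι w) := by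
  refine ⟨(hB.continuousLinearEquivOfBilin.symm : V →L[ℝ] V).comp (ContinuousLinearMap.adjoint ι),
    fun f v => ?_⟩
  rw [ContinuousLinearMap.comp_apply]
  change hB.continuousLinearEquivOfBilin.symm _ = v ↔ _
  rw [ContinuousLinearEquiv.symm_apply_eq]
  constructor
  · intro h w
    rw [← hB.continuousLinearEquivOfBilin_apply, ← h, ContinuousLinearMap.adjoint_inner_left]
  · intro h
    refine hB.unique_continuousLinearEquivOfBilin fun w => ?_
    rw [h, ContinuousLinearMap.adjoint_inner_left]

end LaxMilgram

lemma torusForm_comm (f f' g g' : L2) : torusForm κ ρ f f' g g' = torusForm κ ρ g g' f f' := by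
  rw [torusForm, torusForm, real_inner_comm, real_inner_comm f g]
  congr 1
  exact integral_congr_ae (Eventually.of_forall fun x => by simp only; ring)

/-- The resolvent of the form operator at a large point `lam`. -/
theorem exists_resolvent (hρ : Continuous ρ) (κ : ℝ) : ∃ (lam : ℝ) (T : L2 →L[ℝ] L2),
    T.IsSymmetric ∧ IsCompactOperator T ∧ Function.Injective T ∧
    ∀ f w, T (lam • f - w) = f ↔ ∃ f', WeakPair f f' ∧ ∀ g g', WeakPair g g' →
      torusForm κ ρ f f' g g' = - inner ℝ w g := by
  obtain ⟨M, hM0, hM⟩ := exists_bound_of_continuous hρ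
  obtain ⟨N, hN, hNi⟩ := exists_mul_operator hρ.measurable hM
  -- The mixed terms are at most 2M‖f‖‖f'‖ ≤ ‖f'‖²/4 + 4M²‖f‖²; this shift absorbs them together
  -- with κ and leaves coercivity constant 1/4.
  set lam := |κ| + 4 * M ^ 2 + 1 with hlam
  let I : L2 →L[ℝ] L2 →L[ℝ] ℝ := (isBoundedBilinearMap_inner (𝕜 := ℝ) (E := L2)).toContinuousLinearMap
  have hI : ∀ f g, I f g = inner ℝ f g := fun f g => rfl
  let B : sobolev →L[ℝ] sobolev →L[ℝ] ℝ := (1 / 2 : ℝ) • I.bilinearComp sobolevSnd sobolevSnd +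
    (lam - κ) • I.bilinearComp sobolevFst sobolevFst +
    I.bilinearComp (N.comp sobolevSnd) sobolevFst + I.bilinearComp (N.comp sobolevFst) sobolevSnd
  have hB : ∀ v w, B v w = torusForm κ ρ (sobolevFst v) (sobolevSnd v) (sobolevFst w) (sobolevSnd w) +
      lam * inner ℝ (sobolevFst v) (sobolevFst w) := by
    intro v w
    rw [torusForm, integral_form_integrand hρ.measurable hM hNi]
    simp only [B, _root_.add_apply, _root_.smul_apply, smul_eq_mul,
      ContinuousLinearMap.bilinearComp_apply, hI, ContinuousLinearMap.comp_apply]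
    ring
  have hco : IsCoercive B := by
    refine ⟨1 / 4, by norm_num, fun v => ?_⟩
    rw [hB, torusForm, integral_form_integrand hρ.measurable hM hNi]
    set f := sobolevFst v with hf
    set f' := sobolevSnd v with hf'
    have h1 : |inner ℝ (N f') f| ≤ M * ‖f'‖ * ‖f‖ :=
      (abs_real_inner_le_norm _ _).trans (by gcongr; exact N.le_of_opNorm_le hN f')
    have h2 : |inner ℝ (N f) f'| ≤ M * ‖f‖ * ‖f'‖ :=
      (abs_real_inner_le_norm _ _).trans (by gcongr; exact N.le_of_opNorm_le hN f)
    rw [mul_assoc, ← sq, norm_sq_sobolev, ← hf, ← hf', real_inner_self_eq_norm_sq,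
      real_inner_self_eq_norm_sq]
    have h3 := (abs_le.1 h1).1
    have h4 := (abs_le.1 h2).1
    have h5 := le_abs_self κ
    have h6 := sq_nonneg (‖f'‖ / 2 - 2 * M * ‖f‖)
    have h7 := sq_nonneg ‖f‖
    have h8 : κ * ‖f‖ ^ 2 ≤ |κ| * ‖f‖ ^ 2 := by gcongr
    rw [hlam]
    nlinarith
  obtain ⟨T, hT⟩ := exists_solution_operator sobolevFst hco
  have hTB : ∀ f w, B (T f) w = inner ℝ f (sobolevFst w) := fun f => (hT f (T f)).1 rfl
  have hBs : ∀ v w, B v w = B w v := fun v w => by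
    rw [hB, hB, torusForm_comm, real_inner_comm (sobolevFst v)]
  refine ⟨lam, sobolevFst.comp T, fun f g => ?_, isCompactOperator_sobolevFst.comp_clm T, ?_,
    fun f w => ?_⟩
  · change inner ℝ (sobolevFst (T f)) g = inner ℝ f (sobolevFst (T g))
    rw [← hTB f (T g), hBs, hTB, real_inner_comm]
  · refine (injective_iff_map_eq_zero _).2 fun f hf => ?_
    have h0 : T f = 0 := sobolev_eq_zero hf
    refine eq_zero_of_forall_inner fun φ φ' hφ => ?_
    obtain ⟨v, hv, -⟩ := exists_sobolev hφ.weakPair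
    rw [← hv, ← hTB f v, h0]
    simp
  -- The relation Hf = w is (lam − H)f = lam·f − w, so with T the inverse of lam − H it says T(lam·f
  -- − w) = f.
  · have e : ∀ g, inner ℝ (lam • f - w) g = lam * inner ℝ f g - inner ℝ w g := fun g => by
      rw [inner_sub_left, real_inner_smul_left]
    constructor
    · intro h
      refine ⟨sobolevSnd (T (lam • f - w)), ?_, fun g g' hg => ?_⟩
      · have := weakPair_sobolev (T (lam • f - w))
        rwa [show sobolevFst (T (lam • f - w)) = f from h] at this
      · obtain ⟨v, rfl, rfl⟩ := exists_sobolev hg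
        have := hTB (lam • f - w) v
        rw [hB, e, show sobolevFst (T (lam • f - w)) = f from h] at this
        linarith
    · rintro ⟨f', hf, h⟩
      obtain ⟨v, hv, hv'⟩ := exists_sobolev hf
      have : T (lam • f - w) = v := by
        rw [hT]
        intro u
        rw [hB, hv, hv', e, h _ _ (weakPair_sobolev u)]
        ring
      rw [ContinuousLinearMap.comp_apply, this, hv]

/-! ### The form operator and its eigenvectors -/

/-- The relation `H f = w` for the form operator. -/
def formGraph (κ : ℝ) (ρ : Torus → ℝ) (f w : L2) : Prop :=
  ∃ f', WeakPair f f' ∧ ∀ g g', WeakPair g g' → torusForm κ ρ f f' g g' = - inner ℝ w g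

lemma formGraph_iff (hρ : Continuous (periodicPart R)) (f w : L2) :
    formGraph (R 1 - R 0) (periodicPart R) f w ↔
      MemH1 f ∧ ∀ g : L2, MemH1 g → form R f g = - ∫ x : Torus, w x * g x := by
  constructor
  · rintro ⟨f', hf, h⟩
    refine ⟨memH1_iff.2 ⟨f', hf⟩, fun g hg => ?_⟩
    obtain ⟨g', hg⟩ := memH1_iff.1 hg
    rw [form_eq_torusForm hρ hf hg, h g g' hg, inner_eq_integral]
  · rintro ⟨hf, h⟩
    obtain ⟨f', hf⟩ := memH1_iff.1 hf
    refine ⟨f', hf, fun g g' hg => ?_⟩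
    rw [← form_eq_torusForm hρ hf hg, h g (memH1_iff.2 ⟨g', hg⟩), inner_eq_integral]

lemma dense_range_of_isSymmetric {E : Type*} [NormedAddCommGroup E] [InnerProductSpace ℝ E]
    [CompleteSpace E] {T : E →L[ℝ] E} (hT : T.IsSymmetric) (hi : Function.Injective T) :
    DenseRange T := by
  have h : T.rangeᗮ = ⊥ := by
    refine (Submodule.eq_bot_iff _).2 fun x hx => ?_
    refine (injective_iff_map_eq_zero T).1 hi x (inner_self_eq_zero (𝕜 := ℝ) |>.1 ?_)
    have := hx (T (T x)) ⟨T x, rfl⟩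
    rwa [show inner ℝ (T (T x)) x = inner ℝ (T x) (T x) from hT (T x) x] at this
  have h2 := (Submodule.topologicalClosure_eq_top_iff (K := T.range)).2 h
  exact (Submodule.dense_iff_topologicalClosure_eq_top (s := T.range)).2 h2

/-- The form operator is self-adjoint, and its eigenvectors are total. -/
theorem exists_form_operator (hρ : Continuous ρ) (κ : ℝ) : ∃ H : L2 →ₗ.[ℝ] L2,
    (∀ f w, (f, w) ∈ H.graph ↔ formGraph κ ρ f w) ∧ Dense (H.domain : Set L2) ∧ IsSelfAdjoint H ∧
    Dense (Submodule.span ℝ {e : L2 | ∃ μ : ℝ, formGraph κ ρ e (μ • e)} : Set L2) := by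
  obtain ⟨lam, T, hTs, hTc, hTi, hT⟩ := exists_resolvent hρ κ
  have hTr : DenseRange T := dense_range_of_isSymmetric hTs hTi
  -- The graph of lam − T⁻¹. Injectivity of T makes it single-valued, density of the range of T
  -- makes its domain dense.
  let G : Submodule ℝ (L2 × L2) := LinearMap.ker
    ((T : L2 →ₗ[ℝ] L2) ∘ₗ (lam • LinearMap.fst ℝ L2 L2 - LinearMap.snd ℝ L2 L2) - LinearMap.fst ℝ L2 L2)
  have hG : ∀ f w, (f, w) ∈ G ↔ T (lam • f - w) = f := fun f w => by
    rw [LinearMap.mem_ker]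
    exact sub_eq_zero
  have hG0 : ∀ x ∈ G, x.1 = 0 → x.2 = 0 := by
    rintro ⟨f, w⟩ hx (rfl : f = 0)
    rw [hG, smul_zero, zero_sub] at hx
    exact neg_eq_zero.1 ((injective_iff_map_eq_zero T).1 hTi _ hx)
  have hgr : G.toLinearPMap.graph = G := G.toLinearPMap_graph_eq hG0
  have hdom : Dense (G.toLinearPMap.domain : Set L2) := by
    refine hTr.mono ?_
    rintro _ ⟨h, rfl⟩
    refine LinearPMap.mem_domain_of_mem_graph (y := lam • T h - h) ?_
    rw [hgr, hG, sub_sub_cancel]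
  refine ⟨G.toLinearPMap, fun f w => by rw [hgr, hG, hT]; rfl, hdom, ?_, ?_⟩
  · rw [LinearPMap.isSelfAdjoint_def]
    refine LinearPMap.eq_of_eq_graph ?_
    rw [LinearPMap.adjoint_graph_eq_graph_adjoint hdom, hgr]
    ext ⟨g, z⟩
    rw [Submodule.mem_adjoint_iff, hG]
    -- Every pair of the graph is (Th, lam·Th − h). By symmetry of T, annihilation of all of them is
    -- exactly membership of (g, z) in the graph.
    have key : ∀ h : L2, inner ℝ (lam • T h - h) g - inner ℝ (T h) z =
        inner ℝ h (T (lam • g - z) - g) := fun h => by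
      have e1 : inner ℝ (T h) g = inner ℝ h (T g) := hTs h g
      have e2 : inner ℝ (T h) z = inner ℝ h (T z) := hTs h z
      rw [inner_sub_left, real_inner_smul_left, map_sub, map_smul, inner_sub_right, inner_sub_right,
        real_inner_smul_right, e1, e2]
      ring
    constructor
    · intro h
      rw [← sub_eq_zero, ← inner_self_eq_zero (𝕜 := ℝ), ← key]
      refine h _ _ ?_
      rw [hG, sub_sub_cancel]
    · intro h a b hab
      rw [hG] at hab
      have := key (lam • a - b)
      rwa [hab, sub_sub_cancel, h, sub_self, inner_zero_right] at this
  -- Spectral theorem for compact symmetric operators. An eigenvalue ν ≠ 0 of T gives the eigenvalue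
  -- lam − 1/ν of H; for ν = 0 the eigenspace is trivial.
  · have h1 := ContinuousLinearMap.orthogonalComplement_iSup_eigenspaces_eq_bot hTc hTs
    have h2 := (Submodule.topologicalClosure_eq_top_iff).2 h1
    refine ((Submodule.dense_iff_topologicalClosure_eq_top).2 h2).mono
      (SetLike.coe_subset_coe.2 (iSup_le fun ν e he => Submodule.subset_span ?_))
    have he' : T e = ν • e := Module.End.mem_eigenspace_iff.1 he
    rcases eq_or_ne ν 0 with rfl | hν
    · have : e = 0 := (injective_iff_map_eq_zero T).1 hTi _ (by rw [he', zero_smul])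
      subst this
      exact ⟨0, (hT _ _).1 (by simp)⟩
    · refine ⟨lam - ν⁻¹, (hT _ _).1 ?_⟩
      rw [← sub_smul, sub_sub_cancel, map_smul, he', smul_smul, inv_mul_cancel₀ hν, one_smul]

end RoughTorus
end

/-! ### The rough source term produced by the heat flow. -/

noncomputable section

namespace RoughTorus

variable {C α : ℝ} {κ : ℝ} {ρ : Torus → ℝ}

/-! ### The rough source term of the heat flow of a Sobolev function -/

/-- The pairing of `heat b (w - ·) * f` with the potential, where `f'` is the derivative of `f`. -/
def source (κ : ℝ) (ρ : Torus → ℝ) (f f' : L2) (b : ℝ) (w : Torus) : ℝ :=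
  κ * (∫ x, heat b (w - x) * f x) - ∫ x, (heat b (w - x) * f' x - heatD b (w - x) * f x) * ρ x

lemma measurable_source (hρ : Measurable ρ) (f f' : L2) :
    Measurable fun p : ℝ × Torus => source κ ρ f f' p.1 p.2 := by
  have h : ∀ {g : (ℝ × Torus) × Torus → ℝ}, Measurable g →
      Measurable fun p => ∫ z, g (p, z) := fun hf =>
    (StronglyMeasurable.integral_prod_right' hf.stronglyMeasurable).measurable
  have hb : Measurable fun q : (ℝ × Torus) × Torus => q.1.1 := by fun_prop
  have hw : Measurable fun q : (ℝ × Torus) × Torus => q.1.2 - q.2 := by fun_prop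
  have hf : Measurable fun q : (ℝ × Torus) × Torus => f q.2 :=
    (Lp.stronglyMeasurable f).measurable.comp measurable_snd
  have hf' : Measurable fun q : (ℝ × Torus) × Torus => f' q.2 :=
    (Lp.stronglyMeasurable f').measurable.comp measurable_snd
  exact ((h ((hb.heat hw).mul hf)).const_mul κ).sub
    (h ((((hb.heat hw).mul hf').sub ((hb.heatD hw).mul hf)).mul (hρ.comp measurable_snd)))

lemma integrable_continuous_mul {φ : Torus → ℝ} (hφ : Continuous φ) {u : Torus → ℝ}
    (hu : Integrable u) : Integrable fun x => φ x * u x := by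
  obtain ⟨M, -, hM⟩ := exists_bound_of_continuous hφ
  exact integrable_bdd_mul hφ.measurable hM hu

lemma integrable_source (hρ : Continuous ρ) (f f' : L2) {b : ℝ} (hb : 0 < b) (w : Torus) :
    Integrable fun x => (heat b (w - x) * f' x - heatD b (w - x) * f x) * ρ x := by
  have c1 := continuous_heat hb
  have c2 := continuous_heatD hb
  have := integrable_continuous_mul hρ ((integrable_continuous_mul (φ := fun x => heat b (w - x))
    (by fun_prop) (integrable_coeFn f')).sub (integrable_continuous_mul
    (φ := fun x => heatD b (w - x)) (by fun_prop) (integrable_coeFn f)))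
  simpa only [mul_comm (ρ _), Pi.sub_apply] using this

lemma source_sub (hρ : Continuous ρ) (f f' g g' : L2) {b : ℝ} (hb : 0 < b) (w : Torus) :
    source κ ρ f f' b w - source κ ρ g g' b w = source κ ρ (f - g) (f' - g') b w := by
  have c1 := continuous_heat hb
  have i : ∀ f : L2, Integrable fun x => heat b (w - x) * f x := fun f =>
    integrable_continuous_mul (φ := fun x => heat b (w - x)) (by fun_prop) (integrable_coeFn f)
  have e1 : ∫ x, heat b (w - x) * (f - g : L2) x =
      (∫ x, heat b (w - x) * f x) - ∫ x, heat b (w - x) * g x := by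
    rw [← integral_sub (i f) (i g)]
    refine integral_congr_ae ?_
    filter_upwards [Lp.coeFn_sub f g] with x hx
    rw [hx, Pi.sub_apply, mul_sub]
  have e2 : ∫ x, (heat b (w - x) * (f' - g' : L2) x - heatD b (w - x) * (f - g : L2) x) * ρ x =
      (∫ x, (heat b (w - x) * f' x - heatD b (w - x) * f x) * ρ x) -
        ∫ x, (heat b (w - x) * g' x - heatD b (w - x) * g x) * ρ x := by
    rw [← integral_sub (integrable_source hρ f f' hb w) (integrable_source hρ g g' hb w)]
    refine integral_congr_ae ?_
    filter_upwards [Lp.coeFn_sub f g, Lp.coeFn_sub f' g'] with x h1 h2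
    rw [h1, h2, Pi.sub_apply, Pi.sub_apply]; ring
  rw [source, source, source, e1, e2]
  ring

lemma abs_integral_mul_le {φ : Torus → ℝ} {M : ℝ} (hM : ∀ x, |φ x| ≤ M) (f : L2) :
    |∫ x, φ x * f x| ≤ M * ‖f‖ := by
  have hM0 : 0 ≤ M := (abs_nonneg _).trans (hM 0)
  calc |∫ x, φ x * f x| ≤ ∫ x, M * |f x| := by
        rw [← Real.norm_eq_abs]
        refine norm_integral_le_of_norm_le ((integrable_coeFn f).abs.const_mul M)
          (Eventually.of_forall fun x => ?_)
        rw [norm_mul]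
        exact mul_le_mul_of_nonneg_right (hM _) (abs_nonneg _)
    _ ≤ M * ‖f‖ := by
        rw [integral_const_mul]
        exact mul_le_mul_of_nonneg_left (integral_abs_le_norm f) hM0

lemma source_eq (hρ : Continuous ρ) (f f' : L2) {b : ℝ} (hb : 0 < b) (w : Torus) :
    source κ ρ f f' b w = κ * (∫ x, heat b (w - x) * f x) -
      (∫ x, (heat b (w - x) * ρ x) * f' x) + ∫ x, (heatD b (w - x) * ρ x) * f x := by
  have c1 := continuous_heat hb
  have c2 := continuous_heatD hb
  have e : ∫ x, (heat b (w - x) * f' x - heatD b (w - x) * f x) * ρ x =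
      (∫ x, (heat b (w - x) * ρ x) * f' x) - ∫ x, (heatD b (w - x) * ρ x) * f x := by
    rw [← integral_sub (integrable_continuous_mul (φ := fun x => heat b (w - x) * ρ x) (by fun_prop)
      (integrable_coeFn f')) (integrable_continuous_mul (φ := fun x => heatD b (w - x) * ρ x)
      (by fun_prop) (integrable_coeFn f))]
    exact integral_congr_ae (Eventually.of_forall fun x => by simp only; ring)
  rw [source, e]
  ring

/-- Continuity of the source in (f, f') at a fixed time; the constant may blow up as b → 0. -/
lemma exists_source_bound (hρ : Continuous ρ) (κ : ℝ) {b : ℝ} (hb : 0 < b) :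
    ∃ K, 0 ≤ K ∧ ∀ f f' w, |source κ ρ f f' b w| ≤ K * (‖f‖ + ‖f'‖) := by
  obtain ⟨M, hM0, hM⟩ := exists_bound_of_continuous hρ
  obtain ⟨A, hA0, hA⟩ := exists_bound_of_continuous (continuous_heat hb)
  obtain ⟨B, hB0, hB⟩ := exists_bound_of_continuous (continuous_heatD hb)
  refine ⟨|κ| * A + A * M + B * M, by positivity, fun f f' w => ?_⟩
  have h1 := abs_integral_mul_le (φ := fun x => heat b (w - x)) (fun x => hA _) f
  have h2 := abs_integral_mul_le (φ := fun x => heat b (w - x) * ρ x) (M := A * M) (fun x => by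
    rw [abs_mul]; exact mul_le_mul (hA _) (hM x) (abs_nonneg _) hA0) f'
  have h3 := abs_integral_mul_le (φ := fun x => heatD b (w - x) * ρ x) (M := B * M) (fun x => by
    rw [abs_mul]; exact mul_le_mul (hB _) (hM x) (abs_nonneg _) hB0) f
  rw [source_eq hρ f f' hb w]
  have n1 := norm_nonneg f
  have n2 := norm_nonneg f'
  calc _ ≤ |κ| * (A * ‖f‖) + A * M * ‖f'‖ + B * M * ‖f‖ := by
        refine (abs_add_le _ _).trans (add_le_add ((abs_sub _ _).trans (add_le_add ?_ h2)) h3)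
        rw [abs_mul]
        gcongr
    _ ≤ _ := by
        have p1 : 0 ≤ |κ| * A * ‖f'‖ := by positivity
        have p2 : 0 ≤ A * M * ‖f‖ := by positivity
        have p3 : 0 ≤ B * M * ‖f'‖ := by positivity
        nlinarith

/-- Quantitative in time, for a bounded first argument. The derivative of the heat kernel has L¹
norm of order b^(-1/2), and where only f' ∈ L² is available the supremum of the kernel, also of
order b^(-1/2), is used. -/
lemma exists_source_time_bound (hρ : Continuous ρ) (κ : ℝ) (F : C(Torus, ℝ)) (f' : L2) (T : ℝ) :
    ∃ c, 0 ≤ c ∧ ∀ b, 0 < b → b ≤ T → ∀ w, |source κ ρ (toL2 F) f' b w| ≤ c * b ^ (-(1 / 2) : ℝ) := by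
  obtain ⟨M, hM0, hM⟩ := exists_bound_of_continuous hρ
  set c0 := Real.sqrt T * heat T 0 with hc0d
  have hc0 : 0 ≤ c0 := mul_nonneg (Real.sqrt_nonneg _) (heat_nonneg _ _)
  refine ⟨|κ| * (c0 * ‖toL2 F‖) + c0 * M * ‖f'‖ + 8 * M * ‖F‖, by positivity, fun b hb hbT w => ?_⟩
  set q := b ^ (-(1 / 2) : ℝ) with hq
  have hq0 : 0 ≤ q := Real.rpow_nonneg hb.le _
  have hh : ∀ x, |heat b (w - x)| ≤ c0 * q := fun x => by
    rw [abs_of_nonneg (heat_nonneg _ _)]; exact heat_sup_le hb hbT _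
  have h1 := abs_integral_mul_le (φ := fun x => heat b (w - x)) hh (toL2 F)
  have h2 := abs_integral_mul_le (φ := fun x => heat b (w - x) * ρ x) (M := c0 * q * M) (fun x => by
    rw [abs_mul]; exact mul_le_mul (hh _) (hM x) (abs_nonneg _) (by positivity)) f'
  have h3 : |∫ x, (heatD b (w - x) * ρ x) * toL2 F x| ≤ 8 * q * M * ‖F‖ := by
    have ht2 : 0 < 2 * b := by linarith
    have c2 := continuous_heat ht2
    calc _ ≤ ∫ x, 8 * q * M * ‖F‖ * heat (2 * b) (w - x) := by
          rw [← Real.norm_eq_abs]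
          refine norm_integral_le_of_norm_le (Continuous.integrable_torus (by fun_prop)) ?_
          filter_upwards [coeFn_toL2 F] with x hx
          rw [hx, norm_mul, norm_mul, Real.norm_eq_abs, Real.norm_eq_abs]
          have k1 := abs_heatD_le hb (w - x)
          have k2 := hM x
          have k3 := F.norm_coe_le_norm x
          have k4 := heat_nonneg (2 * b) (w - x)
          calc _ ≤ (8 * q * heat (2 * b) (w - x)) * M * ‖F‖ := by gcongr
            _ = _ := by ring
      _ = _ := by rw [integral_const_mul, integral_heat_sub_right ht2, mul_one]
  rw [source_eq hρ _ f' hb w]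
  calc _ ≤ |κ| * (c0 * q * ‖toL2 F‖) + c0 * q * M * ‖f'‖ + 8 * q * M * ‖F‖ := by
        refine (abs_add_le _ _).trans (add_le_add ((abs_sub _ _).trans (add_le_add ?_ h2)) h3)
        rw [abs_mul]
        gcongr
    _ = _ := by ring

lemma WeakPair.integral_heatD_mul {f f' : L2} (h : WeakPair f f') {t : ℝ} (ht : 0 < t) (x : Torus) :
    ∫ y, heatD t (x - y) * f y = heatC t f' x := by
  have h1 := hasTorusDeriv_conv (hasTorusDeriv_heat ht) (continuous_heatD ht) (integrable_coeFn f)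
  have e1 : (heatC t f : Torus → ℝ) = fun x => ∫ y, heat t (x - y) * f y :=
    funext fun x => heatC_apply ht f x
  have h2 := h.hasTorusDeriv_heatC ht
  rw [e1] at h2
  exact congrFun (h1.unique h2) x

/-- Integrating a rough step against a Sobolev function. -/
lemma integral_mul_stepKernel (hρ : Continuous ρ) {f f' : L2} (h : WeakPair f f') {a b : ℝ}
    (ha : 0 < a) (hb : 0 < b) (w : Torus) :
    ∫ x, f x * stepKernel κ ρ a b x w = source κ ρ (heatOp a f) (heatOp a f') b w := by
  have ca := continuous_heat ha
  have cb := continuous_heat hb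
  have cda := continuous_heatD ha
  have cdb := continuous_heatD hb
  have := integral_mul_pairing (κ := κ) hρ (integrable_coeFn f)
    (φ := fun p : Torus × Torus => heat a (p.2 - p.1) * heat b (p.1 - w))
    (φ' := fun p : Torus × Torus => -heatD a (p.2 - p.1) * heat b (p.1 - w) +
      heat a (p.2 - p.1) * heatD b (p.1 - w)) (by fun_prop) (by fun_prop)
  unfold stepKernel
  rw [this, pairing, source]
  have i1 : ∀ z, Integrable fun x => heat a (z - x) * f x := fun z =>
    integrable_continuous_mul (φ := fun x => heat a (z - x)) (by fun_prop) (integrable_coeFn f)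
  have i2 : ∀ z, Integrable fun x => heatD a (z - x) * f x := fun z =>
    integrable_continuous_mul (φ := fun x => heatD a (z - x)) (by fun_prop) (integrable_coeFn f)
  have s1 : ∀ z x : Torus, heatD a (x - z) = -heatD a (z - x) := fun z x => by
    rw [← neg_sub z x, heatD_neg]
  have s2 : ∀ z : Torus, heatD b (z - w) = -heatD b (w - z) := fun z => by
    rw [← neg_sub w z, heatD_neg]
  have e1 : ∀ z, ∫ x, f x * (heat a (x - z) * heat b (z - w)) = heat b (w - z) * heatC a f z := by
    intro z
    rw [heatC_apply ha, ← integral_const_mul]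
    refine integral_congr_ae (Eventually.of_forall fun x => ?_)
    simp only
    rw [heat_sub_comm a x z, heat_sub_comm b z w]; ring
  have e2 : ∀ z, ∫ x, f x * (-heatD a (x - z) * heat b (z - w) + heat a (x - z) * heatD b (z - w)) =
      heat b (w - z) * heatC a f' z - heatD b (w - z) * heatC a f z := by
    intro z
    rw [heatC_apply ha f, ← h.integral_heatD_mul ha, ← integral_const_mul, ← integral_const_mul,
      ← integral_sub ((i2 z).const_mul _) ((i1 z).const_mul _)]
    refine integral_congr_ae (Eventually.of_forall fun x => ?_)
    simp only
    rw [heat_sub_comm a x z, heat_sub_comm b z w, s1, s2]; ring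
  simp only [e1, e2]
  have a1 : (heatOp a f : Torus → ℝ) =ᵐ[volume] heatC a f := by
    rw [← toL2_heatC ha]; exact coeFn_toL2 _
  have a2 : (heatOp a f' : Torus → ℝ) =ᵐ[volume] heatC a f' := by
    rw [← toL2_heatC ha]; exact coeFn_toL2 _
  congr 1
  · congr 1
    refine integral_congr_ae ?_
    filter_upwards [a1] with x h1
    rw [h1]
  · refine integral_congr_ae ?_
    filter_upwards [a1, a2] with x h1 h2
    rw [h1, h2]

/-! ### The heat flow of an eigenvector -/

lemma continuous_heatDD {t : ℝ} (ht : 0 < t) : Continuous (heatDD t) := by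
  unfold heatDD
  exact continuous_tsum (fun n => continuous_const.mul (Complex.continuous_re.comp
    (fourier n).continuous)) (summable_heatDD_bound ht) fun n x => norm_heatDD_term_le le_rfl n
      ((Complex.abs_re_le_norm _).trans (((fourier n).norm_coe_le_norm x).trans (fourier_norm n).le))

lemma hasDerivAt_integral_heat (f : L2) {t : ℝ} (ht : 0 < t) (w : Torus) :
    HasDerivAt (fun t => ∫ x, heat t (w - x) * f x) (∫ x, 1 / 2 * heatDD t (w - x) * f x) t := by
  obtain ⟨B, hB⟩ := exists_heatDD_bound (half_pos ht)
  have cD : Continuous fun y : Torus => heatDD t (w - y) := (continuous_heatDD ht).comp (by fun_prop)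
  have hpos : ∀ {x}, x ∈ Ioi (t / 2) → 0 < x := fun hx => (half_pos ht).trans hx
  have hfm := (Lp.stronglyMeasurable f).measurable
  have c1 : ∀ x, 0 < x → Continuous fun y : Torus => heat x (w - y) := fun x hx =>
    (continuous_heat hx).comp (by fun_prop)
  refine (hasDerivAt_integral_of_dominated_loc_of_deriv_le (μ := volume) (s := Ioi (t / 2))
    (F := fun t x => heat t (w - x) * f x) (F' := fun t x => 1 / 2 * heatDD t (w - x) * f x)
    (bound := fun x => 1 / 2 * B * |f x|) (Ioi_mem_nhds (half_lt_self ht)) ?_ ?_ ?_ ?_ ?_ ?_).2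
  · filter_upwards [lt_mem_nhds ht] with s hs
    exact ((c1 s hs).measurable.mul hfm).aestronglyMeasurable
  · exact integrable_continuous_mul (c1 t ht) (integrable_coeFn f)
  · exact (((cD.measurable).const_mul (1 / 2)).mul hfm).aestronglyMeasurable
  · refine Eventually.of_forall fun y s hs => ?_
    rw [norm_mul, norm_mul, Real.norm_eq_abs, Real.norm_eq_abs, Real.norm_eq_abs]
    have := hB s (le_of_lt hs) (w - y)
    rw [abs_of_nonneg (by norm_num : (0 : ℝ) ≤ 1 / 2)]
    gcongr
  · exact (integrable_coeFn f).abs.const_mul _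
  · exact Eventually.of_forall fun y s hs => (hasDerivAt_heat_time (hpos hs) (w - y)).mul_const _

end RoughTorus
end

noncomputable section

namespace RoughTorus

variable {C α : ℝ} {κ : ℝ} {ρ : Torus → ℝ}

/-- `e` is an eigenvector of the form operator, with weak derivative `e'`. -/
def IsEigenpair (κ : ℝ) (ρ : Torus → ℝ) (μ : ℝ) (e e' : L2) : Prop :=
  WeakPair e e' ∧ ∀ g g', WeakPair g g' → torusForm κ ρ e e' g g' = - inner ℝ (μ • e) g

/-- The heat kernel centred at w is used as test function in the eigenvalue equation: ½⟨e, φ''⟩ =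
−½⟨e', φ'⟩ equals μ⟨e, φ⟩ minus the source, and the left side is the time derivative by the heat
equation. -/
lemma IsEigenpair.hasDerivAt_integral_heat {μ : ℝ} {e e' : L2}
    (h : IsEigenpair κ ρ μ e e') {t : ℝ} (ht : 0 < t) (w : Torus) :
    HasDerivAt (fun t => ∫ x, heat t (w - x) * e x)
      (μ * (∫ x, heat t (w - x) * e x) - source κ ρ e e' t w) t := by
  have c0 := continuous_heat ht
  have c1 := continuous_heatD ht
  have c2 := continuous_heatDD ht
  let φ : C(Torus, ℝ) := ⟨fun x => heat t (w - x), by fun_prop⟩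
  let φ' : C(Torus, ℝ) := ⟨fun x => -heatD t (w - x), by fun_prop⟩
  let φ'' : C(Torus, ℝ) := ⟨fun x => heatDD t (w - x), by fun_prop⟩
  have d1 : HasTorusDeriv φ φ' := (hasTorusDeriv_heat ht).comp_const_sub w
  have d2 : HasTorusDeriv φ' φ'' := fun x => by
    have := ((hasTorusDeriv_heatD ht).comp_const_sub w x).neg
    rw [neg_neg] at this
    exact this
  have h1 := h.1 φ' φ'' d2
  have h2 := h.2 _ _ d1.weakPair
  rw [torusForm, real_inner_smul_left, inner_toL2, inner_toL2] at h2
  rw [inner_toL2, inner_toL2] at h1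
  have e1 : ∫ x, (e' x * toL2 φ x + e x * toL2 φ' x) * ρ x =
      ∫ x, (heat t (w - x) * e' x - heatD t (w - x) * e x) * ρ x := by
    refine integral_congr_ae ?_
    filter_upwards [coeFn_toL2 φ, coeFn_toL2 φ'] with x h1 h2
    rw [h1, h2]
    simp only [φ, φ', ContinuousMap.coe_mk]
    ring
  have e2 : ∫ x, e x * φ x = ∫ x, heat t (w - x) * e x := by simp only [mul_comm (e _)]; rfl
  have e3 : ∫ x, 1 / 2 * heatDD t (w - x) * e x = 1 / 2 * ∫ x, e x * φ'' x := by
    rw [← integral_const_mul]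
    refine integral_congr_ae (Eventually.of_forall fun x => ?_)
    simp only [φ'', ContinuousMap.coe_mk]; ring
  convert RoughTorus.hasDerivAt_integral_heat e ht w using 1
  rw [e3, source, ← e1, ← e2]
  linarith

/-! ### Chains integrated against an eigenvector -/

/-- The integral of a chain against `e`. -/
def moment (κ : ℝ) (ρ : Torus → ℝ) (e : L2) (n : ℕ) (s : Fin (n + 1) → ℝ) (y : Torus) : ℝ :=
  ∫ x, chain κ ρ n s x y * e x

/-- The chain in which the first half of the first heat kernel is replaced by the source term. -/
def sourceMoment (κ : ℝ) (ρ : Torus → ℝ) (e e' : L2) (n : ℕ) (s : Fin (n + 1) → ℝ) (y : Torus) : ℝ :=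
  ∫ w, source κ ρ e e' (s 0 / 2) w *
    chain κ ρ n (Fin.cons (α := fun _ => ℝ) (s 0 / 2) (fun i => s i.succ)) w y

lemma cons_pos {n : ℕ} {a : ℝ} (ha : 0 < a) {s : Fin n → ℝ} (hs : ∀ i, 0 < s i) (i : Fin (n + 1)) :
    0 < Fin.cons (α := fun _ => ℝ) a s i :=
  Fin.cases ha hs i

lemma moment_cons_add (hα : 0 < α) (hα1 : α ≤ 1) (hρ : HolderTorus C α ρ) (e : L2) {n : ℕ}
    {s : Fin n → ℝ} (hs : ∀ i, 0 < s i) {τ c : ℝ} (hτ : 0 < τ) (hc : 0 < c) (y : Torus) :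
    moment κ ρ e n (Fin.cons (α := fun _ => ℝ) (τ + c) s) y =
      ∫ w, (∫ x, heat τ (w - x) * e x) * chain κ ρ n (Fin.cons (α := fun _ => ℝ) c s) w y := by
  have hs' := cons_pos hc hs
  have hi := integrable_chain_left (κ := κ) hα hα1 hρ hs' y
  have ch := continuous_heat hτ
  obtain ⟨M, -, hM⟩ := exists_bound_of_continuous ch
  have hint : Integrable (fun p : Torus × Torus => heat τ (p.1 - p.2) *
      (e p.1 * chain κ ρ n (Fin.cons (α := fun _ => ℝ) c s) p.2 y)) (volume.prod volume) :=
    ((integrable_coeFn e).mul_prod hi).bdd_mul (c := M)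
      (Continuous.aestronglyMeasurable (by fun_prop)) (Eventually.of_forall fun p => hM _)
  have h1 : ∀ x, chain κ ρ n (Fin.cons (α := fun _ => ℝ) (τ + c) s) x y * e x =
      ∫ w, heat τ (x - w) * (e x * chain κ ρ n (Fin.cons (α := fun _ => ℝ) c s) w y) := by
    intro x
    rw [← heat_conv_chain (κ := κ) hα hα1 hρ hτ hs' (s' := Fin.cons (α := fun _ => ℝ) (τ + c) s)
      rfl (fun _ => rfl) x y, ← integral_mul_const]
    exact integral_congr_ae (Eventually.of_forall fun w => by simp only; ring)
  simp only [moment, h1]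
  rw [integral_integral_swap hint]
  refine integral_congr_ae (Eventually.of_forall fun w => ?_)
  simp only
  rw [← integral_mul_const]
  refine integral_congr_ae (Eventually.of_forall fun x => ?_)
  simp only
  rw [heat_sub_comm]; ring

/-- Half of the first time is frozen inside the chain; only the heat kernel facing e varies, so its
evolution equation is integrated against the frozen chain. -/
lemma hasDerivAt_moment (hα : 0 < α) (hα1 : α ≤ 1) (hρ : HolderTorus C α ρ) {μ : ℝ} {e e' : L2}
    (he : IsEigenpair κ ρ μ e e') {n : ℕ} {s : Fin n → ℝ} (hs : ∀ i, 0 < s i) {a : ℝ} (ha : 0 < a)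
    (y : Torus) :
    HasDerivAt (fun a => moment κ ρ e n (Fin.cons (α := fun _ => ℝ) a s) y)
      (μ * moment κ ρ e n (Fin.cons (α := fun _ => ℝ) a s) y -
        sourceMoment κ ρ e e' n (Fin.cons (α := fun _ => ℝ) a s) y) a := by
  have hρc := hρ.continuous hα
  have hc : 0 < a / 2 := half_pos ha
  set c := a / 2 with hcd
  have hac : a = c + c := by rw [hcd]; ring
  set u : Torus → ℝ := fun w => chain κ ρ n (Fin.cons (α := fun _ => ℝ) c s) w y with hu
  have hi : Integrable u := integrable_chain_left (κ := κ) hα hα1 hρ (cons_pos hc hs) y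
  obtain ⟨B, hB⟩ := exists_heatDD_bound (half_pos hc)
  have c0 := continuous_heat hc
  have c2 := continuous_heatDD hc
  have hconv : ∀ t, 0 < t → Continuous fun w => ∫ x, heat t (w - x) * e x := fun t ht =>
    continuous_conv (continuous_heat ht) (integrable_coeFn e)
  have hpos : ∀ {x}, x ∈ Ioi (c / 2) → 0 < x := fun hx => (half_pos hc).trans hx
  have key := hasDerivAt_integral_of_dominated_loc_of_deriv_le (μ := volume) (s := Ioi (c / 2))
    (x₀ := c) (F := fun t w => (∫ x, heat t (w - x) * e x) * u w)
    (F' := fun t w => (∫ x, 1 / 2 * heatDD t (w - x) * e x) * u w)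
    (bound := fun w => 1 / 2 * B * ‖e‖ * |u w|) (Ioi_mem_nhds (half_lt_self hc)) (by
      filter_upwards [lt_mem_nhds hc] with t ht
      exact (hconv t ht).aestronglyMeasurable.mul hi.aestronglyMeasurable)
    (integrable_continuous_mul (hconv c hc) hi)
    ((continuous_conv (φ := fun x => 1 / 2 * heatDD c x) (by fun_prop)
      (integrable_coeFn e)).aestronglyMeasurable.mul hi.aestronglyMeasurable)
    (Eventually.of_forall fun w t ht => by
      rw [norm_mul, Real.norm_eq_abs, Real.norm_eq_abs]
      refine mul_le_mul_of_nonneg_right (abs_integral_mul_le (fun x => ?_) e) (abs_nonneg _)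
      rw [abs_mul, abs_of_nonneg (by norm_num : (0 : ℝ) ≤ 1 / 2)]
      exact mul_le_mul_of_nonneg_left (hB t (le_of_lt ht) _) (by norm_num))
    (hi.abs.const_mul _)
    (Eventually.of_forall fun w t ht => (hasDerivAt_integral_heat e (hpos ht) w).mul_const _)
  have h2 := key.2
  have hval : ∫ w, (∫ x, 1 / 2 * heatDD c (w - x) * e x) * u w =
      μ * moment κ ρ e n (Fin.cons (α := fun _ => ℝ) a s) y -
        sourceMoment κ ρ e e' n (Fin.cons (α := fun _ => ℝ) a s) y := by
    have hd : ∀ w, ∫ x, 1 / 2 * heatDD c (w - x) * e x =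
        μ * (∫ x, heat c (w - x) * e x) - source κ ρ e e' c w := fun w =>
      (hasDerivAt_integral_heat e hc w).unique (he.hasDerivAt_integral_heat hc w)
    obtain ⟨K, -, hK⟩ := exists_source_bound hρc κ hc
    have i1 := integrable_continuous_mul (hconv c hc) hi
    have i2 : Integrable fun w => source κ ρ e e' c w * u w :=
      integrable_bdd_mul ((measurable_source hρc.measurable e e').comp
        (measurable_const.prodMk measurable_id)) (hK e e') hi
    rw [hac, moment_cons_add hα hα1 hρ e hs hc hc, sourceMoment]
    simp only [hd, Fin.cons_zero, Fin.cons_succ, ← hac, ← hcd]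
    rw [← integral_const_mul, ← integral_sub (i1.const_mul μ) i2]
    exact integral_congr_ae (Eventually.of_forall fun w => by simp only [hu]; ring)
  rw [hval] at h2
  have h3 : HasDerivAt (fun a => ∫ w, (∫ x, heat (a - c) (w - x) * e x) * u w) _ a :=
    HasDerivAt.comp_sub_const a c (by rwa [show a - c = c by rw [hac]; ring])
  refine h3.congr_of_eventuallyEq ?_
  filter_upwards [lt_mem_nhds (by linarith : c < a)] with b hb
  rw [← moment_cons_add hα hα1 hρ e hs (sub_pos.2 hb) hc, sub_add_cancel]

lemma tendsto_moment_zero {e : L2} {E : C(Torus, ℝ)}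
    (hE : Tendsto (fun t => heatC t e) (𝓝[>] 0) (𝓝 E)) (s : Fin 0 → ℝ) (y : Torus) :
    Tendsto (fun a => moment κ ρ e 0 (Fin.cons (α := fun _ => ℝ) a s) y) (𝓝[>] 0) (𝓝 (E y)) := by
  refine (((ContinuousEvalConst.continuous_eval_const y).tendsto E).comp hE).congr' ?_
  filter_upwards [self_mem_nhdsWithin] with a ha
  have ha' : 0 < a := ha
  rw [Function.comp_apply, heatC_apply ha', moment]
  refine integral_congr_ae (Eventually.of_forall fun x => ?_)
  simp only [chain, Fin.cons_zero]
  rw [heat_sub_comm]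

/-- The link between consecutive terms. When the first time vanishes, the first kernel acts on e as
the identity, and the rough step becomes the source term facing a chain with one step fewer.
Convergence of the heat flow in H¹ suffices, since the second kernel stays smooth. -/
lemma tendsto_moment_succ (hα : 0 < α) (hα1 : α ≤ 1) (hρ : HolderTorus C α ρ) {e e' : L2}
    (he : WeakPair e e') {n : ℕ} {s : Fin (n + 1) → ℝ} (hs : ∀ i, 0 < s i) (y : Torus) :
    Tendsto (fun a => moment κ ρ e (n + 1) (Fin.cons (α := fun _ => ℝ) a s) y) (𝓝[>] 0)
      (𝓝 (sourceMoment κ ρ e e' n s y)) := by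
  have hρc := hρ.continuous hα
  have hb : 0 < s 0 / 2 := half_pos (hs 0)
  set b := s 0 / 2 with hbd
  set v : Fin (n + 1) → ℝ := Fin.cons (α := fun _ => ℝ) b (fun i => s i.succ) with hv
  have hvp : ∀ i, 0 < v i := cons_pos hb fun i => hs _
  set u : Torus → ℝ := fun w => chain κ ρ n v w y with hu
  have hi : Integrable u := integrable_chain_left (κ := κ) hα hα1 hρ hvp y
  obtain ⟨K, hK0, hK⟩ := exists_source_bound hρc κ hb
  have hms : ∀ f f' : L2, Measurable fun w => source κ ρ f f' b w := fun f f' =>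
    (measurable_source hρc.measurable f f').comp (measurable_const.prodMk measurable_id)
  have hin : ∀ f f' : L2, Integrable fun w => source κ ρ f f' b w * u w := fun f f' =>
    integrable_bdd_mul (hms f f') (hK f f') hi
  have hmom : ∀ a, 0 < a → moment κ ρ e (n + 1) (Fin.cons (α := fun _ => ℝ) a s) y =
      ∫ w, source κ ρ (heatOp a e) (heatOp a e') b w * u w := by
    intro a ha
    have h1 : ∀ x, chain κ ρ (n + 1) (Fin.cons (α := fun _ => ℝ) a s) x y * e x =
        ∫ w, stepKernel κ ρ a b x w * (e x * u w) := by
      intro x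
      rw [chain, ← integral_mul_const]
      refine integral_congr_ae (Eventually.of_forall fun w => ?_)
      change stepKernel κ ρ a b x w * u w * e x = _
      ring
    have hmk : Measurable fun p : Torus × Torus => stepKernel κ ρ a b p.1 p.2 :=
      Measurable.stepKernel hρc.measurable measurable_const measurable_const measurable_fst
        measurable_snd
    obtain ⟨A, hA⟩ : ∃ A, ∀ w w', |stepKernel κ ρ a b w w'| ≤ A := by
      have c4 := continuous_heat (by linarith : 0 < 4 * (a + b))
      obtain ⟨N, hN0, hN⟩ := exists_bound_of_continuous c4
      refine ⟨(32 * C + 2 * |κ| * a ^ ((1 - α) / 2)) *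
        (a ^ (-((1 - α) / 2)) + b ^ (-((1 - α) / 2))) * N, fun w w' =>
          (abs_stepKernel_le hα hα1 hρ ha hb le_rfl w w').trans ?_⟩
      have := hρ.nonneg
      have hh := (le_abs_self _).trans (hN (w - w'))
      gcongr
    have hint : Integrable (fun p : Torus × Torus => stepKernel κ ρ a b p.1 p.2 *
        (e p.1 * u p.2)) (volume.prod volume) :=
      ((integrable_coeFn e).mul_prod hi).bdd_mul (c := A) hmk.aestronglyMeasurable
        (Eventually.of_forall fun p => hA _ _)
    simp only [moment, h1]
    rw [integral_integral_swap hint]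
    refine integral_congr_ae (Eventually.of_forall fun w => ?_)
    simp only
    rw [← integral_mul_stepKernel hρc he ha hb, ← integral_mul_const]
    exact integral_congr_ae (Eventually.of_forall fun x => by simp only; ring)
  rw [tendsto_iff_dist_tendsto_zero]
  have hlim : Tendsto (fun a => K * (‖heatOp a e - e‖ + ‖heatOp a e' - e'‖) * ∫ w, |u w|)
      (𝓝[>] 0) (𝓝 0) := by
    have t1 := tendsto_iff_norm_sub_tendsto_zero.1 (tendsto_heatOp e)
    have t2 := tendsto_iff_norm_sub_tendsto_zero.1 (tendsto_heatOp e')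
    simpa using ((t1.add t2).const_mul K).mul_const (∫ w, |u w|)
  refine squeeze_zero' (Eventually.of_forall fun _ => dist_nonneg) ?_ hlim
  filter_upwards [self_mem_nhdsWithin] with a ha
  have ha' : 0 < a := ha
  rw [Real.dist_eq, hmom a ha', show sourceMoment κ ρ e e' n s y =
    ∫ w, source κ ρ e e' b w * u w from rfl, ← integral_sub (hin _ _) (hin _ _), ← integral_const_mul,
    ← Real.norm_eq_abs]
  refine norm_integral_le_of_norm_le (hi.abs.const_mul _) (Eventually.of_forall fun w => ?_)
  rw [← sub_mul, source_sub hρc _ _ _ _ hb, norm_mul, Real.norm_eq_abs, Real.norm_eq_abs]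
  exact mul_le_mul_of_nonneg_right (hK _ _ w) (abs_nonneg _)

/-! ### Bounds and the fundamental theorem of calculus -/

lemma measurable_sourceMoment (hρ : Measurable ρ) (e e' : L2) (n : ℕ) (y : Torus) :
    Measurable fun s : Fin (n + 1) → ℝ => sourceMoment κ ρ e e' n s y := by
  have h0 : Measurable fun p : (Fin (n + 1) → ℝ) × Torus => p.1 0 / 2 :=
    ((measurable_pi_apply 0).comp measurable_fst).div_const 2
  have hc : Measurable fun p : (Fin (n + 1) → ℝ) × Torus =>
      (Fin.cons (α := fun _ => ℝ) (p.1 0 / 2) (fun i => p.1 i.succ) : Fin (n + 1) → ℝ) := by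
    refine measurable_pi_iff.2 fun i => ?_
    refine Fin.cases ?_ (fun j => ?_) i
    · exact h0
    · have hj : Measurable fun p : (Fin (n + 1) → ℝ) × Torus => p.1 j.succ :=
        (measurable_pi_apply _).comp measurable_fst
      exact hj
  have h : Measurable fun p : (Fin (n + 1) → ℝ) × Torus => source κ ρ e e' (p.1 0 / 2) p.2 *
      chain κ ρ n (Fin.cons (α := fun _ => ℝ) (p.1 0 / 2) (fun i => p.1 i.succ)) p.2 y :=
    ((measurable_source hρ e e').comp (h0.prodMk measurable_snd)).mul
      ((measurable_chain hρ n).comp (hc.prodMk (measurable_snd.prodMk measurable_const)))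
  exact (StronglyMeasurable.integral_prod_right' h.stronglyMeasurable).measurable

lemma exists_sourceMoment_bound (hα : 0 < α) (hα1 : α ≤ 1) (hρ : HolderTorus C α ρ)
    (E : C(Torus, ℝ)) (e' : L2) (T : ℝ) :
    ∃ c, 0 ≤ c ∧ ∀ τ ≤ T, ∀ (n : ℕ) (s : Fin (n + 1) → ℝ), (∀ i, 0 < s i) → (∀ i, s i ≤ τ) → ∀ y,
      |sourceMoment κ ρ (toL2 E) e' n s y| ≤
        c * ((s 0) ^ (-(1 / 2) : ℝ) * chainWeight (chainConst κ C α T) τ ((1 - α) / 2) s) := by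
  obtain ⟨c, hc0, hc⟩ := exists_source_time_bound (hρ.continuous hα) κ E e' T
  refine ⟨4 * c, by positivity, fun τ hτT n s hs hτ y => ?_⟩
  obtain ⟨s', hs'd, hs', h0, h1⟩ := exists_halve_first hs
  have hsp := half_pos (hs 0)
  have hτ0 : 0 < τ := (hs 0).trans_le (hτ 0)
  have hA := chainConst_nonneg (κ := κ) (α := α) hρ.nonneg (hτ0.le.trans hτT)
  have hτ' : ∀ i, s' i ≤ τ := by
    intro i
    rw [hs'd]
    refine Fin.cases ?_ (fun j => ?_) i
    · exact (half_le_self (hs 0).le).trans (hτ 0)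
    · exact hτ _
  have hsum0 : 0 < 4 * ∑ i, s' i :=
    mul_pos four_pos (Finset.sum_pos (fun i _ => hs' i) ⟨0, Finset.mem_univ _⟩)
  have ch := continuous_heat hsum0
  set W := chainWeight (chainConst κ C α T) τ ((1 - α) / 2) s' with hW
  have hW0 : 0 ≤ W := chainWeight_nonneg hA hτ0.le hs'
  set q := (s 0 / 2) ^ (-(1 / 2) : ℝ) with hq
  have hq0 : 0 ≤ q := Real.rpow_nonneg hsp.le _
  have h2 : |sourceMoment κ ρ (toL2 E) e' n s y| ≤ c * q * W := by
    calc _ ≤ ∫ w, c * q * W * heat (4 * ∑ i, s' i) (w - y) := by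
          rw [sourceMoment, ← hs'd, ← Real.norm_eq_abs]
          refine norm_integral_le_of_norm_le (Continuous.integrable_torus (by fun_prop))
            (Eventually.of_forall fun w => ?_)
          rw [norm_mul, Real.norm_eq_abs, Real.norm_eq_abs, mul_assoc]
          exact mul_le_mul (hc _ hsp ((half_le_self (hs 0).le).trans ((hτ 0).trans hτT)) w)
            (abs_chain_le (κ := κ) hα hα1 hρ hτT hs' hτ' w y) (abs_nonneg _) (by positivity)
      _ = _ := by rw [integral_const_mul, integral_heat_sub_left hsum0, mul_one]
  have h3 : q ≤ 2 * (s 0) ^ (-(1 / 2) : ℝ) := half_rpow_neg_le (hs 0) (by norm_num)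
  have h4 : W ≤ 2 * chainWeight (chainConst κ C α T) τ ((1 - α) / 2) s :=
    chainWeight_cons_half_le hA hτ0.le (by linarith) hs h0 h1
  have h5 : 0 ≤ (s 0) ^ (-(1 / 2) : ℝ) := Real.rpow_nonneg (hs 0).le _
  calc _ ≤ c * q * W := h2
    _ ≤ c * (2 * (s 0) ^ (-(1 / 2) : ℝ)) *
        (2 * chainWeight (chainConst κ C α T) τ ((1 - α) / 2) s) := by gcongr
    _ = _ := by ring

/-- Variation of constants: the integrating factor exp(μ(r − a)) reduces the evolution equation to a
derivative on (0, r), whose value at 0 is the limit L. -/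
lemma moment_eq_of_tendsto (hα : 0 < α) (hα1 : α ≤ 1) (hρ : HolderTorus C α ρ) {μ : ℝ} {e e' : L2}
    (he : IsEigenpair κ ρ μ e e') {n : ℕ} {s : Fin n → ℝ} (hs : ∀ i, 0 < s i) {r L : ℝ} (hr : 0 < r)
    {y : Torus} (hL : Tendsto (fun a => moment κ ρ e n (Fin.cons (α := fun _ => ℝ) a s) y) (𝓝[>] 0) (𝓝 L))
    (hi : IntervalIntegrable (fun a => Real.exp (μ * (r - a)) *
      sourceMoment κ ρ e e' n (Fin.cons (α := fun _ => ℝ) a s) y) volume 0 r) :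
    moment κ ρ e n (Fin.cons (α := fun _ => ℝ) r s) y = Real.exp (μ * r) * L -
      ∫ a in (0 : ℝ)..r, Real.exp (μ * (r - a)) *
        sourceMoment κ ρ e e' n (Fin.cons (α := fun _ => ℝ) a s) y := by
  have hexp : ∀ a : ℝ, HasDerivAt (fun a => Real.exp (μ * (r - a))) (Real.exp (μ * (r - a)) * (-μ)) a := by
    intro a
    have h1 : HasDerivAt (fun a : ℝ => μ * (r - a)) (-μ) a := by
      simpa using ((hasDerivAt_const a r).sub (hasDerivAt_id a)).const_mul μ
    exact h1.exp
  have hd : ∀ a, 0 < a → HasDerivAt (fun a => Real.exp (μ * (r - a)) *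
      moment κ ρ e n (Fin.cons (α := fun _ => ℝ) a s) y) (-(Real.exp (μ * (r - a)) *
      sourceMoment κ ρ e e' n (Fin.cons (α := fun _ => ℝ) a s) y)) a := fun a ha => by
    have := (hexp a).mul (hasDerivAt_moment hα hα1 hρ he hs ha y)
    refine this.congr_deriv ?_
    ring
  have hcont : Continuous fun a : ℝ => Real.exp (μ * (r - a)) := by fun_prop
  have key := intervalIntegral.integral_eq_sub_of_hasDerivAt_of_tendsto hr
    (fun a ha => hd a ha.1) hi.neg
    (((hcont.tendsto 0).mono_left nhdsWithin_le_nhds).mul hL)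
    ((hd r hr).continuousAt.tendsto.mono_left nhdsWithin_le_nhds)
  rw [intervalIntegral.integral_neg] at key
  simp only [sub_self, mul_zero, Real.exp_zero, one_mul, sub_zero] at key
  linarith

end RoughTorus
end

/-! ### The telescoping identity for eigenvectors. -/

noncomputable section

namespace RoughTorus

variable {C α : ℝ} {κ : ℝ} {ρ : Torus → ℝ}

/-! ### Integrals of the source moments over simplices -/

/-- All n + 1 times are now coordinates and the slack carries no weight, hence the Dirichlet
parameter 1 for it. The source lowers the parameter of the first time from (1+α)/2 to α/2, still
positive. -/
lemma lintegral_sourceWeight {A α t : ℝ} (hα : 0 < α) (hA : 0 ≤ A) (ht : 0 < t) (n : ℕ) :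
    ∫⁻ s in simplex (n + 1) t, ENNReal.ofReal ((s 0) ^ (-(1 / 2) : ℝ) *
      chainWeight A t ((1 - α) / 2) s) = ENNReal.ofReal (2 * A ^ n *
        t ^ ((1 - α) / 2 * (n + 1)) * (Real.Gamma (α / 2) * Real.Gamma α ^ n /
        Real.Gamma (1 + α / 2 + n * α) * t ^ (α / 2 + n * α))) := by
  have hd := lintegral_dirichlet one_pos (n := n + 1) (b := Fin.cons (α := fun _ => ℝ) (α / 2) fun _ => α)
    (fun i => cons_pos (half_pos hα) (fun _ => hα) i) ht
  simp only [Fin.prod_univ_succ, Fin.sum_univ_succ (f := fun i : Fin (n + 1) =>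
    (Fin.cons (α := fun _ => ℝ) (α / 2) (fun _ : Fin n => α) i : ℝ)), Fin.cons_zero, Fin.cons_succ,
    Finset.prod_const, Finset.sum_const, Finset.card_univ, Fintype.card_fin, nsmul_eq_mul, sub_self,
    Real.rpow_zero, one_mul, Real.Gamma_one] at hd
  have e : ∀ s ∈ simplex (n + 1) t, ENNReal.ofReal ((s 0) ^ (-(1 / 2) : ℝ) *
      chainWeight A t ((1 - α) / 2) s) =
      ENNReal.ofReal (2 * A ^ n * t ^ ((1 - α) / 2 * (n + 1))) *
      ENNReal.ofReal ((s 0) ^ (α / 2 - 1) * ∏ i : Fin n, (s i.succ) ^ (α - 1)) := by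
    intro s hs
    rw [← ENNReal.ofReal_mul (by positivity)]
    congr 1
    unfold chainWeight
    have e1 : (s 0) ^ (α / 2 - 1) = (s 0) ^ (-(1 / 2) : ℝ) * (s 0) ^ (-((1 - α) / 2)) := by
      rw [← Real.rpow_add (hs.1 0)]; congr 1; ring
    rw [e1, show -(2 * ((1 - α) / 2)) = α - 1 by ring]
    ring
  have hm : Measurable fun s : Fin (n + 1) → ℝ =>
      (s 0) ^ (α / 2 - 1) * ∏ i : Fin n, (s i.succ) ^ (α - 1) :=
    ((measurable_pi_apply 0).pow_const _).mul
      (Finset.measurable_fun_prod _ fun i _ => (measurable_pi_apply _).pow_const _)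
  rw [setLIntegral_congr_fun (measurableSet_simplex (n + 1) t) e,
    lintegral_const_mul _ hm.ennreal_ofReal, hd, ← ENNReal.ofReal_mul (by positivity)]
  rw [show 1 + (α / 2 + n * α) = 1 + α / 2 + n * α by ring,
    show 1 + α / 2 + n * α - 1 = α / 2 + n * α by ring]

lemma measurable_sourceWeight {A α t : ℝ} (n : ℕ) : Measurable fun s : Fin (n + 1) → ℝ =>
    (s 0) ^ (-(1 / 2) : ℝ) * chainWeight A t ((1 - α) / 2) s :=
  ((measurable_pi_apply 0).pow_const _).mul measurable_chainWeight

lemma sourceWeight_nonneg {A α t : ℝ} (hA : 0 ≤ A) (n : ℕ) : ∀ s ∈ simplex (n + 1) t,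
    0 ≤ (s 0) ^ (-(1 / 2) : ℝ) * chainWeight A t ((1 - α) / 2) s := fun _ hs =>
  mul_nonneg (Real.rpow_nonneg (hs.1 0).le _) (chainWeight_nonneg hA (pos_of_mem_simplex hs).le hs.1)

lemma integrableOn_sourceWeight {A α t : ℝ} (hα : 0 < α) (hA : 0 ≤ A) (ht : 0 < t) (n : ℕ) :
    IntegrableOn (fun s : Fin (n + 1) → ℝ => (s 0) ^ (-(1 / 2) : ℝ) *
      chainWeight A t ((1 - α) / 2) s) (simplex (n + 1) t) := by
  refine ⟨(measurable_sourceWeight n).aestronglyMeasurable, ?_⟩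
  rw [hasFiniteIntegral_iff_ofReal]
  · rw [lintegral_sourceWeight hα hA ht]; exact ENNReal.ofReal_lt_top
  · rw [EventuallyLE, ae_restrict_iff' (measurableSet_simplex _ _)]
    exact Eventually.of_forall (sourceWeight_nonneg hA n)

lemma tendsto_integral_sourceWeight {A α t : ℝ} (hα : 0 < α) (hA : 0 ≤ A) (ht : 0 < t) :
    Tendsto (fun n => ∫ s in simplex (n + 1) t, (s 0) ^ (-(1 / 2) : ℝ) *
      chainWeight A t ((1 - α) / 2) s) atTop (𝓝 0) := by
  have hGα := Real.Gamma_pos_of_pos hα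
  have hGα2 := Real.Gamma_pos_of_pos (half_pos hα)
  set B := A * t ^ ((1 + α) / 2) * Real.Gamma α with hB
  have hB0 : 0 ≤ B := by positivity
  have hs := ((summable_pow_div_Gamma hα (by positivity : 0 < 1 + α / 2) hB0).mul_left
    (2 * Real.Gamma (α / 2) * t ^ (1 / 2 : ℝ))).tendsto_atTop_zero
  refine hs.congr fun n => ?_
  have hGn : 0 < Real.Gamma (1 + α / 2 + n * α) := Real.Gamma_pos_of_pos (by positivity)
  rw [integral_eq_lintegral_of_nonneg_ae
    ((ae_restrict_iff' (measurableSet_simplex _ _)).2 (Eventually.of_forall (sourceWeight_nonneg hA n)))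
    (measurable_sourceWeight n).aestronglyMeasurable, lintegral_sourceWeight hα hA ht,
    ENNReal.toReal_ofReal (by positivity)]
  have e2 : t ^ ((1 - α) / 2 * ((n : ℝ) + 1)) * t ^ (α / 2 + n * α) =
      t ^ (1 / 2 : ℝ) * (t ^ ((1 + α) / 2)) ^ n := by
    rw [← Real.rpow_mul_natCast ht.le, ← Real.rpow_add ht, ← Real.rpow_add ht]
    congr 1; ring
  calc _ = 2 * A ^ n * (Real.Gamma (α / 2) * Real.Gamma α ^ n / Real.Gamma (1 + α / 2 + n * α)) *
        (t ^ (1 / 2 : ℝ) * (t ^ ((1 + α) / 2)) ^ n) := by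
        rw [hB]; simp only [mul_pow]; ring
    _ = _ := by rw [← e2]; ring

/-- The source moments integrated over the simplex, with the exponential weight of the last time. -/
def sourceTerm (κ : ℝ) (ρ : Torus → ℝ) (μ : ℝ) (e e' : L2) (n : ℕ) (t : ℝ) (y : Torus) : ℝ :=
  ∫ s in simplex (n + 1) t, Real.exp (μ * (t - ∑ i, s i)) * sourceMoment κ ρ e e' n s y

lemma exists_sourceTerm_integrand_bound (hα : 0 < α) (hα1 : α ≤ 1) (hρ : HolderTorus C α ρ) (μ : ℝ)
    (E : C(Torus, ℝ)) (e' : L2) (t : ℝ) :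
    ∃ c, 0 ≤ c ∧ ∀ (n : ℕ), ∀ s ∈ simplex (n + 1) t, ∀ y,
      ‖Real.exp (μ * (t - ∑ i, s i)) * sourceMoment κ ρ (toL2 E) e' n s y‖ ≤
        c * ((s 0) ^ (-(1 / 2) : ℝ) * chainWeight (chainConst κ C α t) t ((1 - α) / 2) s) := by
  obtain ⟨c, hc0, hc⟩ := exists_sourceMoment_bound (κ := κ) hα hα1 hρ E e' t
  refine ⟨Real.exp (|μ| * t) * c, by positivity, fun n s hs y => ?_⟩
  have ht := pos_of_mem_simplex hs
  have hsum0 : 0 ≤ ∑ i, s i := Finset.sum_nonneg fun i _ => (hs.1 i).le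
  have hle : ∀ i, s i ≤ t := fun i =>
    (Finset.single_le_sum (f := s) (fun j _ => (hs.1 j).le) (Finset.mem_univ i)).trans hs.2.le
  rw [norm_mul, Real.norm_eq_abs, Real.norm_eq_abs, Real.abs_exp, mul_assoc]
  have h1 := hc t le_rfl n s hs.1 hle y
  have h2 : μ * (t - ∑ i, s i) ≤ |μ| * t :=
    mul_le_mul (le_abs_self μ) (by linarith) (sub_nonneg.2 hs.2.le) (abs_nonneg _)
  exact mul_le_mul (Real.exp_le_exp.2 h2) h1 (abs_nonneg _) (Real.exp_pos _).le

lemma measurable_sourceTerm_integrand (hρ : Measurable ρ) (μ : ℝ) (e e' : L2) (n : ℕ) (t : ℝ)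
    (y : Torus) : Measurable fun s : Fin (n + 1) → ℝ =>
      Real.exp (μ * (t - ∑ i, s i)) * sourceMoment κ ρ e e' n s y :=
  (((measurable_const.sub (Finset.measurable_fun_sum _ fun i _ => measurable_pi_apply i)).const_mul
    μ).exp).mul (measurable_sourceMoment hρ e e' n y)

lemma integrableOn_sourceTerm (hα : 0 < α) (hα1 : α ≤ 1) (hρ : HolderTorus C α ρ) (μ : ℝ)
    (E : C(Torus, ℝ)) (e' : L2) (n : ℕ) {t : ℝ} (ht : 0 < t) (y : Torus) :
    IntegrableOn (fun s => Real.exp (μ * (t - ∑ i, s i)) * sourceMoment κ ρ (toL2 E) e' n s y)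
      (simplex (n + 1) t) := by
  obtain ⟨c, hc0, hc⟩ := exists_sourceTerm_integrand_bound (κ := κ) hα hα1 hρ μ E e' t
  refine ((integrableOn_sourceWeight hα (chainConst_nonneg (κ := κ) (α := α) hρ.nonneg ht.le) ht
    n).const_mul c).mono' (measurable_sourceTerm_integrand (hρ.continuous hα).measurable μ _ e' n t
      y).aestronglyMeasurable ?_
  exact (ae_restrict_iff' (measurableSet_simplex _ _)).2 (Eventually.of_forall fun s hs => hc n s hs y)

lemma tendsto_sourceTerm (hα : 0 < α) (hα1 : α ≤ 1) (hρ : HolderTorus C α ρ) (μ : ℝ)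
    (E : C(Torus, ℝ)) (e' : L2) {t : ℝ} (ht : 0 < t) (y : Torus) :
    Tendsto (fun n => sourceTerm κ ρ μ (toL2 E) e' n t y) atTop (𝓝 0) := by
  obtain ⟨c, hc0, hc⟩ := exists_sourceTerm_integrand_bound (κ := κ) hα hα1 hρ μ E e' t
  have hA := chainConst_nonneg (κ := κ) (α := α) hρ.nonneg ht.le
  refine squeeze_zero_norm (fun n => ?_)
    (by simpa only [mul_zero] using (tendsto_integral_sourceWeight hα hA ht).const_mul c)
  rw [← integral_const_mul]
  refine norm_integral_le_of_norm_le ((integrableOn_sourceWeight hα hA ht n).const_mul c) ?_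
  exact (ae_restrict_iff' (measurableSet_simplex _ _)).2 (Eventually.of_forall fun s hs => hc n s hs y)

/-! ### The telescoping identity -/

lemma integral_kernelTerm_mul (hα : 0 < α) (hα1 : α ≤ 1) (hρ : HolderTorus C α ρ) (e : L2) (n : ℕ)
    {t : ℝ} (ht : 0 < t) (y : Torus) :
    IntegrableOn (fun s => moment κ ρ e n (fullTimes t s) y) (simplex n t) ∧
    ∫ x, kernelTerm κ ρ n t x y * e x = ∫ s in simplex n t, moment κ ρ e n (fullTimes t s) y := by
  have hA := chainConst_nonneg (κ := κ) (α := α) hρ.nonneg ht.le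
  obtain ⟨M, hM0, hM⟩ := exists_bound_of_continuous (continuous_heat (by linarith : 0 < 4 * t))
  have hm : Measurable fun p : Torus × (Fin n → ℝ) => chain κ ρ n (fullTimes t p.2) p.1 y :=
    (measurable_chain (hρ.continuous hα).measurable n).comp
      (((measurable_fullTimes t).comp measurable_snd).prodMk (measurable_fst.prodMk measurable_const))
  have hint : Integrable (fun p : Torus × (Fin n → ℝ) => chain κ ρ n (fullTimes t p.2) p.1 y * e p.1)
      (volume.prod (volume.restrict (simplex n t))) := by
    refine ((integrable_coeFn e).abs.mul_prod ((integrableOn_chainWeight (A := chainConst κ C α t)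
      (v := 0) hα hA (by norm_num) n).mul_const M)).mono' (hm.mul
        ((Lp.stronglyMeasurable e).measurable.comp measurable_fst)).aestronglyMeasurable ?_
    have hs : ∀ᵐ p : Torus × (Fin n → ℝ) ∂(volume.prod (volume.restrict (simplex n t))),
        p.2 ∈ simplex n t :=
      Measure.quasiMeasurePreserving_snd.ae (ae_restrict_mem (measurableSet_simplex n t))
    filter_upwards [hs] with p hp
    rw [norm_mul, Real.norm_eq_abs, Real.norm_eq_abs, mul_comm]
    refine mul_le_mul_of_nonneg_left ?_ (abs_nonneg _)
    refine (abs_chain_fullTimes_le (κ := κ) hα hα1 hρ le_rfl hp p.1 y).trans ?_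
    refine mul_le_mul_of_nonneg_left ((le_abs_self _).trans (hM _)) ?_
    exact mul_nonneg (Real.rpow_nonneg (fullTimes_pos hp 0).le _)
      (chainWeight_nonneg hA ht.le (fullTimes_pos hp))
  refine ⟨hint.integral_prod_right, ?_⟩
  simp only [kernelTerm, ← integral_mul_const]
  exact integral_integral_swap hint

/-- Variation of constants integrated over the simplex. The auxiliary time a runs over (0, t − ∑ sᵢ)
and becomes the first coordinate of a simplex one dimension higher; the integrating factor is the
exponential of the new slack. -/
lemma IsEigenpair.integral_moment (hα : 0 < α) (hα1 : α ≤ 1) (hρ : HolderTorus C α ρ) {μ : ℝ}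
    {E : C(Torus, ℝ)} {e' : L2} (he : IsEigenpair κ ρ μ (toL2 E) e') {n : ℕ} {t : ℝ} (ht : 0 < t)
    {y : Torus} {L : (Fin n → ℝ) → ℝ} (hL : ∀ s : Fin n → ℝ, (∀ i, 0 < s i) →
      Tendsto (fun a => moment κ ρ (toL2 E) n (Fin.cons (α := fun _ => ℝ) a s) y) (𝓝[>] 0) (𝓝 (L s)))
    (hLi : IntegrableOn (fun s => Real.exp (μ * (t - ∑ i, s i)) * L s) (simplex n t)) :
    ∫ x, kernelTerm κ ρ n t x y * toL2 E x =
      (∫ s in simplex n t, Real.exp (μ * (t - ∑ i, s i)) * L s) -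
        sourceTerm κ ρ μ (toL2 E) e' n t y := by
  obtain ⟨h1, h2, h3⟩ := integral_simplex_succ
    (integrableOn_sourceTerm (κ := κ) hα hα1 hρ μ E e' n ht y)
  rw [(integral_kernelTerm_mul hα hα1 hρ (toL2 E) n ht y).2, sourceTerm, h1, ← integral_sub hLi h2]
  refine integral_congr_ae ?_
  filter_upwards [h3, ae_restrict_mem (measurableSet_simplex n t)] with s hs3 hs
  have hr : 0 < t - ∑ i, s i := sub_pos.2 hs.2
  have e : ∀ a, Real.exp (μ * (t - ∑ i, (Fin.cons (α := fun _ => ℝ) a s : Fin (n + 1) → ℝ) i)) =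
      Real.exp (μ * (t - ∑ i, s i - a)) := fun a => by
    rw [Fin.sum_univ_succ]
    simp only [Fin.cons_zero, Fin.cons_succ]
    congr 2; ring
  simp only [e] at hs3 ⊢
  refine moment_eq_of_tendsto hα hα1 hρ he hs.1 hr (hL s hs.1) ?_
  rw [intervalIntegrable_iff_integrableOn_Ioo_of_le hr.le]
  exact hs3

lemma setIntegral_simplex_zero {t : ℝ} (ht : 0 < t) (f : (Fin 0 → ℝ) → ℝ) :
    ∫ s in simplex 0 t, f s = f default := by
  have hu : simplex 0 t = univ := by
    ext s; simp [simplex, ht]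
  rw [hu, Measure.restrict_univ, Measure.volume_pi_eq_dirac, integral_dirac]
  exact congrArg f (Subsingleton.elim _ _)

lemma integrableOn_simplex_zero (t : ℝ) (f : (Fin 0 → ℝ) → ℝ) : IntegrableOn f (simplex 0 t) := by
  refine Integrable.integrableOn ?_
  rw [Measure.volume_pi_eq_dirac]
  exact integrable_dirac (by simp)

/-- The kernel, integrated in its first variable against an eigenvector. -/
theorem IsEigenpair.integral_kernel_mul (hα : 0 < α) (hα1 : α ≤ 1) (hρ : HolderTorus C α ρ) {μ : ℝ}
    {E : C(Torus, ℝ)} {e' : L2} (he : IsEigenpair κ ρ μ (toL2 E) e')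
    (hE : Tendsto (fun t => heatC t (toL2 E)) (𝓝[>] 0) (𝓝 E)) {t : ℝ} (ht : 0 < t) (y : Torus) :
    ∫ x, (heat t (x - y) + remainderSum κ ρ t x y) * toL2 E x = Real.exp (μ * t) * E y := by
  have hρm := (hρ.continuous hα).measurable
  set A := fun n => sourceTerm κ ρ μ (toL2 E) e' n t y with hAdef
  have h0 : ∫ x, heat t (x - y) * toL2 E x = Real.exp (μ * t) * E y - A 0 := by
    have := he.integral_moment hα hα1 hρ (n := 0) ht (y := y) (L := fun _ => E y)
      (fun s _ => tendsto_moment_zero hE s y) (integrableOn_simplex_zero _ _)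
    rw [setIntegral_simplex_zero ht] at this
    simp only [Finset.univ_eq_empty, Finset.sum_empty, sub_zero] at this
    rw [← this]
    refine integral_congr_ae (Eventually.of_forall fun x => ?_)
    simp only [kernelTerm, setIntegral_simplex_zero ht]
    congr 2
    simp [fullTimes]
  -- The boundary value of a chain with n + 1 steps is the source moment with n steps, whose
  -- weighted integral is A n.
  have hsucc : ∀ n, ∫ x, kernelTerm κ ρ (n + 1) t x y * toL2 E x = A n - A (n + 1) := fun n =>
    he.integral_moment hα hα1 hρ ht (fun s hs => tendsto_moment_succ hα hα1 hρ he.1 hs y)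
      (integrableOn_sourceTerm hα hα1 hρ μ E e' n ht y)
  obtain ⟨D, hD, hD0, hb⟩ := exists_kernelTerm_uniform_bound (κ := κ) hα hα1 hρ t
  have hmk : ∀ n, Measurable fun x => kernelTerm κ ρ (n + 1) t x y := fun n =>
    (measurable_kernelTerm hρm (n + 1) t).comp (measurable_id.prodMk measurable_const)
  have hik : ∀ n, Integrable fun x => kernelTerm κ ρ (n + 1) t x y * toL2 E x := fun n =>
    integrable_bdd_mul (hmk n) (fun x => hb t le_rfl n x y) (integrable_coeFn _)
  have hsum : HasSum (fun n => A n - A (n + 1)) (∫ x, remainderSum κ ρ t x y * toL2 E x) := by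
    have := hasSum_integral_of_summable_integral_norm hik (Summable.of_nonneg_of_le
      (fun n => integral_nonneg fun x => norm_nonneg _) (fun n => ?_) (hD.mul_right ‖toL2 E‖))
    · simp only [hsucc, tsum_mul_right] at this
      exact this
    · calc ∫ x, ‖kernelTerm κ ρ (n + 1) t x y * toL2 E x‖ ≤ ∫ x, D n * |toL2 E x| := by
            refine integral_mono (hik n).norm ((integrable_coeFn _).abs.const_mul _) fun x => ?_
            simp only [norm_mul, Real.norm_eq_abs]
            exact mul_le_mul_of_nonneg_right (hb t le_rfl n x y) (abs_nonneg _)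
        _ ≤ _ := by
            rw [integral_const_mul]
            exact mul_le_mul_of_nonneg_left (integral_abs_le_norm _) (hD0 n)
  -- The source terms tend to 0, being dominated by terms of a convergent Mittag-Leffler series.
  have htel : HasSum (fun n => A n - A (n + 1)) (A 0) := by
    have h1 := hsum.summable.hasSum.tendsto_sum_nat
    have h2 : Tendsto (fun n => ∑ i ∈ Finset.range n, (A i - A (i + 1))) atTop (𝓝 (A 0 - 0)) := by
      simp only [Finset.sum_range_sub']
      exact tendsto_const_nhds.sub (tendsto_sourceTerm hα hα1 hρ μ E e' ht y)
    rw [sub_zero] at h2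
    rw [← tendsto_nhds_unique h1 h2]
    exact hsum.summable.hasSum
  have hc := continuous_heat ht
  obtain ⟨c, -, hcb⟩ := exists_remainderSum_bound (κ := κ) hα hα1 hρ t
  simp only [add_mul]
  have i2 : Integrable fun x => remainderSum κ ρ t x y * toL2 E x :=
    integrable_bdd_mul ((measurable_remainderSum hα hα1 hρ t).comp
      (measurable_id.prodMk measurable_const)) (fun x => hcb t le_rfl x y) (integrable_coeFn _)
  rw [integral_add (integrable_continuous_mul (φ := fun x => heat t (x - y)) (by fun_prop)
    (integrable_coeFn _)) i2, h0, hsum.unique htel]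
  ring

end RoughTorus
end

/-! ### Diagonal semigroups, their generator, and the operators given by the kernel. -/

noncomputable section

namespace RoughTorus

/-! ### Semigroups which are diagonal on the eigenvectors of a self-adjoint operator -/

section Abstract

variable {E : Type*} [NormedAddCommGroup E] [InnerProductSpace ℝ E]
  {H : E →ₗ.[ℝ] E}

/-- The eigenvectors of an unbounded operator. -/
def eigenvectors (H : E →ₗ.[ℝ] E) : Set E := {e | ∃ μ : ℝ, (e, μ • e) ∈ H.graph}

/-- Self-adjointness as maximality: every pair that is formally adjoint to the whole graph already
lies in it. -/
lemma mem_graph_iff_of_isSelfAdjoint [CompleteSpace E] (hH : IsSelfAdjoint H) {f w : E} :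
    (f, w) ∈ H.graph ↔ ∀ a b, (a, b) ∈ H.graph → inner ℝ b f = inner ℝ a w := by
  have h1 := LinearPMap.adjoint_graph_eq_graph_adjoint (T := H) hH.dense_domain
  rw [LinearPMap.isSelfAdjoint_def.1 hH] at h1
  conv_lhs => rw [h1]
  rw [Submodule.mem_adjoint_iff]
  simp only [sub_eq_zero]

lemma eq_of_forall_inner_eigenvectors
    (hd : Dense (Submodule.span ℝ (eigenvectors H) : Set E)) {u v : E}
    (h : ∀ e ∈ eigenvectors H, inner ℝ u e = inner ℝ v e) : u = v := by
  have hc : innerSL ℝ u = innerSL ℝ v := ContinuousLinearMap.ext_on hd fun e he => h e he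
  exact ext_inner_right ℝ fun z => congrArg (fun L : E →L[ℝ] ℝ => L z) hc

/-- An operator whose adjoint is a function of `H` is its own adjoint. -/
lemma eq_of_adjoint_diagonal [CompleteSpace E] (hH : IsSelfAdjoint H)
    (hd : Dense (Submodule.span ℝ (eigenvectors H) : Set E)) {P Q : E →L[ℝ] E}
    (hPQ : ∀ f g, inner ℝ (P f) g = inner ℝ f (Q g)) {c : ℝ → ℝ}
    (hQ : ∀ e μ, (e, μ • e) ∈ H.graph → Q e = c μ • e) : P = Q := by
  refine ContinuousLinearMap.ext_on hd ?_
  rintro e ⟨μ, he⟩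
  refine eq_of_forall_inner_eigenvectors hd ?_
  rintro z ⟨ν, hz⟩
  rw [hPQ, hQ z ν hz, hQ e μ he, real_inner_smul_left, real_inner_smul_right]
  -- Symmetry of H gives μ⟨e, z⟩ = ν⟨e, z⟩: either e and z are orthogonal or their eigenvalues
  -- coincide.
  have h := ((mem_graph_iff_of_isSelfAdjoint hH).1 hz) e _ he
  rw [real_inner_smul_left, real_inner_smul_right] at h
  rcases eq_or_ne (inner ℝ e z) 0 with h0 | h0
  · rw [h0, mul_zero, mul_zero]
  · rw [mul_right_cancel₀ h0 h]

variable {S : ℝ → E →L[ℝ] E}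

lemma semigroup_of_diagonal (hd : Dense (Submodule.span ℝ (eigenvectors H) : Set E))
    (hS : ∀ t ≥ 0, ∀ e μ, (e, μ • e) ∈ H.graph → S t e = Real.exp (μ * t) • e)
    {s t : ℝ} (hs : 0 ≤ s) (ht : 0 ≤ t) : S (t + s) = (S t).comp (S s) := by
  refine ContinuousLinearMap.ext_on hd ?_
  rintro e ⟨μ, he⟩
  rw [ContinuousLinearMap.comp_apply, hS s hs e μ he, map_smul, hS t ht e μ he,
    hS (t + s) (add_nonneg ht hs) e μ he, smul_smul, ← Real.exp_add]
  congr 2; ring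

lemma continuousOn_of_diagonal (hd : Dense (Submodule.span ℝ (eigenvectors H) : Set E))
    (hS : ∀ t ≥ 0, ∀ e μ, (e, μ • e) ∈ H.graph → S t e = Real.exp (μ * t) • e)
    (hb : ∀ T, ∃ A, ∀ t ∈ Icc 0 T, ‖S t‖ ≤ A) (f : E) :
    ContinuousOn (fun t => S t f) (Ici 0) := by
  intro t₀ ht₀
  obtain ⟨A, hA⟩ := hb (t₀ + 1)
  refine tendsto_of_dense (S := S) (S₀ := S t₀) (M := A) ?_ hd ?_ f
  · filter_upwards [self_mem_nhdsWithin,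
      mem_nhdsWithin_of_mem_nhds (Iio_mem_nhds (lt_add_one t₀))] with t h1 h2
    exact hA t ⟨h1, le_of_lt h2⟩
  · intro g hg
    induction hg using Submodule.span_induction with
    | mem e he =>
      obtain ⟨μ, he⟩ := he
      rw [hS t₀ ht₀ e μ he]
      have hc : Continuous fun t : ℝ => Real.exp (μ * t) • e := by fun_prop
      refine ((hc.tendsto t₀).mono_left nhdsWithin_le_nhds).congr' ?_
      filter_upwards [self_mem_nhdsWithin] with t ht
      rw [hS t ht e μ he]
    | zero => simp only [map_zero]; exact tendsto_const_nhds
    | add x y _ _ hx hy => simpa only [map_add] using hx.add hy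
    | smul c x _ hx => simpa only [map_smul] using hx.const_smul c

/-- The generator of a symmetric diagonal semigroup is the self-adjoint operator. -/
lemma generator_of_diagonal [CompleteSpace E] (hH : IsSelfAdjoint H)
    (hd : Dense (Submodule.span ℝ (eigenvectors H) : Set E)) (h0 : S 0 = ContinuousLinearMap.id ℝ E)
    (hS : ∀ t ≥ 0, ∀ e μ, (e, μ • e) ∈ H.graph → S t e = Real.exp (μ * t) • e)
    (hb : ∀ T, ∃ A, ∀ t ∈ Icc 0 T, ‖S t‖ ≤ A)
    (hsymm : ∀ t ≥ 0, ∀ f g, inner ℝ (S t f) g = inner ℝ f (S t g)) (f w : E) :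
    Tendsto (fun t : ℝ => t⁻¹ • (S t f - f)) (𝓝[>] 0) (𝓝 w) ↔ (f, w) ∈ H.graph := by
  have hgen : ∀ f w, (f, w) ∈ H.graph →
      Tendsto (fun t : ℝ => t⁻¹ • (S t f - f)) (𝓝[>] 0) (𝓝 w) := by
    intro f w hfw
    have hcont := continuousOn_of_diagonal hd hS hb w
    have hint : ∀ t, 0 ≤ t → IntervalIntegrable (fun s => S s w) volume 0 t := fun t ht =>
      (hcont.mono (by rw [uIcc_of_le ht]; exact fun s hs => hs.1)).intervalIntegrable
    -- Tested on an eigenvector, both sides equal (e^(μt) − 1)⟨f, e⟩. Dividing by t and using strong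
    -- continuity at 0 gives the derivative w.
    have hrep : ∀ t, 0 ≤ t → S t f - f = ∫ s in (0 : ℝ)..t, S s w := by
      intro t ht
      refine eq_of_forall_inner_eigenvectors hd ?_
      rintro e ⟨μ, he⟩
      have h1 : inner ℝ w e = μ * inner ℝ f e := by
        have := ((mem_graph_iff_of_isSelfAdjoint hH).1 he) f w hfw
        rwa [real_inner_smul_right] at this
      have h2 : inner ℝ (∫ s in (0 : ℝ)..t, S s w) e = ∫ s in (0 : ℝ)..t, inner ℝ (S s w) e := by
        have := ((innerSL ℝ e).intervalIntegral_comp_comm (hint t ht)).symm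
        rw [real_inner_comm]
        refine this.trans (intervalIntegral.integral_congr fun s _ => ?_)
        exact real_inner_comm _ _
      have h3 : ∫ s in (0 : ℝ)..t, inner ℝ (S s w) e =
          ∫ s in (0 : ℝ)..t, Real.exp (μ * s) * μ * inner ℝ f e := by
        refine intervalIntegral.integral_congr fun s hs => ?_
        rw [uIcc_of_le ht] at hs
        rw [hsymm s hs.1, hS s hs.1 e μ he, real_inner_smul_right, h1]; ring
      have h4 : ∫ s in (0 : ℝ)..t, Real.exp (μ * s) * μ = Real.exp (μ * t) - 1 := by
        rw [intervalIntegral.integral_eq_sub_of_hasDerivAt (f := fun s => Real.exp (μ * s))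
          (fun s _ => by
            have : HasDerivAt (fun s : ℝ => μ * s) μ s := by
              simpa using (hasDerivAt_id s).const_mul μ
            exact this.exp) (Continuous.intervalIntegrable (by fun_prop) _ _)]
        simp
      rw [h2, h3, intervalIntegral.integral_mul_const, h4, inner_sub_left, hsymm t ht,
        hS t ht e μ he, real_inner_smul_right]
      ring
    have hder : HasDerivWithinAt (fun t => ∫ s in (0 : ℝ)..t, S s w) (S 0 w) (Ioi 0) 0 :=
      (intervalIntegral.integral_hasDerivWithinAt_right (a := 0) (b := 0) (s := Ici 0) (t := Ioi 0)
        (by simp) ((hcont.mono Ioi_subset_Ici_self).stronglyMeasurableAtFilter_nhdsWithin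
          measurableSet_Ioi 0)
        ((hcont 0 self_mem_Ici).mono Ioi_subset_Ici_self)).mono Ioi_subset_Ici_self
    rw [hasDerivWithinAt_iff_tendsto_slope' (by simp), h0, ContinuousLinearMap.id_apply] at hder
    refine hder.congr' ?_
    filter_upwards [self_mem_nhdsWithin] with t ht
    rw [slope_def_module, intervalIntegral.integral_same, sub_zero, sub_zero, hrep t (le_of_lt ht)]
  -- Conversely, the difference quotients are symmetric, so a limit w is formally adjoint to the
  -- graph, which is maximal.
  refine ⟨fun h => (mem_graph_iff_of_isSelfAdjoint hH).2 fun a b hab => ?_, hgen f w⟩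
  have h1 := h.inner (𝕜 := ℝ) (tendsto_const_nhds (x := a))
  have h2 := (tendsto_const_nhds (x := f)).inner (𝕜 := ℝ) (hgen a b hab)
  rw [real_inner_comm f b, real_inner_comm w a]
  refine (tendsto_nhds_unique_of_eventuallyEq h1 h2 ?_).symm
  filter_upwards [self_mem_nhdsWithin] with t ht
  rw [real_inner_smul_left, real_inner_smul_right, inner_sub_left, inner_sub_right,
    hsymm t (le_of_lt ht)]

end Abstract

/-! ### The kernel -/

variable {C α : ℝ} {κ : ℝ} {ρ : Torus → ℝ} {R : ℝ → ℝ}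

/-- The kernel of the semigroup. -/
def fullKernel (κ : ℝ) (ρ : Torus → ℝ) (t : ℝ) (p : Torus × Torus) : ℝ :=
  heat t (p.1 - p.2) + remainderSum κ ρ t p.1 p.2

lemma measurable_fullKernel (hα : 0 < α) (hα1 : α ≤ 1) (hρ : HolderTorus C α ρ) {t : ℝ} (ht : 0 < t) :
    Measurable (fullKernel κ ρ t) := by
  have hc := continuous_heat ht
  exact Measurable.add (Continuous.measurable (by fun_prop)) (measurable_remainderSum hα hα1 hρ t)

lemma exists_fullKernel_bound (hα : 0 < α) (hα1 : α ≤ 1) (hρ : HolderTorus C α ρ) {t : ℝ} (ht : 0 < t) :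
    ∃ M, ∀ p, |fullKernel κ ρ t p| ≤ M := by
  obtain ⟨M, -, hM⟩ := exists_bound_of_continuous (continuous_heat ht)
  obtain ⟨c, -, hc⟩ := exists_remainderSum_bound (κ := κ) hα hα1 hρ t
  exact ⟨M + c, fun p => (abs_add_le _ _).trans (add_le_add (hM _) (hc t le_rfl _ _))⟩

lemma exists_integral_fullKernel_bound (hα : 0 < α) (hα1 : α ≤ 1) (hρ : HolderTorus C α ρ) (T : ℝ) :
    ∃ A, 1 ≤ A ∧ ∀ t, 0 < t → t ≤ T → (∀ x, ∫ y, |fullKernel κ ρ t (x, y)| ≤ A) ∧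
      ∀ y, ∫ x, |fullKernel κ ρ t (x, y)| ≤ A := by
  obtain ⟨c, hc0, hc⟩ := exists_remainderSum_bound (κ := κ) hα hα1 hρ T
  refine ⟨1 + c, by linarith, fun t ht htT => ?_⟩
  have hcont := continuous_heat ht
  have hb : ∀ x y, |fullKernel κ ρ t (x, y)| ≤ heat t (x - y) + c := fun x y =>
    (abs_add_le _ _).trans (add_le_add (abs_of_nonneg (heat_nonneg _ _)).le (hc t htT x y))
  refine ⟨fun x => ?_, fun y => ?_⟩
  · calc _ ≤ ∫ y, (heat t (x - y) + c) :=
          integral_mono_of_nonneg (Eventually.of_forall fun _ => abs_nonneg _)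
            (Continuous.integrable_torus (by fun_prop)) (Eventually.of_forall fun y => hb x y)
      _ = _ := by
          rw [integral_add (Continuous.integrable_torus (by fun_prop)) (integrable_const _),
            integral_heat_sub_right ht]
          simp
  · calc _ ≤ ∫ x, (heat t (x - y) + c) :=
          integral_mono_of_nonneg (Eventually.of_forall fun _ => abs_nonneg _)
            (Continuous.integrable_torus (by fun_prop)) (Eventually.of_forall fun x => hb x y)
      _ = _ := by
          rw [integral_add (Continuous.integrable_torus (by fun_prop)) (integrable_const _),
            integral_heat_sub_left ht]
          simp

lemma kernelOp_eq (hα : 0 < α) (hα1 : α ≤ 1) (hR : ContinuousOn R (Icc 0 1))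
    (hρ : HolderTorus C α (periodicPart R)) {t : ℝ} (ht : 0 < t) (f : Torus → ℝ) (x : Torus) :
    kernelOp R t f x = ∫ y, fullKernel (R 1 - R 0) (periodicPart R) t (x, y) * f y := by
  rw [kernelOp, if_neg ht.ne']
  simp only [kernel, heatKernel_eq_heat ht, remainder_eq_remainderSum hα hα1 hR hρ]
  rfl

/-- The kernels define operators on `L²` which are diagonal on the eigenvectors of the form
operator. -/
theorem exists_semigroup (hα : 0 < α) (hα1 : α ≤ 1) (hρ : HolderTorus C α ρ) {H : L2 →ₗ.[ℝ] L2}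
    (hH : IsSelfAdjoint H) (hg : ∀ f w, (f, w) ∈ H.graph ↔ formGraph κ ρ f w)
    (hd : Dense (Submodule.span ℝ (eigenvectors H) : Set L2)) :
    ∃ S : ℝ → L2 →L[ℝ] L2, S 0 = ContinuousLinearMap.id ℝ L2 ∧
      (∀ t > 0, ∀ f, S t f =ᵐ[volume] fun x => ∫ y, fullKernel κ ρ t (x, y) * f y) ∧
      (∀ t ≥ 0, ∀ e μ, (e, μ • e) ∈ H.graph → S t e = Real.exp (μ * t) • e) ∧
      (∀ T, ∃ A, ∀ t ∈ Icc 0 T, ‖S t‖ ≤ A) ∧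
      ∀ t ≥ 0, ∀ f g, inner ℝ (S t f) g = inner ℝ f (S t g) := by
  have hex : ∀ t : ℝ, 0 < t → ∃ S : L2 →L[ℝ] L2,
      (∀ f, S f =ᵐ[volume] fun x => ∫ y, fullKernel κ ρ t (x, y) * f y) ∧
      (∀ e μ, (e, μ • e) ∈ H.graph → S e = Real.exp (μ * t) • e) ∧
      (∀ A, 1 ≤ A → ((∀ x, ∫ y, |fullKernel κ ρ t (x, y)| ≤ A) ∧
        ∀ y, ∫ x, |fullKernel κ ρ t (x, y)| ≤ A) → ‖S‖ ≤ A) ∧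
      ∀ f g, inner ℝ (S f) g = inner ℝ f (S g) := by
    intro t ht
    have hm := measurable_fullKernel (κ := κ) hα hα1 hρ ht
    have hm' : Measurable fun p : Torus × Torus => fullKernel κ ρ t (p.2, p.1) :=
      hm.comp measurable_swap
    obtain ⟨M, hM⟩ := exists_fullKernel_bound (κ := κ) hα hα1 hρ ht
    obtain ⟨A, hA1, hA⟩ := exists_integral_fullKernel_bound (κ := κ) hα hα1 hρ t
    obtain ⟨hA2, hA3⟩ := hA t ht le_rfl
    have hA0 : 0 < A := by linarith
    obtain ⟨S, -, hS⟩ := exists_kernel_operator hm hM hA0 hA2 hA3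
    obtain ⟨S', -, hS'⟩ := exists_kernel_operator (K := fun p => fullKernel κ ρ t (p.2, p.1)) hm'
      (fun p => hM _) hA0 hA3 hA2
    have hadj := inner_kernel_operator hm hM hS hS'
    -- The telescoping integrates over the first variable of the kernel, so it diagonalises the
    -- transposed operator.
    have hdiag : ∀ e μ, (e, μ • e) ∈ H.graph → S' e = Real.exp (μ * t) • e := by
      intro e μ he
      obtain ⟨e', hw, hf⟩ := (hg _ _).1 he
      obtain ⟨E, rfl, hE, -⟩ := hw.exists_rep
      have hp : IsEigenpair κ ρ μ (toL2 E) e' := ⟨hw, hf⟩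
      refine Lp.ext ?_
      filter_upwards [hS' (toL2 E), Lp.coeFn_smul (Real.exp (μ * t)) (toL2 E), coeFn_toL2 E]
        with y h1 h2 h3
      rw [h1, h2, Pi.smul_apply, h3, smul_eq_mul]
      exact hp.integral_kernel_mul hα hα1 hρ hE ht y
    have hSS : S = S' := eq_of_adjoint_diagonal hH hd hadj (c := fun μ => Real.exp (μ * t)) hdiag
    refine ⟨S, hS, by rw [hSS]; exact hdiag, fun A hA1 hA => ?_, fun f g => by
      rw [hadj, ← hSS]⟩
    -- The operator is determined by its kernel, so Schur's test applies with any admissible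
    -- constant, in particular one uniform over bounded times.
    obtain ⟨S'', hn, hS''⟩ := exists_kernel_operator hm hM (by linarith : 0 < A) hA.1 hA.2
    have : S = S'' := ContinuousLinearMap.ext fun f => Lp.ext ((hS f).trans (hS'' f).symm)
    rw [this]; exact hn
  choose! S h1 h2 h3 h4 using hex
  refine ⟨fun t => if 0 < t then S t else ContinuousLinearMap.id ℝ L2, if_neg (lt_irrefl 0),
    fun t ht => ?_, fun t ht e μ he => ?_, fun T => ?_, fun t ht f g => ?_⟩
  · simp only [if_pos ht]; exact h1 t ht
  · rcases ht.eq_or_lt with rfl | ht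
    · simp
    · simp only [if_pos ht]; exact h2 t ht e μ he
  · obtain ⟨A, hA1, hA⟩ := exists_integral_fullKernel_bound (κ := κ) hα hα1 hρ T
    refine ⟨A, fun t ht => ?_⟩
    rcases ht.1.eq_or_lt with rfl | ht0
    · simp only [lt_irrefl, if_false]
      exact ContinuousLinearMap.norm_id_le.trans hA1
    · simp only [if_pos ht0]; exact h3 t ht0 A hA1 (hA t ht0 ht.2)
  · rcases ht.eq_or_lt with rfl | ht
    · simp
    · simp only [if_pos ht]; exact h4 t ht f g

/-! ### The semigroup on continuous functions -/

lemma integrable_fullKernel_mul (hα : 0 < α) (hα1 : α ≤ 1) (hρ : HolderTorus C α ρ) {t : ℝ}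
    (ht : 0 < t) (x : Torus) {f : Torus → ℝ} (hf : Integrable f) :
    Integrable fun y => fullKernel κ ρ t (x, y) * f y := by
  obtain ⟨M, hM⟩ := exists_fullKernel_bound (κ := κ) hα hα1 hρ ht
  exact integrable_bdd_mul ((measurable_fullKernel hα hα1 hρ ht).comp
    (measurable_const.prodMk measurable_id)) (fun y => hM (x, y)) hf

/-- The heat part is a convolution with a continuous kernel; the remainder is Lipschitz in x by the
integrated estimate with exponent 1. -/
lemma continuous_integral_fullKernel (hα : 0 < α) (hα1 : α ≤ 1) (hρ : HolderTorus C α ρ) {t : ℝ}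
    (ht : 0 < t) (f : C(Torus, ℝ)) : Continuous fun x => ∫ y, fullKernel κ ρ t (x, y) * f y := by
  have hf : Integrable f := f.continuous.integrable_torus
  have hc := continuous_heat ht
  obtain ⟨c, -, hcb⟩ := exists_remainderSum_bound (κ := κ) hα hα1 hρ t
  have hi : ∀ x, Integrable fun y => remainderSum κ ρ t x y * f y := fun x =>
    integrable_bdd_mul (measurable_remainderSum_right hα hα1 hρ t x) (fun y => hcb t le_rfl x y) hf
  have e : (fun x => ∫ y, fullKernel κ ρ t (x, y) * f y) =
      fun x => (∫ y, heat t (x - y) * f y) + ∫ y, remainderSum κ ρ t x y * f y := by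
    funext x
    rw [← integral_add (integrable_continuous_mul (φ := fun y => heat t (x - y)) (by fun_prop) hf)
      (hi x)]
    simp only [fullKernel, add_mul]
  rw [e]
  refine (continuous_conv hc hf).add ?_
  obtain ⟨d, hd0, hd⟩ := exists_integral_remainderSum_sub_bound (κ := κ) hα hα1 hρ t one_pos le_rfl
  refine (LipschitzWith.of_dist_le_mul (K := (‖f‖ * d).toNNReal) fun x x' => ?_).continuous
  rw [Real.dist_eq, ← integral_sub (hi x) (hi x'), Real.coe_toNNReal _ (by positivity)]
  have hi2 : Integrable fun y => |remainderSum κ ρ t x y - remainderSum κ ρ t x' y| :=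
    ((integrable_remainderSum hα hα1 hρ t x).sub (integrable_remainderSum hα hα1 hρ t x')).abs
  calc _ ≤ ∫ y, ‖f‖ * |remainderSum κ ρ t x y - remainderSum κ ρ t x' y| := by
        rw [← Real.norm_eq_abs]
        refine norm_integral_le_of_norm_le (hi2.const_mul _) (Eventually.of_forall fun y => ?_)
        rw [← sub_mul, norm_mul, mul_comm, Real.norm_eq_abs (_ - _)]
        exact mul_le_mul_of_nonneg_right (f.norm_coe_le_norm y) (abs_nonneg _)
    _ ≤ ‖f‖ * (dist x x' ^ (1 : ℝ) * d) := by
        rw [integral_const_mul]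
        exact mul_le_mul_of_nonneg_left (hd t le_rfl x x') (norm_nonneg _)
    _ = _ := by rw [Real.rpow_one]; ring

lemma exists_continuous_operator (hα : 0 < α) (hα1 : α ≤ 1) (hρ : HolderTorus C α ρ) {t : ℝ}
    (ht : 0 < t) : ∃ S : C(Torus, ℝ) →L[ℝ] C(Torus, ℝ),
      ∀ f x, S f x = ∫ y, fullKernel κ ρ t (x, y) * f y := by
  obtain ⟨A, hA1, hA⟩ := exists_integral_fullKernel_bound (κ := κ) hα hα1 hρ t
  have hi : ∀ (f : C(Torus, ℝ)) x, Integrable fun y => fullKernel κ ρ t (x, y) * f y := fun f x =>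
    integrable_fullKernel_mul hα hα1 hρ ht x f.continuous.integrable_torus
  let L : C(Torus, ℝ) →ₗ[ℝ] C(Torus, ℝ) :=
    { toFun := fun f => ⟨_, continuous_integral_fullKernel (κ := κ) hα hα1 hρ ht f⟩
      map_add' := fun f g => by
        ext x
        simp only [ContinuousMap.coe_mk, ContinuousMap.add_apply, mul_add]
        exact integral_add (hi f x) (hi g x)
      map_smul' := fun c f => by
        ext x
        simp only [ContinuousMap.coe_mk, ContinuousMap.smul_apply, smul_eq_mul, RingHom.id_apply,
          mul_left_comm _ c, integral_const_mul] }
  refine ⟨L.mkContinuous A fun f => ?_, fun f x => rfl⟩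
  refine (ContinuousMap.norm_le _ (by positivity)).2 fun x => ?_
  have hKi : Integrable fun y => |fullKernel κ ρ t (x, y)| := by
    have := integrable_fullKernel_mul (κ := κ) hα hα1 hρ ht x (f := fun _ => 1) (integrable_const _)
    simpa only [mul_one] using this.abs
  calc ‖L f x‖ ≤ ∫ y, ‖f‖ * |fullKernel κ ρ t (x, y)| := by
        refine norm_integral_le_of_norm_le (hKi.const_mul _) (Eventually.of_forall fun y => ?_)
        rw [norm_mul, mul_comm, Real.norm_eq_abs (fullKernel κ ρ t _)]
        exact mul_le_mul_of_nonneg_right (f.norm_coe_le_norm y) (abs_nonneg _)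
    _ ≤ A * ‖f‖ := by
        rw [integral_const_mul, mul_comm]
        exact mul_le_mul_of_nonneg_right ((hA t ht le_rfl).1 x) (norm_nonneg _)

/-- The semigroup property passes from `L²` to continuous functions. -/
lemma exists_continuous_semigroup (hα : 0 < α) (hα1 : α ≤ 1) (hR : ContinuousOn R (Icc 0 1))
    (hρ : HolderTorus C α (periodicPart R)) {S : ℝ → L2 →L[ℝ] L2}
    (hS : ∀ t > 0, ∀ f, S t f =ᵐ[volume]
      fun x => ∫ y, fullKernel (R 1 - R 0) (periodicPart R) t (x, y) * f y)
    (hsg : ∀ s ≥ 0, ∀ t ≥ 0, S (t + s) = (S t).comp (S s)) :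
    ∃ P : ℝ → C(Torus, ℝ) →L[ℝ] C(Torus, ℝ),
      (∀ t ≥ 0, ∀ f x, P t f x = kernelOp R t f x) ∧ P 0 = ContinuousLinearMap.id ℝ _ ∧
      ∀ s ≥ 0, ∀ t ≥ 0, P (t + s) = (P t).comp (P s) := by
  choose! Q hQ using fun (t : ℝ) (ht : 0 < t) =>
    exists_continuous_operator (κ := R 1 - R 0) hα hα1 hρ ht
  have hQL : ∀ t > 0, ∀ f, toL2 (Q t f) = S t (toL2 f) := by
    intro t ht f
    refine Lp.ext (((coeFn_toL2 _).trans (Eventually.of_forall fun x => ?_)).trans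
      (hS t ht (toL2 f)).symm)
    rw [hQ t ht]
    refine integral_congr_ae ?_
    filter_upwards [coeFn_toL2 f] with y hy
    rw [hy]
  refine ⟨fun t => if 0 < t then Q t else ContinuousLinearMap.id ℝ _, fun t ht f x => ?_,
    if_neg (lt_irrefl 0), fun s hs t ht => ?_⟩
  · rcases ht.eq_or_lt with rfl | ht
    · simp [kernelOp]
    · simp only [if_pos ht]
      rw [hQ t ht, kernelOp_eq hα hα1 hR hρ ht]
  · rcases hs.eq_or_lt with rfl | hs
    · simp
    rcases ht.eq_or_lt with rfl | ht
    · simp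
    simp only [if_pos hs, if_pos ht, if_pos (add_pos ht hs)]
    ext1 f
    -- Both sides are continuous, so equality almost everywhere is enough, and this is the law
    -- already known on L².
    refine toL2_injective ?_
    rw [ContinuousLinearMap.comp_apply, hQL _ (add_pos ht hs), hQL t ht, hQL s hs,
      hsg s hs.le t ht.le, ContinuousLinearMap.comp_apply]

end RoughTorus
end

/-! ### The proposition. -/

theorem mainTheorem2 (α : NNReal) (hα : 0 < α) (hα1 : α ≤ 1) (R : ℝ → ℝ)
    (hR : ∃ C : NNReal, HolderOnWith C α R (Set.Icc 0 1)) :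
    -- every integral in the terms of the series exists
    (∀ (n : ℕ) (s : Fin (n + 1) → ℝ), (∀ i, 0 < s i) → ∀ x y : RoughTorus.Torus,
      RoughTorus.RSIntegrableN R n (RoughTorus.pathWeight s x y)) ∧
    (∀ (n : ℕ) (t : ℝ) (x y : RoughTorus.Torus),
      IntegrableOn (fun s => RoughTorus.innerTerm R (RoughTorus.fullTimes t s) x y)
        (RoughTorus.simplex n t)) ∧
    -- convergence of the series and bounds on the remainder
    (∀ T : ℝ,
      (∀ t ∈ Set.Icc 0 T, ∀ x y : RoughTorus.Torus,
        Summable fun n : ℕ => |RoughTorus.seriesTerm R (n + 1) t x y|) ∧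
      TendstoUniformlyOn
        (fun (N : ℕ) (q : ℝ × RoughTorus.Torus × RoughTorus.Torus) =>
          ∑ n ∈ Finset.range N, RoughTorus.seriesTerm R (n + 1) q.1 q.2.1 q.2.2)
        (fun q => RoughTorus.remainder R q.1 q.2.1 q.2.2)
        atTop (Set.Icc 0 T ×ˢ Set.univ) ∧
      (∀ t ∈ Set.Icc 0 T, ∀ x : RoughTorus.Torus,
        Integrable fun y => RoughTorus.remainder R t x y) ∧
      (∃ c : ℝ, ∀ t ∈ Set.Icc 0 T, ∀ x : RoughTorus.Torus,
        ∫ y, |RoughTorus.remainder R t x y| ≤ c) ∧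
      (∀ u ∈ Set.Ioc (0 : ℝ) 1, ∃ c : ℝ, ∀ t ∈ Set.Icc 0 T, ∀ x x' : RoughTorus.Torus,
        ∫ y, |RoughTorus.remainder R t x y - RoughTorus.remainder R t x' y|
          ≤ dist x x' ^ u * c) ∧
      (∃ c : ℝ, ∀ t ∈ Set.Icc 0 T, ∀ x y : RoughTorus.Torus,
        |RoughTorus.remainder R t x y| ≤ c) ∧
      (∀ u ∈ Set.Ioc (0 : ℝ) 1, ∃ c : ℝ, ∀ t ∈ Set.Ioc 0 T, ∀ x x' y : RoughTorus.Torus,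
        |RoughTorus.remainder R t x y - RoughTorus.remainder R t x' y|
          ≤ dist x x' ^ u / t ^ (u / 2) * c)) ∧
    -- the operators on `C(𝕋)`
    (∃ S : ℝ → C(RoughTorus.Torus, ℝ) →L[ℝ] C(RoughTorus.Torus, ℝ),
      (∀ t ≥ 0, ∀ f x, S t f x = RoughTorus.kernelOp R t f x) ∧
      S 0 = ContinuousLinearMap.id ℝ _ ∧
      ∀ s ≥ 0, ∀ t ≥ 0, S (t + s) = (S t).comp (S s)) ∧
    -- the form operator, and the semigroup on `L²(𝕋)` which it generates
    (∃ H : RoughTorus.L2 →ₗ.[ℝ] RoughTorus.L2,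
      RoughTorus.IsFormOperator R H ∧ Dense (H.domain : Set RoughTorus.L2) ∧ IsSelfAdjoint H ∧
      ∃ S : ℝ → RoughTorus.L2 →L[ℝ] RoughTorus.L2,
        (∀ t ≥ 0, ∀ f : RoughTorus.L2, S t f =ᵐ[volume] RoughTorus.kernelOp R t f) ∧
        S 0 = ContinuousLinearMap.id ℝ _ ∧
        (∀ s ≥ 0, ∀ t ≥ 0, S (t + s) = (S t).comp (S s)) ∧
        (∀ f, ContinuousOn (fun t => S t f) (Set.Ici 0)) ∧
        ∀ f w : RoughTorus.L2,
          Tendsto (fun t : ℝ => t⁻¹ • (S t f - f)) (𝓝[>] 0) (𝓝 w) ↔ (f, w) ∈ H.graph) := by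
  have hα0 : (0 : ℝ) < α := by exact_mod_cast hα
  have hα' : (α : ℝ) ≤ 1 := by exact_mod_cast hα1
  have hRc : ContinuousOn R (Icc 0 1) := hR.choose_spec.continuousOn hα
  obtain ⟨C, hρ⟩ := RoughTorus.exists_holderTorus_periodicPart hα hα1 hR
  have hc := hρ.continuous hα0
  obtain ⟨H, hg, hdom, hH, hspan⟩ := RoughTorus.exists_form_operator hc (R 1 - R 0)
  have hd : Dense (Submodule.span ℝ (RoughTorus.eigenvectors H) : Set RoughTorus.L2) := by
    simpa only [RoughTorus.eigenvectors, hg] using hspan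
  obtain ⟨S, h0, hk, hdiag, hb, hsymm⟩ := RoughTorus.exists_semigroup hα0 hα' hρ hH hg hd
  have hsg : ∀ s ≥ 0, ∀ t ≥ 0, S (t + s) = (S t).comp (S s) := fun s hs t ht =>
    RoughTorus.semigroup_of_diagonal hd hdiag hs ht
  refine ⟨fun n s hs x y => (RoughTorus.rsIntegrableN_and_innerTerm_eq hα0 hα' hRc hρ hs x y).1,
    RoughTorus.integrableOn_innerTerm hα0 hα' hRc hρ, RoughTorus.series_bounds hα0 hα' hRc hρ,
    ?_, H, fun f w => (hg f w).trans (RoughTorus.formGraph_iff hc f w), hdom, hH, S, ?_, h0, hsg,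
    RoughTorus.continuousOn_of_diagonal hd hdiag hb,
    RoughTorus.generator_of_diagonal hH hd h0 hdiag hb hsymm⟩
  · exact RoughTorus.exists_continuous_semigroup hα0 hα' hRc hρ hk hsg
  · intro t ht f
    rcases ht.eq_or_lt with rfl | ht
    · rw [h0]
      exact Eventually.of_forall fun x => by simp [RoughTorus.kernelOp]
    · exact (hk t ht f).trans
        (Eventually.of_forall fun x => (RoughTorus.kernelOp_eq hα0 hα' hRc hρ ht f x).symm)
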